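/- Comparison principle. Let $N\in\mathbb N$, $T>0$, let $U,V$ be nonempty compact subsets of finite dimensional real vector spaces, and let $f:\mathbb R^N\times U\times V\to\mathbb R^N$ be bounded, uniformly continuous, and Lipschitz continuous in $x$ uniformly in $(u,v)$; $\|f\|_\infty=\sup|f|$. Let $\mathcal W$ be the set of Borel probability measures on $\mathbb R^N$ with finite second moment, with the Wasserstein distance ${\bf d}^2(\mu,\nu)=\inf_{\pi\in\Pi(\mu,\nu)}\int|x-y|^2\,d\pi(x,y)$, where $\Pi(\mu,\nu)$ is the set of probability measures on $\mathbb R^{2N}$ with first marginal $\mu$ and second marginal $\nu$, and let $\Pi_{opt}(\mu,\nu)$ be the set of minimizers. For $\mu\in\mathcal W$ and ${\bf p}\in L^2_\mu(\mathbb R^N,\mathbb R^N)$ set $$H(\mu,{\bf p})=\sup_{{\bf v}\in\Delta(V)}\int_{\mathbb R^N}\inf_{{\bf u}\in\Delta(U)}\int_{U\times V}\langle f(x,u,v),{\bf p}(x)\rangle\,d{\bf u}(u)\,d{\bf v}(v)\,d\mu(x),$$ where $\Delta(U),\Delta(V)$ are the sets of Borel probability measures on $U$ and $V$. A Lipschitz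 continuous $w:[0,T]\times\mathcal W\to\mathbb R$ is a subsolution of $$w_t+H(\mu,D_\mu w)=0\quad\text{in }[0,T)\times\mathcal W \qquad (\ast)$$ if for all smooth $\psi:\mathbb R\to\mathbb R$, all $\alpha,\eta>0$, $\bar\mu,\bar\nu\in\mathcal W$ and $\bar t\in[0,T)$ such that $w-\varphi$, with $\varphi(t,\mu)=\frac\alpha2{\bf d}^2(\bar\mu,\mu)+\eta\,{\bf d}(\bar\nu,\mu)+\psi(t)$, has a local maximum (relative to $[0,T]\times\mathcal W$) at $(\bar t,\bar\nu)$, and for every $\bar\pi\in\Pi_{opt}(\bar\mu,\bar\nu)$, one has $\psi'(\bar t)+H(\bar\nu,-\alpha{\bf p})\ge-\|f\|_\infty\eta$, where ${\bf p}$ is the unique element of $L^2_{\bar\nu}(\mathbb R^N,\mathbb R^N)$ with $\int\langle\xi(y),x-y\rangle\,d\bar\pi(x,y)=\int\langle\xi(y),{\bf p}(y)\rangle\,d\bar\nu(y)$ for all $\xi\in L^2_{\bar\nu}(\mathbb R^N,\mathbb R^N)$. It is a supersolution if, for all such data, whenever $w-\varphi$ with $\varphi(t,\mu)=-\frac\alpha2{\bf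 d}^2(\bar\mu,\mu)-\eta\,{\bf d}(\bar\nu,\mu)+\psi(t)$ has a local minimum at $(\bar t,\bar\nu)$, one has $\psi'(\bar t)+H(\bar\nu,\alpha{\bf p})\le\|f\|_\infty\eta$ for every $\bar\pi\in\Pi_{opt}(\bar\mu,\bar\nu)$ with associated ${\bf p}$. A solution is a function that is both a subsolution and a supersolution. Let $w_1$ be a Lipschitz continuous subsolution and $w_2$ a Lipschitz continuous supersolution of $(\ast)$ with $w_1(T,\mu)\le w_2(T,\mu)$ for all $\mu\in\mathcal W$. Then $w_1\le w_2$ on $[0,T]\times\mathcal W$. Consequently, for every Lipschitz continuous $\tilde g:\mathcal W\to\mathbb R$ there is at most one Lipschitz continuous solution $w$ of $(\ast)$ on $[0,T]\times\mathcal W$ with $w(T,\mu)=\tilde g(\mu)$ for all $\mu\in\mathcal W$. -/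

import Mathlib

open MeasureTheory
open scoped ContDiff

noncomputable section

/-- Points of `ℝ^N` with the Euclidean norm. -/
abbrev Space (N : ℕ) : Type := EuclideanSpace ℝ (Fin N)

/-- The space `𝒲` of Borel probability measures on `ℝ^N` with finite second order moment. -/
def WSpace (N : ℕ) : Type :=
  {μ : ProbabilityMeasure (Space N) //
    Integrable (fun x : Space N => ‖x‖ ^ 2) (μ : Measure (Space N))}

namespace WSpace

/-- The underlying measure of an element of `𝒲`. -/
def meas {N : ℕ} (μ : WSpace N) : Measure (Space N) := (μ.1 : Measure (Space N))

end WSpace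

/-- Transport plans: the measures on `ℝ^N × ℝ^N` with first marginal `μ` and second marginal `ν`
(these are automatically probability measures). -/
def plans {N : ℕ} (μ ν : WSpace N) : Set (Measure (Space N × Space N)) :=
  {π | π.map Prod.fst = μ.meas ∧ π.map Prod.snd = ν.meas}

/-- The quadratic transport cost of a plan. -/
def transportCost {N : ℕ} (π : Measure (Space N × Space N)) : ℝ :=
  ∫ z, ‖z.1 - z.2‖ ^ 2 ∂π

/-- The Wasserstein distance `𝐝` on `𝒲`. -/
def wdist {N : ℕ} (μ ν : WSpace N) : ℝ :=
  Real.sqrt (sInf (transportCost '' plans μ ν))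

/-- Optimal transport plans: the minimizers of the transport cost. -/
def optPlans {N : ℕ} (μ ν : WSpace N) : Set (Measure (Space N × Space N)) :=
  {π | π ∈ plans μ ν ∧ ∀ π' ∈ plans μ ν, transportCost π ≤ transportCost π'}

/-- `p` is (a representative of) the unique element of `L²_ν(ℝ^N, ℝ^N)` such that
`∫ ⟨ξ(y), x - y⟩ dπ(x,y) = ∫ ⟨ξ(y), p(y)⟩ dν(y)` for all `ξ ∈ L²_ν(ℝ^N, ℝ^N)`. -/
def IsPlanGradient {N : ℕ} (ν : WSpace N) (π : Measure (Space N × Space N))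
    (p : Space N → Space N) : Prop :=
  MemLp p 2 ν.meas ∧
    ∀ ξ : Space N → Space N, MemLp ξ 2 ν.meas →
      ∫ z, inner ℝ (ξ z.2) (z.1 - z.2) ∂π = ∫ y, inner ℝ (ξ y) (p y) ∂ν.meas

section Equation

variable {N : ℕ} {EU EV : Type*}
  [NormedAddCommGroup EU] [MeasurableSpace EU] [NormedAddCommGroup EV] [MeasurableSpace EV]
  {U : Set EU} {V : Set EV}

/-- The Hamiltonian
`H(μ, p) = sup_{v ∈ Δ(V)} ∫ inf_{u ∈ Δ(U)} ∫ ⟨f(x,u,v), p(x)⟩ du dv dμ(x)`. -/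
def hamiltonian (f : Space N → U → V → Space N) (μ : WSpace N) (p : Space N → Space N) : ℝ :=
  ⨆ v : ProbabilityMeasure V, ∫ x, (⨅ u : ProbabilityMeasure U,
    ∫ z : U × V, inner ℝ (f x z.1 z.2) (p x) ∂((u : Measure U).prod (v : Measure V))) ∂μ.meas

/-- The sup norm `‖f‖_∞`. -/
def supNorm (f : Space N → U → V → Space N) : ℝ :=
  ⨆ z : Space N × U × V, ‖f z.1 z.2.1 z.2.2‖

/-- `F` has a local maximum at `(t, ν)`, relative to `[0,T] × 𝒲`. -/
def HasLocalMax (T : ℝ) (F : ℝ → WSpace N → ℝ) (t : ℝ) (ν : WSpace N) : Prop :=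
  ∃ r : ℝ, 0 < r ∧ ∀ s ∈ Set.Icc (0 : ℝ) T, ∀ μ : WSpace N,
    |s - t| < r → wdist ν μ < r → F s μ ≤ F t ν

/-- `F` has a local minimum at `(t, ν)`, relative to `[0,T] × 𝒲`. -/
def HasLocalMin (T : ℝ) (F : ℝ → WSpace N → ℝ) (t : ℝ) (ν : WSpace N) : Prop :=
  ∃ r : ℝ, 0 < r ∧ ∀ s ∈ Set.Icc (0 : ℝ) T, ∀ μ : WSpace N,
    |s - t| < r → wdist ν μ < r → F t ν ≤ F s μ

/-- Lipschitz continuity on `[0,T] × 𝒲`. -/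
def LipschitzOnStrip (T : ℝ) (w : ℝ → WSpace N → ℝ) : Prop :=
  ∃ K : ℝ, ∀ s ∈ Set.Icc (0 : ℝ) T, ∀ t ∈ Set.Icc (0 : ℝ) T, ∀ μ ν : WSpace N,
    |w s μ - w t ν| ≤ K * (|s - t| + wdist μ ν)

/-- Lipschitz continuity on `𝒲`. -/
def LipschitzOnW (g : WSpace N → ℝ) : Prop :=
  ∃ K : ℝ, ∀ μ ν : WSpace N, |g μ - g ν| ≤ K * wdist μ ν

/-- Lipschitz subsolutions of `w_t + H(μ, D_μ w) = 0` in `[0,T) × 𝒲`. -/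
def IsSubsolution (T : ℝ) (f : Space N → U → V → Space N) (w : ℝ → WSpace N → ℝ) : Prop :=
  LipschitzOnStrip T w ∧
  ∀ (ψ : ℝ → ℝ) (α η : ℝ) (μbar νbar : WSpace N) (tbar : ℝ),
    ContDiff ℝ ∞ ψ → 0 < α → 0 < η → tbar ∈ Set.Ico (0 : ℝ) T →
    HasLocalMax T
      (fun t μ => w t μ - (α / 2 * wdist μbar μ ^ 2 + η * wdist νbar μ + ψ t)) tbar νbar →
    ∀ π ∈ optPlans μbar νbar, ∀ p : Space N → Space N, IsPlanGradient νbar π p →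
      deriv ψ tbar + hamiltonian f νbar (fun y => -(α • p y)) ≥ -(supNorm f * η)

/-- Lipschitz supersolutions of `w_t + H(μ, D_μ w) = 0` in `[0,T) × 𝒲`. -/
def IsSupersolution (T : ℝ) (f : Space N → U → V → Space N) (w : ℝ → WSpace N → ℝ) : Prop :=
  LipschitzOnStrip T w ∧
  ∀ (ψ : ℝ → ℝ) (α η : ℝ) (μbar νbar : WSpace N) (tbar : ℝ),
    ContDiff ℝ ∞ ψ → 0 < α → 0 < η → tbar ∈ Set.Ico (0 : ℝ) T →
    HasLocalMin T
      (fun t μ => w t μ - (-(α / 2 * wdist μbar μ ^ 2) - η * wdist νbar μ + ψ t)) tbar νbar →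
    ∀ π ∈ optPlans μbar νbar, ∀ p : Space N → Space N, IsPlanGradient νbar π p →
      deriv ψ tbar + hamiltonian f νbar (fun y => α • p y) ≤ supNorm f * η

/-- Lipschitz (viscosity) solutions: both sub- and supersolutions. -/
def IsSolution (T : ℝ) (f : Space N → U → V → Space N) (w : ℝ → WSpace N → ℝ) : Prop :=
  IsSubsolution T f w ∧ IsSupersolution T f w

end Equation

end

open Filter Topology ProbabilityTheory
open scoped ENNReal NNReal BoundedContinuousFunction

noncomputable section

set_option linter.unusedSectionVars false

/-! ### Random vectors in L², their laws and joint laws -/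

section Law

variable {N : ℕ} {Ω Ω' : Type*} [MeasurableSpace Ω] [MeasurableSpace Ω']

/-! Optimal plans are realised by pairs of L² random vectors, so that Wasserstein estimates become
Hilbert space estimates. Doubling of variables, with Ekeland's principle in the complete space
`WSpace N` in place of local compactness (`exists_doubling`), produces an optimal pair X, Y with
common slope P = A(X - Y). The viscosity inequalities, however, see only the conditional
expectations E[P|X] (subsolution) and E[P|Y] (supersolution). Up to small errors the Hamiltonian is
a maximum of finitely many functionals M_k(X,P) = E[min_i ⟨F_{k,i}(X), P⟩]
(`exists_hamiltonian_net`), each concave in P. Jensen's inequality therefore lets P replace E[P|Y]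
in the supersolution inequality (`IsSupersolution.meanMin_le`), but it points the wrong way for the
subsolution when P is not a function of X.

The remedy is `IsTouch.false_of_violation`: a subsolution admits no touching point with time slope τ
and unprojected slope P = α(X - Xb) such that τ + M_k(X,P) + θ ≤ 0 for every k. To prove it,
consider the penalty J = ε‖P‖² - Σ v_k², where v_k = max(τ + M_k + θ, 0), over all touching points.
Slopes are bounded by the Lipschitz constant, so J is bounded above, and the hypothetical point has
J ≥ 0.

Near the supremum of J let Z be the ascent direction of J in P. The touching point is perturbed by
moving the centre of the quadratic along -σZ, 0 ≤ σ ≤ h, with a reward for large σ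
(`TouchAt.exists_push`). If the optimal σ is below h, its first order condition says that the slope
has moved along Z enough to raise J by a fixed amount, which is impossible. If σ = h, the new point
X' is X - hZ up to a small multiple of h. Optimal couplings are almost monotone, and Z is almost
strongly monotone in P because of ε‖P‖² and the concavity of M_k. Hence two copies sharing the same
X' have almost the same P (`norm_sub_copies_sq_le`). So P is close to its conditional expectation
given X', and the subsolution inequality at X' contradicts the smallness of the v_k. Both cases are
in `IsTouch.exists_penalty_gt`. -/

instance WSpace.isProbabilityMeasure_meas (μ : WSpace N) : IsProbabilityMeasure μ.meas :=
  μ.1.2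

theorem WSpace.ext_meas {μ ν : WSpace N} (h : μ.meas = ν.meas) : μ = ν :=
  Subtype.ext (Subtype.ext h)

theorem WSpace.memLp_id (μ : WSpace N) : MemLp (fun x : Space N => x) 2 μ.meas :=
  (memLp_two_iff_integrable_sq_norm (by fun_prop)).2 μ.2

/-- The element of `𝒲` given by a probability measure with finite second moment. -/
def WSpace.ofMeasure (m : Measure (Space N)) [IsProbabilityMeasure m]
    (h : MemLp (fun x : Space N => x) 2 m) : WSpace N :=
  ⟨⟨m, inferInstance⟩, (memLp_two_iff_integrable_sq_norm (by fun_prop)).1 h⟩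

@[simp] theorem WSpace.ofMeasure_meas (m : Measure (Space N)) [IsProbabilityMeasure m]
    (h : MemLp (fun x : Space N => x) 2 m) : (WSpace.ofMeasure m h).meas = m := rfl

/-- Square integrable random vectors. -/
abbrev RandVec (N : ℕ) {Ω : Type*} [MeasurableSpace Ω] (P : Measure Ω) := Lp (Space N) 2 P

theorem measurable_randVec {P : Measure Ω} (X : RandVec N P) : Measurable (X : Ω → Space N) :=
  (Lp.stronglyMeasurable X).measurable

theorem memLp_id_map {P : Measure Ω} (X : RandVec N P) :
    MemLp (fun x : Space N => x) 2 (P.map X) := by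
  rw [memLp_map_measure_iff (by fun_prop) (measurable_randVec X).aemeasurable]
  exact Lp.memLp X

/-- The law of a square integrable random vector. -/
def lawOf {P : Measure Ω} [IsProbabilityMeasure P] (X : RandVec N P) : WSpace N :=
  haveI := Measure.isProbabilityMeasure_map (μ := P) (measurable_randVec X).aemeasurable
  WSpace.ofMeasure (P.map X) (memLp_id_map X)

@[simp] theorem lawOf_meas {P : Measure Ω} [IsProbabilityMeasure P] (X : RandVec N P) :
    (lawOf X).meas = P.map X := rfl

/-- Composition of a random vector with a measure preserving map. -/
def RandVec.pull {P : Measure Ω} {Q : Measure Ω'} {j : Ω' → Ω} (hj : MeasurePreserving j Q P) :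
    RandVec N P →ₗᵢ[ℝ] RandVec N Q :=
  Lp.compMeasurePreservingₗᵢ ℝ j hj

theorem RandVec.coeFn_pull {P : Measure Ω} {Q : Measure Ω'} {j : Ω' → Ω}
    (hj : MeasurePreserving j Q P) (X : RandVec N P) :
    RandVec.pull hj X =ᵐ[Q] X ∘ j :=
  Lp.coeFn_compMeasurePreserving X hj

theorem lawOf_pull {P : Measure Ω} {Q : Measure Ω'} [IsProbabilityMeasure P]
    [IsProbabilityMeasure Q] {j : Ω' → Ω} (hj : MeasurePreserving j Q P) (X : RandVec N P) :
    lawOf (RandVec.pull hj X) = lawOf X := by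
  apply WSpace.ext_meas
  rw [lawOf_meas, lawOf_meas, Measure.map_congr (RandVec.coeFn_pull hj X),
    ← Measure.map_map (measurable_randVec X) hj.measurable, hj.map_eq]

theorem RandVec.inner_def {P : Measure Ω} (X Y : RandVec N P) :
    inner ℝ X Y = ∫ a, inner ℝ (X a) (Y a) ∂P := L2.inner_def X Y

theorem RandVec.norm_sq {P : Measure Ω} (X : RandVec N P) : ‖X‖ ^ 2 = ∫ a, ‖X a‖ ^ 2 ∂P := by
  rw [← real_inner_self_eq_norm_sq, RandVec.inner_def]
  simp

/-- The joint law of two random vectors. -/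
def jointLaw {P : Measure Ω} (X Y : RandVec N P) : Measure (Space N × Space N) :=
  P.map (fun a => (X a, Y a))

theorem measurable_pair {P : Measure Ω} (X Y : RandVec N P) :
    Measurable (fun a => (X a, Y a)) := (measurable_randVec X).prodMk (measurable_randVec Y)

theorem jointLaw_mem_plans {P : Measure Ω} [IsProbabilityMeasure P] (X Y : RandVec N P) :
    jointLaw X Y ∈ plans (lawOf X) (lawOf Y) := by
  constructor
  · rw [jointLaw, Measure.map_map measurable_fst (measurable_pair X Y)]; rfl
  · rw [jointLaw, Measure.map_map measurable_snd (measurable_pair X Y)]; rfl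

theorem transportCost_jointLaw {P : Measure Ω} [IsProbabilityMeasure P] (X Y : RandVec N P) :
    transportCost (jointLaw X Y) = ‖X - Y‖ ^ 2 := by
  rw [transportCost, jointLaw, integral_map (measurable_pair X Y).aemeasurable
    (by fun_prop), RandVec.norm_sq]
  apply integral_congr_ae
  filter_upwards [Lp.coeFn_sub X Y] with a h
  rw [h]; rfl

end Law

/-! ### Transport plans as pairs of random vectors -/

section Plans

variable {N : ℕ} {μ ν : WSpace N} {π : Measure (Space N × Space N)}

theorem isProbabilityMeasure_of_mem_plans (h : π ∈ plans μ ν) : IsProbabilityMeasure π := by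
  constructor
  have h1 : π.map Prod.fst Set.univ = 1 := by rw [h.1]; simp
  rwa [Measure.map_apply measurable_fst MeasurableSet.univ, Set.preimage_univ] at h1

theorem measurePreserving_fst_of_mem_plans (h : π ∈ plans μ ν) :
    MeasurePreserving Prod.fst π μ.meas := ⟨measurable_fst, h.1⟩

theorem measurePreserving_snd_of_mem_plans (h : π ∈ plans μ ν) :
    MeasurePreserving Prod.snd π ν.meas := ⟨measurable_snd, h.2⟩

theorem memLp_fst_of_mem_plans (h : π ∈ plans μ ν) :
    MemLp (fun z : Space N × Space N => z.1) 2 π :=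
  μ.memLp_id.comp_measurePreserving (measurePreserving_fst_of_mem_plans h)

theorem memLp_snd_of_mem_plans (h : π ∈ plans μ ν) :
    MemLp (fun z : Space N × Space N => z.2) 2 π :=
  ν.memLp_id.comp_measurePreserving (measurePreserving_snd_of_mem_plans h)

/-- The first coordinate as a random vector on a transport plan. -/
def planFst (h : π ∈ plans μ ν) : RandVec N π := (memLp_fst_of_mem_plans h).toLp _

/-- The second coordinate as a random vector on a transport plan. -/
def planSnd (h : π ∈ plans μ ν) : RandVec N π := (memLp_snd_of_mem_plans h).toLp _

theorem coeFn_planFst (h : π ∈ plans μ ν) : planFst h =ᵐ[π] Prod.fst :=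
  (memLp_fst_of_mem_plans h).coeFn_toLp

theorem coeFn_planSnd (h : π ∈ plans μ ν) : planSnd h =ᵐ[π] Prod.snd :=
  (memLp_snd_of_mem_plans h).coeFn_toLp

theorem lawOf_planFst [IsProbabilityMeasure π] (h : π ∈ plans μ ν) : lawOf (planFst h) = μ :=
  WSpace.ext_meas ((Measure.map_congr (coeFn_planFst h)).trans h.1)

theorem lawOf_planSnd [IsProbabilityMeasure π] (h : π ∈ plans μ ν) : lawOf (planSnd h) = ν :=
  WSpace.ext_meas ((Measure.map_congr (coeFn_planSnd h)).trans h.2)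

theorem jointLaw_planFst_planSnd (h : π ∈ plans μ ν) : jointLaw (planFst h) (planSnd h) = π := by
  have : (fun z => (planFst h z, planSnd h z)) =ᵐ[π] id := by
    filter_upwards [coeFn_planFst h, coeFn_planSnd h] with z h1 h2
    rw [h1, h2]; rfl
  rw [jointLaw, Measure.map_congr this, Measure.map_id]

theorem transportCost_eq_norm_sq (h : π ∈ plans μ ν) :
    transportCost π = ‖planFst h - planSnd h‖ ^ 2 := by
  have := isProbabilityMeasure_of_mem_plans h
  rw [← transportCost_jointLaw, jointLaw_planFst_planSnd]

theorem transportCost_nonneg (π : Measure (Space N × Space N)) : 0 ≤ transportCost π :=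
  integral_nonneg fun _ => by positivity

theorem prod_mem_plans (μ ν : WSpace N) : μ.meas.prod ν.meas ∈ plans μ ν := by
  constructor
  · change (μ.meas.prod ν.meas).fst = _; simp
  · change (μ.meas.prod ν.meas).snd = _; simp

theorem bddBelow_transportCost (μ ν : WSpace N) : BddBelow (transportCost '' plans μ ν) :=
  ⟨0, by rintro _ ⟨π, -, rfl⟩; exact transportCost_nonneg π⟩

theorem wdist_nonneg (μ ν : WSpace N) : 0 ≤ wdist μ ν := Real.sqrt_nonneg _

theorem wdist_sq_le_transportCost (h : π ∈ plans μ ν) : wdist μ ν ^ 2 ≤ transportCost π := by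
  rw [wdist, Real.sq_sqrt]
  · exact csInf_le (bddBelow_transportCost μ ν) ⟨π, h, rfl⟩
  · exact le_csInf ⟨_, _, h, rfl⟩ (by rintro _ ⟨π, -, rfl⟩; exact transportCost_nonneg π)

theorem transportCost_of_mem_optPlans (h : π ∈ optPlans μ ν) :
    transportCost π = wdist μ ν ^ 2 := by
  refine le_antisymm ?_ (wdist_sq_le_transportCost h.1)
  rw [wdist, Real.sq_sqrt]
  · exact le_csInf ⟨_, _, h.1, rfl⟩ (by rintro _ ⟨π', h', rfl⟩; exact h.2 π' h')
  · exact le_csInf ⟨_, _, h.1, rfl⟩ (by rintro _ ⟨π, -, rfl⟩; exact transportCost_nonneg π)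

theorem mem_optPlans_of_transportCost_le (h : π ∈ plans μ ν)
    (hc : transportCost π ≤ wdist μ ν ^ 2) : π ∈ optPlans μ ν :=
  ⟨h, fun _ h' => hc.trans (wdist_sq_le_transportCost h')⟩

theorem wdist_lawOf_le {Ω : Type*} [MeasurableSpace Ω] {P : Measure Ω} [IsProbabilityMeasure P]
    (X Y : RandVec N P) : wdist (lawOf X) (lawOf Y) ≤ ‖X - Y‖ := by
  refine le_of_sq_le_sq ?_ (norm_nonneg _)
  rw [← transportCost_jointLaw]
  exact wdist_sq_le_transportCost (jointLaw_mem_plans X Y)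

theorem norm_planFst_sub_planSnd (h : π ∈ optPlans μ ν) :
    ‖planFst h.1 - planSnd h.1‖ = wdist μ ν := by
  have h1 := transportCost_of_mem_optPlans h
  rw [transportCost_eq_norm_sq h.1] at h1
  exact (sq_eq_sq₀ (norm_nonneg _) (wdist_nonneg _ _)).1 h1

end Plans

/-! ### Existence of optimal plans -/

section Compactness

/-- Weak convergence only tests bounded functions, so g is truncated at each n; monotone convergence
writes the sublevel set as an intersection of closed ones. -/
theorem isClosed_lintegral_le {Ω : Type*} [MeasurableSpace Ω] [TopologicalSpace Ω]
    [OpensMeasurableSpace Ω] {g : Ω → ℝ≥0} (hg : Continuous g) (c : ℝ≥0∞) :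
    IsClosed {π : ProbabilityMeasure Ω | ∫⁻ z, g z ∂(π : Measure Ω) ≤ c} := by
  let G : ℕ → Ω →ᵇ ℝ≥0 := fun n => BoundedContinuousFunction.mkOfBound
    ⟨fun z => min (g z) n, hg.min continuous_const⟩ n (fun x y => by
      rw [NNReal.dist_eq, abs_sub_le_iff]
      exact ⟨by simp, by simp⟩)
  have hG : ∀ n z, G n z = min (g z) n := fun n z => rfl
  have key : ∀ π : ProbabilityMeasure Ω, ∫⁻ z, g z ∂(π : Measure Ω)
      = ⨆ n, ∫⁻ z, G n z ∂(π : Measure Ω) := by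
    intro π
    rw [← lintegral_iSup]
    · congr 1 with z
      apply le_antisymm
      · obtain ⟨n, hn⟩ := exists_nat_ge (g z)
        refine le_iSup_of_le n ?_
        rw [hG, min_eq_left hn]
      · exact iSup_le fun n => by rw [hG]; exact_mod_cast min_le_left _ _
    · intro n
      exact ((G n).continuous.measurable).coe_nnreal_ennreal
    · intro m n hmn z
      simp only [hG]
      exact_mod_cast min_le_min_left _ (by exact_mod_cast hmn)
  have : {π : ProbabilityMeasure Ω | ∫⁻ z, g z ∂(π : Measure Ω) ≤ c}
      = ⋂ n, {π : ProbabilityMeasure Ω | ∫⁻ z, G n z ∂(π : Measure Ω) ≤ c} := by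
    ext π; simp [key π]
  rw [this]
  refine isClosed_iInter fun n => ?_
  have hc : Continuous fun π : ProbabilityMeasure Ω =>
      ((π.toFiniteMeasure.testAgainstNN (G n) : ℝ≥0) : ℝ≥0∞) :=
    ENNReal.continuous_coe.comp (ProbabilityMeasure.continuous_testAgainstNN_eval (G n))
  have h2 : ∀ π : ProbabilityMeasure Ω,
      ((π.toFiniteMeasure.testAgainstNN (G n) : ℝ≥0) : ℝ≥0∞) = ∫⁻ z, G n z ∂(π : Measure Ω) := by
    intro π
    rw [FiniteMeasure.testAgainstNN_coe_eq]
    rfl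
  simp_rw [← h2]
  exact isClosed_le hc continuous_const

theorem lowerSemicontinuous_lintegral {Ω : Type*} [MeasurableSpace Ω] [TopologicalSpace Ω]
    [OpensMeasurableSpace Ω] {g : Ω → ℝ≥0} (hg : Continuous g) :
    LowerSemicontinuous fun π : ProbabilityMeasure Ω => ∫⁻ z, g z ∂(π : Measure Ω) :=
  lowerSemicontinuous_iff_isClosed_preimage.2 fun c => isClosed_lintegral_le hg c

variable {N : ℕ}

theorem isCompact_plans (S : Set (ProbabilityMeasure (Space N))) (hS : IsTightMeasureSet
    {((μ : ProbabilityMeasure (Space N)) : Measure (Space N)) | μ ∈ S})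
    (S' : Set (ProbabilityMeasure (Space N))) (hS' : IsTightMeasureSet
    {((μ : ProbabilityMeasure (Space N)) : Measure (Space N)) | μ ∈ S'}) :
    IsCompact (closure {π : ProbabilityMeasure (Space N × Space N) |
      π.map (f := Prod.fst) measurable_fst.aemeasurable ∈ S ∧
      π.map (f := Prod.snd) measurable_snd.aemeasurable ∈ S'}) := by
  apply isCompact_closure_of_isTightMeasureSet
  apply IsTightMeasureSet.prodMk
  · refine hS.subset ?_
    rintro _ ⟨_, ⟨π, hπ, rfl⟩, rfl⟩
    exact ⟨_, hπ.1, rfl⟩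
  · refine hS'.subset ?_
    rintro _ ⟨_, ⟨π, hπ, rfl⟩, rfl⟩
    exact ⟨_, hπ.2, rfl⟩

theorem transportCost_eq_toReal (π : Measure (Space N × Space N)) :
    transportCost π = (∫⁻ z, ((‖z.1 - z.2‖₊ ^ 2 : ℝ≥0) : ℝ≥0∞) ∂π).toReal := by
  rw [transportCost, integral_eq_lintegral_of_nonneg_ae (.of_forall fun _ => by positivity)
    (by fun_prop)]
  congr 2 with z
  rw [← ENNReal.ofReal_coe_nnreal]
  simp

theorem lintegral_ne_top_of_mem_plans {μ ν : WSpace N} {π : Measure (Space N × Space N)}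
    (h : π ∈ plans μ ν) : ∫⁻ z, ((‖z.1 - z.2‖₊ ^ 2 : ℝ≥0) : ℝ≥0∞) ∂π ≠ ⊤ := by
  have := ((memLp_fst_of_mem_plans h).sub (memLp_snd_of_mem_plans h)).integrable_norm_pow (by simp)
  have h2 := this.2
  rw [HasFiniteIntegral] at h2
  convert h2.ne using 3 with z
  simp [enorm_eq_nnnorm]

/-- Direct method: plans with fixed marginals form a closed tight set, hence a compact one, and the
cost is lower semicontinuous. -/
theorem optPlans_nonempty (μ ν : WSpace N) : (optPlans μ ν).Nonempty := by
  let S : Set (ProbabilityMeasure (Space N × Space N)) := {π |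
      π.map (f := Prod.fst) measurable_fst.aemeasurable ∈ ({μ.1} : Set _) ∧
      π.map (f := Prod.snd) measurable_snd.aemeasurable ∈ ({ν.1} : Set _)}
  have hmem : ∀ π : ProbabilityMeasure (Space N × Space N), π ∈ S ↔
      (π : Measure (Space N × Space N)) ∈ plans μ ν := by
    intro π
    constructor
    · intro h
      exact ⟨congrArg Subtype.val h.1, congrArg Subtype.val h.2⟩
    · intro h
      exact ⟨Subtype.ext h.1, Subtype.ext h.2⟩
  have htight : ∀ μ : WSpace N, IsTightMeasureSet
      {((m : ProbabilityMeasure (Space N)) : Measure (Space N)) | m ∈ ({μ.1} : Set _)} := by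
    intro μ
    have := isTightMeasureSet_singleton (μ := μ.meas)
    refine this.subset ?_
    rintro _ ⟨m, hm, rfl⟩
    rw [hm]; rfl
  have hclosed : IsClosed S := by
    refine IsClosed.inter ?_ ?_
    · exact isClosed_singleton.preimage (ProbabilityMeasure.continuous_map continuous_fst)
    · exact isClosed_singleton.preimage (ProbabilityMeasure.continuous_map continuous_snd)
  have hcomp : IsCompact S := by
    have := isCompact_plans {μ.1} (htight μ) {ν.1} (htight ν)
    rwa [show {π : ProbabilityMeasure (Space N × Space N) | _ ∧ _} = S from rfl,
      hclosed.closure_eq] at this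
  have hne : S.Nonempty :=
    ⟨⟨μ.meas.prod ν.meas, inferInstance⟩, (hmem _).2 (prod_mem_plans μ ν)⟩
  obtain ⟨π, hπ, hmin⟩ := LowerSemicontinuousOn.exists_isMinOn hne hcomp
    ((lowerSemicontinuous_lintegral (g := fun z : Space N × Space N => ‖z.1 - z.2‖₊ ^ 2)
      (by fun_prop)).lowerSemicontinuousOn S)
  refine ⟨π, (hmem π).1 hπ, fun π' h' => ?_⟩
  have := isProbabilityMeasure_of_mem_plans h'
  rw [transportCost_eq_toReal, transportCost_eq_toReal]
  apply ENNReal.toReal_mono (lintegral_ne_top_of_mem_plans h')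
  exact isMinOn_iff.1 hmin ⟨π', this⟩ ((hmem _).2 h')

end Compactness

/-! ### Gluing of plans and the Wasserstein pseudometric -/

section Gluing

variable {N : ℕ} {Ω : Type*} [MeasurableSpace Ω] {P : Measure Ω} [IsProbabilityMeasure P]

theorem lawOf_eq_of_jointLaw_mem_plans {X Y : RandVec N P} {μ ν : WSpace N}
    (h : jointLaw X Y ∈ plans μ ν) : lawOf X = μ ∧ lawOf Y = ν := by
  have h' := jointLaw_mem_plans X Y
  exact ⟨WSpace.ext_meas (h'.1.symm.trans h.1), WSpace.ext_meas (h'.2.symm.trans h.2)⟩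

/-- Every transport plan from the law of `A` is realised on an extension of the probability
space. -/
theorem exists_gluing (A : RandVec N P) {ν : WSpace N} {π : Measure (Space N × Space N)}
    (hπ : π ∈ plans (lawOf A) ν) :
    ∃ (Q : Measure (Ω × Space N)) (_ : IsProbabilityMeasure Q)
      (hj : MeasurePreserving Prod.fst Q P) (Y : RandVec N Q),
      jointLaw (RandVec.pull hj A) Y = π ∧ lawOf Y = ν := by
  have := isProbabilityMeasure_of_mem_plans hπ
  have hA := measurable_randVec A
  -- Disintegrate π over its first marginal and sample the second coordinate from the fibre over A;
  -- only the target space has to be standard Borel.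
  let κ : Kernel Ω (Space N) := π.condKernel.comap A hA
  let Q : Measure (Ω × Space N) := P.compProd κ
  have hfst : Q.map Prod.fst = P := Measure.fst_compProd P κ
  have hj : MeasurePreserving Prod.fst Q P := ⟨measurable_fst, hfst⟩
  have hdis : (P.map A).compProd π.condKernel = π := by
    have h1 : π.fst = P.map A := hπ.1
    rw [← h1]
    exact π.disintegrate π.condKernel
  have hmap : Q.map (fun z => (A z.1, z.2)) = π := by
    conv_rhs => rw [← hdis]
    ext s hs
    rw [Measure.map_apply (by fun_prop) hs, Measure.compProd_apply
      (measurableSet_preimage (by fun_prop) hs), Measure.compProd_apply hs,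
      lintegral_map (Kernel.measurable_kernel_prodMk_left hs) hA]
    rfl
  have hsnd : MeasurePreserving Prod.snd Q ν.meas := by
    refine ⟨measurable_snd, ?_⟩
    rw [← hπ.2, ← hmap, Measure.map_map measurable_snd (by fun_prop)]
    rfl
  have hY : MemLp (fun z : Ω × Space N => z.2) 2 Q := ν.memLp_id.comp_measurePreserving hsnd
  have hjoint : jointLaw (RandVec.pull hj A) (hY.toLp _) = π := by
    rw [← hmap]
    apply Measure.map_congr
    filter_upwards [RandVec.coeFn_pull hj A, hY.coeFn_toLp] with a h1 h2
    rw [h1, h2]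
    rfl
  refine ⟨Q, inferInstance, hj, hY.toLp _, hjoint, ?_⟩
  rw [← hjoint] at hπ
  exact (lawOf_eq_of_jointLaw_mem_plans hπ).2

theorem norm_sub_of_jointLaw_mem_optPlans {X Y : RandVec N P} {μ ν : WSpace N}
    (h : jointLaw X Y ∈ optPlans μ ν) : ‖X - Y‖ = wdist μ ν := by
  have h1 := transportCost_of_mem_optPlans h
  rw [transportCost_jointLaw] at h1
  exact (sq_eq_sq₀ (norm_nonneg _) (wdist_nonneg _ _)).1 h1

variable (μ ν ρ : WSpace N)

theorem wdist_self : wdist μ μ = 0 := by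
  obtain ⟨π, h⟩ := optPlans_nonempty μ μ
  have := isProbabilityMeasure_of_mem_plans h.1
  have h1 := wdist_lawOf_le (planFst h.1) (planFst h.1)
  rw [lawOf_planFst, sub_self, norm_zero] at h1
  exact le_antisymm h1 (wdist_nonneg _ _)

theorem wdist_comm_le : wdist μ ν ≤ wdist ν μ := by
  obtain ⟨π, h⟩ := optPlans_nonempty ν μ
  have := isProbabilityMeasure_of_mem_plans h.1
  have h1 := wdist_lawOf_le (planSnd h.1) (planFst h.1)
  rwa [lawOf_planFst, lawOf_planSnd, norm_sub_rev, norm_planFst_sub_planSnd h] at h1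

theorem wdist_comm : wdist μ ν = wdist ν μ :=
  le_antisymm (wdist_comm_le μ ν) (wdist_comm_le ν μ)

/-- Gluing puts both optimal couplings on one probability space with the same middle vector, where
the L² triangle inequality applies. -/
theorem wdist_triangle : wdist μ ρ ≤ wdist μ ν + wdist ν ρ := by
  obtain ⟨π, h⟩ := optPlans_nonempty μ ν
  have := isProbabilityMeasure_of_mem_plans h.1
  obtain ⟨π', h'⟩ := optPlans_nonempty ν ρ
  have h'2 := h'.1
  rw [← lawOf_planSnd h.1] at h'2
  obtain ⟨Q, hQ, hj, Y, hY, hYlaw⟩ := exists_gluing (planSnd h.1) h'2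
  have e1 : ‖RandVec.pull hj (planSnd h.1) - Y‖ = wdist ν ρ :=
    norm_sub_of_jointLaw_mem_optPlans (hY ▸ h')
  have e2 : ‖RandVec.pull hj (planFst h.1) - RandVec.pull hj (planSnd h.1)‖ = wdist μ ν := by
    rw [← map_sub, LinearIsometry.norm_map, norm_planFst_sub_planSnd h]
  calc wdist μ ρ = wdist (lawOf (RandVec.pull hj (planFst h.1))) (lawOf Y) := by
        rw [lawOf_pull, lawOf_planFst, hYlaw]
    _ ≤ ‖RandVec.pull hj (planFst h.1) - Y‖ := wdist_lawOf_le _ _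
    _ ≤ _ := norm_sub_le_norm_sub_add_norm_sub _ (RandVec.pull hj (planSnd h.1)) _
    _ = _ := by rw [e1, e2]

instance : PseudoMetricSpace (WSpace N) where
  dist := wdist
  dist_self := wdist_self
  dist_comm := wdist_comm
  dist_triangle := wdist_triangle

theorem dist_eq_wdist : dist μ ν = wdist μ ν := rfl

end Gluing

/-! ### Completeness of the Wasserstein space -/

section Complete

variable {N : ℕ}

/-- The Dirac mass at the origin. -/
def WSpace.diracZero (N : ℕ) : WSpace N :=
  WSpace.ofMeasure (Measure.dirac 0) (by
    rw [memLp_congr_ae (ae_dirac_eq (a := (0 : Space N)) ▸ (by simp [EventuallyEq] :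
      (fun x : Space N => x) =ᶠ[pure 0] fun _ => 0))]
    exact MemLp.zero)

/-- Serves to turn Wasserstein boundedness into a second moment bound, hence into tightness by
Chebyshev's inequality. -/
theorem integral_norm_sq_eq (μ : WSpace N) :
    ∫ x, ‖x‖ ^ 2 ∂μ.meas = wdist μ (WSpace.diracZero N) ^ 2 := by
  obtain ⟨π, h⟩ := optPlans_nonempty μ (WSpace.diracZero N)
  have hs : ∀ᵐ z ∂π, z.2 = 0 := by
    have h1 : ∀ᵐ y ∂(π.map Prod.snd), y = 0 := by
      rw [h.1.2, WSpace.diracZero, WSpace.ofMeasure_meas, ae_dirac_eq]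
      simp
    exact ae_of_ae_map measurable_snd.aemeasurable h1
  rw [← transportCost_of_mem_optPlans h, transportCost, ← h.1.1,
    integral_map measurable_fst.aemeasurable (by fun_prop)]
  apply integral_congr_ae
  filter_upwards [hs] with z hz
  simp [hz]

theorem lintegral_norm_sq_eq (μ : WSpace N) :
    ∫⁻ x, ((‖x‖₊ ^ 2 : ℝ≥0) : ℝ≥0∞) ∂μ.meas =
      ENNReal.ofReal (wdist μ (WSpace.diracZero N) ^ 2) := by
  have h : Integrable (fun x : Space N => ‖x‖ ^ 2) μ.meas := μ.2
  rw [← integral_norm_sq_eq, ofReal_integral_eq_lintegral_ofReal h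
    (.of_forall fun _ => by positivity)]
  congr 1 with x
  rw [← ENNReal.ofReal_coe_nnreal]
  simp

theorem lintegral_sub_sq_eq {μ ν : WSpace N} {π : Measure (Space N × Space N)}
    (h : π ∈ optPlans μ ν) : ∫⁻ z, ((‖z.1 - z.2‖₊ ^ 2 : ℝ≥0) : ℝ≥0∞) ∂π =
      ENNReal.ofReal (wdist μ ν ^ 2) := by
  rw [← transportCost_of_mem_optPlans h, transportCost_eq_toReal,
    ENNReal.ofReal_toReal (lintegral_ne_top_of_mem_plans h.1)]

theorem isTightMeasureSet_of_wdist_le (R : ℝ) :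
    IsTightMeasureSet {((m : ProbabilityMeasure (Space N)) : Measure (Space N)) |
      m ∈ {m : ProbabilityMeasure (Space N) | ∃ μ : WSpace N, μ.1 = m ∧
        wdist μ (WSpace.diracZero N) ≤ R}} := by
  rw [isTightMeasureSet_iff_exists_isCompact_measure_compl_le]
  intro ε hε
  obtain rfl | hεtop := eq_or_ne ε ⊤
  · exact ⟨∅, isCompact_empty, fun _ _ => le_top⟩
  have hε' := ENNReal.toReal_pos hε.ne' hεtop
  obtain ⟨r, hr0, hr⟩ : ∃ r : ℝ, 0 < r ∧ R ^ 2 / ε.toReal ≤ r ^ 2 := by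
    refine ⟨R ^ 2 / ε.toReal + 1, by positivity, ?_⟩
    have : 0 ≤ R ^ 2 / ε.toReal := by positivity
    nlinarith
  refine ⟨Metric.closedBall 0 r, isCompact_closedBall 0 r, ?_⟩
  rintro _ ⟨m, ⟨μ, rfl, hμ⟩, rfl⟩
  have hR : 0 ≤ R := (wdist_nonneg _ _).trans hμ
  have h1 := mul_meas_ge_le_lintegral₀ (μ := μ.meas)
    (f := fun x : Space N => ((‖x‖₊ ^ 2 : ℝ≥0) : ℝ≥0∞)) (by fun_prop) (ENNReal.ofReal (r ^ 2))
  rw [lintegral_norm_sq_eq] at h1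
  have h2 : (Metric.closedBall (0 : Space N) r)ᶜ ⊆
      {x | ENNReal.ofReal (r ^ 2) ≤ ((‖x‖₊ ^ 2 : ℝ≥0) : ℝ≥0∞)} := by
    intro x hx
    have hx' : r < ‖x‖ := by simpa using hx
    rw [Set.mem_ofPred_eq, ← ENNReal.ofReal_coe_nnreal]
    apply ENNReal.ofReal_le_ofReal
    push_cast
    gcongr
  refine (measure_mono h2).trans ?_
  have hr2 : ENNReal.ofReal (r ^ 2) ≠ 0 := by
    rw [Ne, ENNReal.ofReal_eq_zero, not_le]; positivity
  rw [← ENNReal.mul_le_mul_iff_right hr2 ENNReal.ofReal_ne_top]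
  refine h1.trans ?_
  rw [← ENNReal.ofReal_toReal hεtop, ← ENNReal.ofReal_mul (by positivity)]
  apply ENNReal.ofReal_le_ofReal
  rw [div_le_iff₀ hε'] at hr
  exact (pow_le_pow_left₀ (wdist_nonneg _ _) hμ 2).trans hr

/-- A Cauchy sequence is bounded, hence tight, and has a weak limit along an ultrafilter. Optimal
plans from a fixed term to later terms also converge along it, and lower semicontinuity of the cost
passes the Cauchy estimate to the limit. -/
instance : CompleteSpace (WSpace N) := by
  apply Metric.complete_of_cauchySeq_tendsto
  intro u hu
  have hbdd := hu.isBounded_range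
  obtain ⟨R, hR⟩ := (Metric.isBounded_iff_subset_closedBall (WSpace.diracZero N)).1 hbdd
  have hR' : ∀ n, wdist (u n) (WSpace.diracZero N) ≤ R := fun n => hR ⟨n, rfl⟩
  have htight := isTightMeasureSet_of_wdist_le (N := N) R
  have hcomp := isCompact_closure_of_isTightMeasureSet htight
  let f : Ultrafilter ℕ := Ultrafilter.of atTop
  have hf : (f : Filter ℕ) ≤ atTop := Ultrafilter.of_le _
  have hmem : ∀ n, (u n).1 ∈ {m : ProbabilityMeasure (Space N) | ∃ μ : WSpace N, μ.1 = m ∧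
      wdist μ (WSpace.diracZero N) ≤ R} := fun n => ⟨u n, rfl, hR' n⟩
  obtain ⟨m, -, hm⟩ := isCompact_iff_ultrafilter_le_nhds.1 hcomp (f.map fun n => (u n).1)
    (by
      rw [le_principal_iff, Ultrafilter.coe_map]
      exact Filter.mem_map.2 (Filter.univ_mem' fun n => subset_closure (hmem n)))
  have hm' : Tendsto (fun n => (u n).1) f (𝓝 m) := hm
  have hmom : MemLp (fun x : Space N => x) 2 (m : Measure (Space N)) := by
    rw [memLp_two_iff_integrable_sq_norm (by fun_prop)]
    refine ⟨by fun_prop, ?_⟩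
    have := (isClosed_lintegral_le (Ω := Space N) (g := fun x => ‖x‖₊ ^ 2) (by fun_prop)
      (ENNReal.ofReal (R ^ 2))).mem_of_tendsto hm' (.of_forall fun n => by
        change ∫⁻ x, ((‖x‖₊ ^ 2 : ℝ≥0) : ℝ≥0∞) ∂(u n).meas ≤ _
        rw [lintegral_norm_sq_eq]
        exact ENNReal.ofReal_le_ofReal (pow_le_pow_left₀ (wdist_nonneg _ _) (hR' n) 2))
    rw [HasFiniteIntegral]
    refine lt_of_le_of_lt ?_ (lt_of_le_of_lt this ENNReal.ofReal_lt_top)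
    apply lintegral_mono
    intro x
    simp [enorm_eq_nnnorm]
  let μ : WSpace N := WSpace.ofMeasure m hmom
  have hdist : ∀ ε > 0, ∀ k, (∀ n ≥ k, wdist (u k) (u n) ≤ ε) → wdist (u k) μ ≤ ε := by
    intro ε hε k hk
    choose π hπ using fun n => optPlans_nonempty (u k) (u n)
    have hprob := fun n => isProbabilityMeasure_of_mem_plans (hπ n).1
    let p : ℕ → ProbabilityMeasure (Space N × Space N) := fun n => ⟨π n, hprob n⟩
    have hc := isCompact_plans _ htight _ htight
    obtain ⟨q, -, hq⟩ := isCompact_iff_ultrafilter_le_nhds.1 hc (f.map p) (by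
      rw [le_principal_iff, Ultrafilter.coe_map]
      refine Filter.mem_map.2 (Filter.univ_mem' fun n => subset_closure ⟨?_, ?_⟩)
      · exact ⟨u k, Subtype.ext (hπ n).1.1.symm, hR' k⟩
      · exact ⟨u n, Subtype.ext (hπ n).1.2.symm, hR' n⟩)
    have hq' : Tendsto p f (𝓝 q) := hq
    have h1 : q.map (f := Prod.fst) measurable_fst.aemeasurable = (u k).1 := by
      have h := ((ProbabilityMeasure.continuous_map continuous_fst).tendsto q).comp hq'
      refine tendsto_nhds_unique h (tendsto_const_nhds.congr fun n => ?_)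
      exact Subtype.ext (hπ n).1.1.symm
    have h2 : q.map (f := Prod.snd) measurable_snd.aemeasurable = m := by
      have h := ((ProbabilityMeasure.continuous_map continuous_snd).tendsto q).comp hq'
      refine tendsto_nhds_unique h (hm'.congr fun n => ?_)
      exact Subtype.ext (hπ n).1.2.symm
    have hplan : (q : Measure (Space N × Space N)) ∈ plans (u k) μ :=
      ⟨congrArg Subtype.val h1, congrArg Subtype.val h2⟩
    have hcost := (isClosed_lintegral_le (Ω := Space N × Space N)
      (g := fun z => ‖z.1 - z.2‖₊ ^ 2) (by fun_prop)
      (ENNReal.ofReal (ε ^ 2))).mem_of_tendsto hq' (by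
        have : ∀ᶠ n in (f : Filter ℕ), k ≤ n := hf (eventually_ge_atTop k)
        filter_upwards [this] with n hn
        change ∫⁻ z, ((‖z.1 - z.2‖₊ ^ 2 : ℝ≥0) : ℝ≥0∞) ∂(π n) ≤ _
        rw [lintegral_sub_sq_eq (hπ n)]
        exact ENNReal.ofReal_le_ofReal (pow_le_pow_left₀ (wdist_nonneg _ _) (hk n hn) 2))
    refine le_of_sq_le_sq ((wdist_sq_le_transportCost hplan).trans ?_) hε.le
    rw [transportCost_eq_toReal]
    exact ENNReal.toReal_le_of_le_ofReal (by positivity) hcost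
  refine ⟨μ, Metric.tendsto_atTop.2 fun ε hε => ?_⟩
  obtain ⟨n0, hn0⟩ := Metric.cauchySeq_iff.1 hu (ε / 2) (by positivity)
  refine ⟨n0, fun n hn => ?_⟩
  have := hdist (ε / 2) (by positivity) n fun k hk => (hn0 n hn k (le_trans hn hk)).le
  rw [dist_eq_wdist]
  linarith

end Complete

/-! ### Ekeland's variational principle -/

section Ekeland

/-- Ekeland's variational principle. -/
theorem exists_ekeland {X : Type*} [PseudoMetricSpace X] [CompleteSpace X] {g : X → ℝ}
    (hg : Continuous g) {B : ℝ} (hB : ∀ x, g x ≤ B) {η : ℝ} (hη : 0 < η) (x0 : X) :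
    ∃ x, g x0 ≤ g x ∧ ∀ y, g y ≤ g x + η * dist x y := by
  let S : X → Set X := fun x => {y | g x + η * dist x y ≤ g y}
  have hself : ∀ x, x ∈ S x := fun x => by simp [S]
  have htrans : ∀ x y z, y ∈ S x → z ∈ S y → z ∈ S x := by
    intro x y z h1 h2
    simp only [S, Set.mem_ofPred_eq] at h1 h2 ⊢
    nlinarith [dist_triangle x y z]
  have hbdd : ∀ x, BddAbove (g '' S x) := fun x => ⟨B, by rintro _ ⟨y, -, rfl⟩; exact hB y⟩
  have hne : ∀ x, (g '' S x).Nonempty := fun x => ⟨_, x, hself x, rfl⟩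
  -- Choosing almost the best point of S x at each step makes the nested sets S (u n) shrink to
  -- diameter zero.
  have hstep : ∀ x (n : ℕ), ∃ y ∈ S x, sSup (g '' S x) - (1 / 2) ^ n < g y := by
    intro x n
    obtain ⟨_, ⟨y, hy, rfl⟩, h⟩ := exists_lt_of_lt_csSup (hne x)
      (show sSup (g '' S x) - (1 / 2) ^ n < sSup (g '' S x) by
        have : (0 : ℝ) < (1 / 2) ^ n := by positivity
        linarith)
    exact ⟨y, hy, h⟩
  choose nxt hnxt hnxt2 using hstep
  let u : ℕ → X := fun n => Nat.rec x0 (fun n x => nxt x n) n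
  have hu : ∀ n, u (n + 1) = nxt (u n) n := fun n => rfl
  have hmem : ∀ n k, u (n + k) ∈ S (u n) := by
    intro n k
    induction k with
    | zero => exact hself _
    | succ k ih =>
      refine htrans _ _ _ ih ?_
      rw [← add_assoc, hu]
      exact hnxt _ _
  have hclose : ∀ n y, y ∈ S (u (n + 1)) → η * dist (u (n + 1)) y ≤ (1 / 2) ^ n := by
    intro n y hy
    have h1 : y ∈ S (u n) := htrans _ _ _ (hmem n 1) hy
    have h2 := le_csSup (hbdd (u n)) ⟨y, h1, rfl⟩
    have h3 := hnxt2 (u n) n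
    rw [← hu] at h3
    simp only [S, Set.mem_ofPred_eq] at hy
    linarith
  have hsmall : ∀ ε > 0, ∃ n : ℕ, (1 / 2 : ℝ) ^ n < ε := fun ε hε =>
    exists_pow_lt_of_lt_one hε (by norm_num)
  have hcauchy : CauchySeq u := by
    refine Metric.cauchySeq_iff'.2 fun ε hε => ?_
    obtain ⟨n, hn⟩ := hsmall (η * ε) (by positivity)
    refine ⟨n + 1, fun m hm => ?_⟩
    obtain ⟨k, rfl⟩ := Nat.exists_eq_add_of_le hm
    have := hclose n _ (hmem (n + 1) k)
    rw [dist_comm]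
    exact lt_of_mul_lt_mul_left (lt_of_le_of_lt this hn) hη.le
  obtain ⟨x, hx⟩ := cauchySeq_tendsto_of_complete hcauchy
  have hclosed : ∀ x, IsClosed (S x) := fun x => isClosed_le (by fun_prop) hg
  have hxS : ∀ n, x ∈ S (u n) := fun n =>
    (hclosed _).mem_of_tendsto hx ((eventually_ge_atTop n).mono fun m hm => by
      obtain ⟨k, rfl⟩ := Nat.exists_eq_add_of_le hm
      exact hmem n k)
  refine ⟨x, ?_, fun y => ?_⟩
  · have h0 : g (u 0) + η * dist (u 0) x ≤ g x := hxS 0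
    have : 0 ≤ η * dist (u 0) x := by positivity
    change g x0 + η * dist (u 0) x ≤ g x at h0
    linarith
  · by_contra! hlt
    have hyx : y ∈ S x := hlt.le
    have hd : dist x y = 0 := by
      by_contra hne
      have hpos : 0 < dist x y := lt_of_le_of_ne dist_nonneg (Ne.symm hne)
      obtain ⟨n, hn⟩ := hsmall (η * dist x y / 2) (by positivity)
      have h1 := hclose n x (hxS (n + 1))
      have h2 := hclose n y (htrans _ _ _ (hxS (n + 1)) hyx)
      have h3 := dist_triangle_left x y (u (n + 1))
      nlinarith
    -- In a pseudometric space y may differ from x at distance zero; continuity still forces equal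
    -- values.
    have hgxy : g x = g y := by
      have := (Metric.inseparable_iff.2 hd).map hg
      exact this.eq
    rw [hd] at hlt
    linarith

/-- Ekeland's variational principle with an additional compact parameter. -/
theorem exists_ekeland_param {X A : Type*} [PseudoMetricSpace X] [CompleteSpace X]
    [TopologicalSpace A] [CompactSpace A] {F : A → X → ℝ}
    (hF : Continuous fun z : A × X => F z.1 z.2) {B : ℝ} (hB : ∀ a x, F a x ≤ B)
    {η : ℝ} (hη : 0 < η) (a0 : A) (x0 : X) :
    ∃ a x, F a0 x0 ≤ F a x ∧ ∀ a' y, F a' y ≤ F a x + η * dist x y := by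
  -- Maximising over the compact parameter first leaves no Ekeland error term in the parameter, so
  -- first order conditions in it are exact.
  let g : X → ℝ := fun x => sSup ((fun a => F a x) '' Set.univ)
  have hg : Continuous g := by
    have := isCompact_univ (X := A) |>.continuous_sSup
      (f := fun x a => F a x) (by exact hF.comp continuous_swap)
    exact this
  have hbdd : ∀ x, BddAbove ((fun a => F a x) '' Set.univ) := fun x =>
    ⟨B, by rintro _ ⟨a, -, rfl⟩; exact hB a x⟩
  have hle : ∀ a x, F a x ≤ g x := fun a x => le_csSup (hbdd x) ⟨a, trivial, rfl⟩
  obtain ⟨x, h1, h2⟩ := exists_ekeland hg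
    (fun x => csSup_le ⟨_, a0, trivial, rfl⟩ (by rintro _ ⟨a, -, rfl⟩; exact hB a x)) hη x0
  obtain ⟨a, -, ha⟩ := isCompact_univ (X := A).exists_sSup_image_eq ⟨a0, trivial⟩
    (f := fun a => F a x) (by fun_prop)
  have ha' : g x = F a x := ha
  exact ⟨a, x, (hle a0 x0).trans (h1.trans ha'.le), fun a' y =>
    (hle a' y).trans ((h2 y).trans (by rw [ha']))⟩

end Ekeland

/-! ### Conditional expectations and conditionally independent copies -/

section CondCopies

variable {N : ℕ} {Ω : Type*} [MeasurableSpace Ω]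

theorem integrable_inner_of_memLp {P : Measure Ω} {f g : Ω → Space N} (hf : MemLp f 2 P)
    (hg : MemLp g 2 P) : Integrable (fun a => inner ℝ (f a) (g a)) P := by
  refine (L2.integrable_inner (𝕜 := ℝ) (hf.toLp f) (hg.toLp g)).congr ?_
  filter_upwards [hf.coeFn_toLp, hg.coeFn_toLp] with a h1 h2
  rw [h1, h2]

/-- The gradient associated with a transport plan, realised on a probability space. -/
theorem isPlanGradient_jointLaw {Q : Measure Ω} [IsProbabilityMeasure Q]
    (Xbar X : RandVec N Q) (c : ℝ) (hc : c ≠ 0) {R : Space N → Space N}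
    (hR : MemLp R 2 (lawOf X).meas)
    (h : ∀ ξ : Space N → Space N, MemLp ξ 2 (lawOf X).meas →
        ∫ a, inner ℝ (ξ (X a)) ((c • (X - Xbar)) a) ∂Q
          = ∫ y, inner ℝ (ξ y) (R y) ∂(lawOf X).meas) :
    IsPlanGradient (lawOf X) (jointLaw Xbar X) (fun y => -(c⁻¹ • R y)) := by
  have hX := measurable_randVec X
  refine ⟨(hR.const_smul c⁻¹).neg, fun ξ hξ => ?_⟩
  have hplan := jointLaw_mem_plans Xbar X
  have hae : AEStronglyMeasurable (fun z : Space N × Space N =>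
      (inner ℝ (ξ z.2) (z.1 - z.2) : ℝ)) (jointLaw Xbar X) := by
    refine AEStronglyMeasurable.inner ?_ (by fun_prop)
    exact hξ.1.comp_quasiMeasurePreserving
      (measurePreserving_snd_of_mem_plans hplan).quasiMeasurePreserving
  rw [jointLaw] at hae ⊢
  rw [integral_map (measurable_pair _ _).aemeasurable hae]
  have h1 : ∫ y, (inner ℝ (ξ y) (-(c⁻¹ • R y)) : ℝ) ∂(lawOf X).meas
      = -(c⁻¹ * ∫ y, inner ℝ (ξ y) (R y) ∂(lawOf X).meas) := by
    rw [← integral_const_mul, ← integral_neg]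
    congr 1 with y
    rw [inner_neg_right, inner_smul_right]
  rw [h1, ← h ξ hξ, ← integral_const_mul, ← integral_neg]
  apply integral_congr_ae
  filter_upwards [Lp.coeFn_smul c (X - Xbar), Lp.coeFn_sub X Xbar] with a e1 e2
  rw [e1, Pi.smul_apply, e2, Pi.sub_apply, inner_smul_right, ← mul_assoc, inv_mul_cancel₀ hc,
    one_mul, ← inner_neg_right, neg_sub]

variable [StandardBorelSpace Ω] {Q : Measure Ω} [IsProbabilityMeasure Q]

/-- Two copies of a probability space, conditionally independent given the random vector `X`,
together with the conditional expectation of another random vector `A` given `X`. -/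
theorem exists_condCopies (X A : RandVec N Q) :
    ∃ (Q₂ : Measure (Space N × Ω × Ω)) (_ : IsProbabilityMeasure Q₂)
      (j₁ j₂ : Space N × Ω × Ω → Ω)
      (h₁ : MeasurePreserving j₁ Q₂ Q) (h₂ : MeasurePreserving j₂ Q₂ Q)
      (R : Space N → Space N) (Rv : RandVec N Q),
      RandVec.pull h₁ X = RandVec.pull h₂ X ∧ MemLp R 2 (lawOf X).meas ∧ Rv =ᵐ[Q] R ∘ X ∧
      (∀ ξ : Space N → Space N, MemLp ξ 2 (lawOf X).meas →
        ∫ a, inner ℝ (ξ (X a)) (A a) ∂Q = ∫ y, inner ℝ (ξ y) (R y) ∂(lawOf X).meas) ∧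
      ‖A - Rv‖ ≤ ‖RandVec.pull h₁ A - RandVec.pull h₂ A‖ ∧ ‖Rv‖ ≤ ‖A‖ := by
  have hne : Nonempty Ω := nonempty_of_isProbabilityMeasure Q
  have hX := measurable_randVec X
  have hA := measurable_randVec A
  have hAint : Integrable A Q := (Lp.memLp A).integrable (by norm_num)
  let m : Measure (Space N) := Q.map X
  have hm : IsProbabilityMeasure m := Measure.isProbabilityMeasure_map hX.aemeasurable
  let κ : Kernel (Space N) Ω := condDistrib id X Q
  have hκ : IsMarkovKernel κ := by unfold κ; infer_instance
  have hρ : m.compProd κ = Q.map (fun a => (X a, a)) :=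
    compProd_map_condDistrib measurable_id.aemeasurable
  have hpair : Measurable fun a => (X a, a) := hX.prodMk measurable_id
  let R : Space N → Space N := fun x => ∫ a, A a ∂κ x
  have hRX : Q[A | MeasurableSpace.comap X inferInstance] =ᵐ[Q] R ∘ X :=
    condExp_ae_eq_integral_condDistrib_id hX hAint
  have hRmeas : StronglyMeasurable R :=
    (hA.stronglyMeasurable.comp_measurable measurable_snd).integral_kernel_prod_right'
      (κ := κ)
  have hRX2 : MemLp (R ∘ X) 2 Q :=
    ((Lp.memLp A).condExp (by norm_num)).ae_eq hRX
  have hR2 : MemLp R 2 m := (memLp_map_measure_iff hRmeas.aestronglyMeasurable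
    hX.aemeasurable).2 hRX2
  have hκ0 : ∀ᵐ x ∂m, Integrable A (κ x) := by
    have h1 : Integrable (fun z : Space N × Ω => A z.2) (m.compProd κ) := by
      rw [hρ]
      exact (integrable_map_measure (by
        exact (hA.comp measurable_snd).aestronglyMeasurable) hpair.aemeasurable).2 hAint
    exact ((Measure.integrable_compProd_iff
      ((hA.comp measurable_snd).aestronglyMeasurable)).1 h1).1
  have hξ : ∀ ξ : Space N → Space N, MemLp ξ 2 m →
      ∫ a, inner ℝ (ξ (X a)) (A a) ∂Q = ∫ y, inner ℝ (ξ y) (R y) ∂m := by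
    intro ξ hξ
    have hξX : MemLp (ξ ∘ X) 2 Q := hξ.comp_measurePreserving ⟨hX, rfl⟩
    have hae : AEStronglyMeasurable (fun z : Space N × Ω => inner ℝ (ξ z.1) (A z.2) : _ → ℝ)
        (m.compProd κ) := by
      refine AEStronglyMeasurable.inner ?_ (hA.comp measurable_snd).aestronglyMeasurable
      exact hξ.1.comp_quasiMeasurePreserving
        ⟨measurable_fst, by rw [show Measure.map Prod.fst (m.compProd κ) = m from
          Measure.fst_compProd m κ]⟩
    have hint : Integrable (fun z : Space N × Ω => inner ℝ (ξ z.1) (A z.2) : _ → ℝ)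
        (m.compProd κ) := by
      rw [hρ] at hae ⊢
      exact (integrable_map_measure hae hpair.aemeasurable).2
        (integrable_inner_of_memLp hξX (Lp.memLp A))
    have h2 := Measure.integral_compProd hint
    have h3 : ∫ z, (inner ℝ (ξ z.1) (A z.2) : ℝ) ∂(m.compProd κ)
        = ∫ a, inner ℝ (ξ (X a)) (A a) ∂Q := by
      rw [hρ] at hae ⊢
      rw [integral_map hpair.aemeasurable hae]
    rw [← h3, h2]
    apply integral_congr_ae
    filter_upwards [hκ0] with x hx
    exact integral_inner hx (ξ x)
  -- Draw x from the law of X, then two independent points of Ω from the conditional law given X =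
  -- x.
  let Q₂ : Measure (Space N × Ω × Ω) := m.compProd (κ ×ₖ κ)
  have hQ₂ : IsProbabilityMeasure Q₂ := by unfold Q₂; infer_instance
  have hmap1 : Q₂.map (fun z => (z.1, z.2.1)) = Q.map (fun a => (X a, a)) := by
    rw [← hρ]
    conv_rhs => rw [← Kernel.fst_prod κ κ]
    rw [Kernel.fst_eq, Measure.compProd_map measurable_fst]
    rfl
  have hmap2 : Q₂.map (fun z => (z.1, z.2.2)) = Q.map (fun a => (X a, a)) := by
    rw [← hρ]
    conv_rhs => rw [← Kernel.snd_prod κ κ]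
    rw [Kernel.snd_eq, Measure.compProd_map measurable_snd]
    rfl
  have h₁ : MeasurePreserving (fun z : Space N × Ω × Ω => z.2.1) Q₂ Q := by
    refine ⟨by fun_prop, ?_⟩
    have := congrArg (Measure.map Prod.snd) hmap1
    rw [Measure.map_map measurable_snd (by fun_prop), Measure.map_map measurable_snd hpair] at this
    exact this.trans Measure.map_id
  have h₂ : MeasurePreserving (fun z : Space N × Ω × Ω => z.2.2) Q₂ Q := by
    refine ⟨by fun_prop, ?_⟩
    have := congrArg (Measure.map Prod.snd) hmap2
    rw [Measure.map_map measurable_snd (by fun_prop), Measure.map_map measurable_snd hpair] at this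
    exact this.trans Measure.map_id
  have hgraph : ∀ᵐ z ∂(Q.map (fun a => (X a, a))), X z.2 = z.1 := by
    refine (ae_map_iff hpair.aemeasurable
      (measurableSet_eq_fun (f := fun z : Space N × Ω => X z.2) (hX.comp measurable_snd)
        measurable_fst)).2 ?_
    simp
  have hX1 : ∀ᵐ z ∂Q₂, X z.2.1 = z.1 := by
    rw [← hmap1] at hgraph
    exact ae_of_ae_map (by fun_prop) hgraph
  have hX2 : ∀ᵐ z ∂Q₂, X z.2.2 = z.1 := by
    rw [← hmap2] at hgraph
    exact ae_of_ae_map (by fun_prop) hgraph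
  let Rv : RandVec N Q := hRX2.toLp (R ∘ X)
  have hRv : Rv =ᵐ[Q] R ∘ X := hRX2.coeFn_toLp
  have hinner1 : inner ℝ Rv A = ‖Rv‖ ^ 2 := by
    rw [RandVec.inner_def, RandVec.norm_sq]
    calc ∫ a, inner ℝ (Rv a) (A a) ∂Q = ∫ a, inner ℝ (R (X a)) (A a) ∂Q :=
          integral_congr_ae (by filter_upwards [hRv] with a h; rw [h]; rfl)
      _ = ∫ y, inner ℝ (R y) (R y) ∂m := hξ R hR2
      _ = ∫ a, inner ℝ (R (X a)) (R (X a)) ∂Q := integral_map hX.aemeasurable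
          (hRmeas.inner hRmeas).aestronglyMeasurable
      _ = _ := integral_congr_ae (by
          filter_upwards [hRv] with a h; rw [h]; exact real_inner_self_eq_norm_sq _)
  have hnormR : ‖Rv‖ ^ 2 = ∫ x, inner ℝ (R x) (R x) ∂m := by
    rw [RandVec.norm_sq]
    refine Eq.trans ?_ (integral_map hX.aemeasurable
          (hRmeas.inner hRmeas).aestronglyMeasurable).symm
    exact integral_congr_ae (by
          filter_upwards [hRv] with a h; rw [h]; exact (real_inner_self_eq_norm_sq _).symm)
  -- Conditional independence factorises the inner product into ⟨E[A|X], E[A|X]⟩. Consequently the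
  -- squared distance of the copies is 2‖A‖² - 2‖Rv‖², twice the squared distance from A to its
  -- projection.
  have hinner2 : inner ℝ (RandVec.pull h₁ A) (RandVec.pull h₂ A) = ‖Rv‖ ^ 2 := by
    rw [RandVec.inner_def, hnormR]
    have e : ∀ᵐ z ∂Q₂, (inner ℝ (RandVec.pull h₁ A z) (RandVec.pull h₂ A z) : ℝ)
        = inner ℝ (A z.2.1) (A z.2.2) := by
      filter_upwards [RandVec.coeFn_pull h₁ A, RandVec.coeFn_pull h₂ A] with z e1 e2
      rw [e1, e2]; rfl
    have hint : Integrable (fun z : Space N × Ω × Ω => (inner ℝ (A z.2.1) (A z.2.2) : ℝ)) Q₂ :=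
      (L2.integrable_inner (𝕜 := ℝ) (RandVec.pull h₁ A) (RandVec.pull h₂ A)).congr e
    rw [integral_congr_ae e, Measure.integral_compProd hint]
    have hint2 := ((Measure.integrable_compProd_iff hint.1).1 hint).1
    apply integral_congr_ae
    filter_upwards [hint2, hκ0] with x hx hx0
    rw [Kernel.prod_apply] at hx ⊢
    rw [integral_prod _ hx]
    simp only
    calc ∫ a, ∫ b, (inner ℝ (A a) (A b) : ℝ) ∂κ x ∂κ x
        = ∫ a, inner ℝ (R x) (A a) ∂κ x := by
          congr 1 with a
          rw [integral_inner hx0, real_inner_comm]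
      _ = _ := integral_inner hx0 _
  refine ⟨Q₂, hQ₂, _, _, h₁, h₂, R, Rv, ?_, hR2, hRv, hξ, ?_, ?_⟩
  · apply Lp.ext
    filter_upwards [RandVec.coeFn_pull h₁ X, RandVec.coeFn_pull h₂ X, hX1, hX2] with z e1 e2 e3 e4
    rw [e1, e2]
    exact e3.trans e4.symm
  · refine le_of_sq_le_sq ?_ (norm_nonneg _)
    rw [norm_sub_sq_real, norm_sub_sq_real, hinner2, real_inner_comm, hinner1,
      LinearIsometry.norm_map, LinearIsometry.norm_map]
    have h5 : ‖Rv‖ ^ 2 ≤ ‖A‖ * ‖Rv‖ := by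
      rw [← hinner1, mul_comm]; exact real_inner_le_norm _ _
    nlinarith [sq_nonneg (‖A‖ - ‖Rv‖)]
  · have h5 : ‖Rv‖ ^ 2 ≤ ‖A‖ * ‖Rv‖ := by
      rw [← hinner1, mul_comm]; exact real_inner_le_norm _ _
    nlinarith [norm_nonneg A, norm_nonneg Rv]

end CondCopies

/-! ### Norm inequalities for random vectors -/

section CauchySchwarz

variable {N : ℕ} {Ω : Type*} [MeasurableSpace Ω] {Q : Measure Ω}

theorem integral_norm_mul_norm_le (A B : RandVec N Q) :
    Integrable (fun a => ‖A a‖ * ‖B a‖) Q ∧ ∫ a, ‖A a‖ * ‖B a‖ ∂Q ≤ ‖A‖ * ‖B‖ := by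
  have hA := (Lp.memLp A).norm
  have hB := (Lp.memLp B).norm
  refine ⟨hA.integrable_mul hB, ?_⟩
  have h := real_inner_le_norm (hA.toLp _) (hB.toLp _)
  rw [L2.inner_def, Lp.norm_toLp, Lp.norm_toLp, eLpNorm_norm, eLpNorm_norm, ← Lp.norm_def,
    ← Lp.norm_def] at h
  refine le_of_eq_of_le (integral_congr_ae ?_) h
  filter_upwards [hA.coeFn_toLp, hB.coeFn_toLp] with a e1 e2
  rw [e1, e2]
  simp [mul_comm]

theorem integral_norm_le [IsProbabilityMeasure Q] (A : RandVec N Q) :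
    Integrable (fun a => ‖A a‖) Q ∧ ∫ a, ‖A a‖ ∂Q ≤ ‖A‖ := by
  have hA := (Lp.memLp A).norm
  refine ⟨hA.integrable (by norm_num), ?_⟩
  have h1 : MemLp (fun _ : Ω => (1 : ℝ)) 2 Q := memLp_const 1
  have h := real_inner_le_norm (h1.toLp _) (hA.toLp _)
  rw [L2.inner_def, Lp.norm_toLp, Lp.norm_toLp, eLpNorm_norm, ← Lp.norm_def,
    eLpNorm_const _ (by norm_num) (IsProbabilityMeasure.ne_zero Q)] at h
  simp only [enorm_one, measure_univ, ENNReal.one_rpow, mul_one, ENNReal.toReal_one, one_mul] at h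
  refine le_of_eq_of_le (integral_congr_ae ?_) h
  filter_upwards [hA.coeFn_toLp, h1.coeFn_toLp] with a e1 e2
  rw [e1, e2]
  simp

theorem norm_le_of_ae_bound [IsProbabilityMeasure Q] (A : RandVec N Q) {C : ℝ} (hC : 0 ≤ C)
    (h : ∀ᵐ a ∂Q, ‖A a‖ ≤ C) : ‖A‖ ≤ C := by
  have := Lp.norm_le_of_ae_bound (f := A) hC h
  have h1 : measureUnivNNReal Q = 1 := by simp [measureUnivNNReal]
  simpa [h1] using this

end CauchySchwarz

/-! ### Expected minima of finitely many linear forms -/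

section MinInner

variable {N : ℕ} {I : Type*} [Finite I] [Nonempty I]

/-- The minimum of finitely many linear forms. -/
def minInner (G : I → Space N) (p : Space N) : ℝ := ⨅ i, inner ℝ (G i) p

theorem minInner_le (G : I → Space N) (p : Space N) (i : I) : minInner G p ≤ inner ℝ (G i) p :=
  ciInf_le (Set.finite_range _).bddBelow i

theorem le_minInner {G : I → Space N} {p : Space N} {c : ℝ} (h : ∀ i, c ≤ inner ℝ (G i) p) :
    c ≤ minInner G p := le_ciInf h

theorem minInner_le_add {G G' : I → Space N} {p p' : Space N} {e C : ℝ}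
    (hG : ∀ i, ‖G' i - G i‖ ≤ e) (hC : ∀ i, ‖G i‖ ≤ C) :
    minInner G' p' ≤ minInner G p + (e * ‖p'‖ + C * ‖p' - p‖) := by
  rw [← sub_le_iff_le_add]
  refine le_minInner fun i => ?_
  have h1 := minInner_le G' p' i
  have h2 : (inner ℝ (G' i) p' : ℝ) = inner ℝ (G i) p + inner ℝ (G' i - G i) p'
      + inner ℝ (G i) (p' - p) := by
    rw [inner_sub_left, inner_sub_right]; ring
  have h3 : inner ℝ (G' i - G i) p' ≤ e * ‖p'‖ := (real_inner_le_norm _ _).trans (by gcongr; exact hG i)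
  have h4 : inner ℝ (G i) (p' - p) ≤ C * ‖p' - p‖ :=
    (real_inner_le_norm _ _).trans (by gcongr; exact hC i)
  linarith

theorem abs_minInner_le {G : I → Space N} {C : ℝ} (hC : ∀ i, ‖G i‖ ≤ C) (p : Space N) :
    |minInner G p| ≤ C * ‖p‖ := by
  rw [abs_le]
  constructor
  · refine le_minInner fun i => ?_
    have := abs_real_inner_le_norm (G i) p
    have h2 : ‖G i‖ * ‖p‖ ≤ C * ‖p‖ := by gcongr; exact hC i
    have := (abs_le.1 this).1
    linarith
  · obtain ⟨i⟩ := ‹Nonempty I›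
    exact (minInner_le G p i).trans ((real_inner_le_norm _ _).trans (by gcongr; exact hC i))

/-- Measurable selection of a minimizer among finitely many functions. -/
theorem exists_measurable_argmin {α : Type*} [MeasurableSpace α] {β : Type*} [MeasurableSpace β]
    {g : I → α → ℝ} (hg : ∀ i, Measurable (g i)) {φ : I → α → β} (hφ : ∀ i, Measurable (φ i)) :
    ∃ D : α → β, Measurable D ∧ ∀ a, ∃ i, D a = φ i a ∧ ∀ j, g i a ≤ g j a := by
  have := Fintype.ofFinite I
  have key : ∀ s : Finset I, s.Nonempty → ∃ D : α → β, ∃ m : α → ℝ, Measurable D ∧ Measurable m ∧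
      ∀ a, ∃ i ∈ s, D a = φ i a ∧ m a = g i a ∧ ∀ j ∈ s, g i a ≤ g j a := by
    intro s hs
    induction hs using Finset.Nonempty.cons_induction with
    | singleton i => exact ⟨φ i, g i, hφ i, hg i, fun a => ⟨i, by simp⟩⟩
    | cons j s hj hs ih =>
      obtain ⟨D, m, hD, hm, h⟩ := ih
      have hset : MeasurableSet {a | g j a ≤ m a} := measurableSet_le (hg j) hm
      classical
      refine ⟨fun a => if g j a ≤ m a then φ j a else D a,
        fun a => if g j a ≤ m a then g j a else m a,
        Measurable.ite hset (hφ j) hD, Measurable.ite hset (hg j) hm, fun a => ?_⟩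
      obtain ⟨i, his, h1, h2, h3⟩ := h a
      by_cases hle : g j a ≤ m a
      · refine ⟨j, by simp, by simp [hle], by simp [hle], fun k hk => ?_⟩
        rcases Finset.mem_cons.1 hk with rfl | hk
        · exact le_rfl
        · exact hle.trans (h2 ▸ h3 k hk)
      · refine ⟨i, by simp [his], by simp [hle, h1], (if_neg hle).trans h2, fun k hk => ?_⟩
        rcases Finset.mem_cons.1 hk with rfl | hk
        · rw [← h2]; exact (not_le.1 hle).le
        · exact h3 k hk
  obtain ⟨D, m, hD, -, h⟩ := key Finset.univ Finset.univ_nonempty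
  refine ⟨D, hD, fun a => ?_⟩
  obtain ⟨i, -, h1, -, h3⟩ := h a
  exact ⟨i, h1, fun j => h3 j (Finset.mem_univ j)⟩

/-- A finite family of bounded Lipschitz vector fields. -/
structure IsLipFamily (F : I → Space N → Space N) (C L : ℝ) : Prop where
  bound : ∀ i x, ‖F i x‖ ≤ C
  lip : ∀ i x y, ‖F i x - F i y‖ ≤ L * ‖x - y‖
  nonneg : 0 ≤ L

variable {F : I → Space N → Space N} {C L : ℝ}

theorem IsLipFamily.bound_nonneg (hF : IsLipFamily F C L) : 0 ≤ C :=
  (norm_nonneg _).trans (hF.bound (Classical.arbitrary I) 0)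

theorem IsLipFamily.continuous (hF : IsLipFamily F C L) (i : I) : Continuous (F i) := by
  refine (LipschitzWith.of_dist_le_mul (K := L.toNNReal) fun x y => ?_).continuous
  rw [dist_eq_norm, dist_eq_norm, Real.coe_toNNReal _ hF.nonneg]
  exact hF.lip i x y

theorem IsLipFamily.measurable_minInner (hF : IsLipFamily F C L) :
    Measurable fun z : Space N × Space N => minInner (fun i => F i z.1) z.2 :=
  Measurable.iInf fun i => by
    have := hF.continuous i
    exact (by fun_prop : Continuous fun z : Space N × Space N =>
      (inner ℝ (F i z.1) z.2 : ℝ)).measurable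

variable {Ω : Type*} [MeasurableSpace Ω] {Q : Measure Ω}

/-- The expectation of the minimum of finitely many linear forms. -/
def meanMin (F : I → Space N → Space N) (X P : RandVec N Q) : ℝ :=
  ∫ a, minInner (fun i => F i (X a)) (P a) ∂Q

theorem integrable_minInner [IsProbabilityMeasure Q] (hF : IsLipFamily F C L) (X P : RandVec N Q) :
    Integrable (fun a => minInner (fun i => F i (X a)) (P a)) Q := by
  refine ((integral_norm_le P).1.const_mul C).mono'
    (hF.measurable_minInner.comp (measurable_pair X P)).aestronglyMeasurable ?_
  exact .of_forall fun a => abs_minInner_le (fun i => hF.bound i _) _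

theorem meanMin_le_add [IsProbabilityMeasure Q] (hF : IsLipFamily F C L) (X P X' P' : RandVec N Q) :
    meanMin F X' P' ≤ meanMin F X P + (L * (‖X' - X‖ * ‖P'‖) + C * ‖P' - P‖) := by
  obtain ⟨h1, h1'⟩ := integral_norm_mul_norm_le (X' - X) P'
  obtain ⟨h2, h2'⟩ := integral_norm_le (P' - P)
  have hle : meanMin F X' P' ≤ ∫ a, (minInner (fun i => F i (X a)) (P a)
      + (L * (‖(X' - X) a‖ * ‖P' a‖) + C * ‖(P' - P) a‖)) ∂Q := by
    refine integral_mono_ae (integrable_minInner hF X' P')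
      ((integrable_minInner hF X P).add ((h1.const_mul L).add (h2.const_mul C))) ?_
    filter_upwards [Lp.coeFn_sub X' X, Lp.coeFn_sub P' P] with a e1 e2
    rw [e1, e2]
    simp only [Pi.sub_apply]
    rw [← mul_assoc]
    exact minInner_le_add (fun i => hF.lip i _ _) (fun i => hF.bound i _)
  refine hle.trans ?_
  have e1 := integral_add (integrable_minInner hF X P) ((h1.const_mul L).add (h2.const_mul C))
  have e2 := integral_add (h1.const_mul L) (h2.const_mul C)
  simp only [Pi.add_apply] at e1 e2
  rw [e1, e2, integral_const_mul, integral_const_mul]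
  have := hF.nonneg
  have := hF.bound_nonneg
  unfold meanMin
  gcongr

/-- `D` is, almost surely, one of the vectors `F i X`. -/
def IsSelection (F : I → Space N → Space N) (X D : RandVec N Q) : Prop :=
  ∀ᵐ a ∂Q, ∃ i, D a = F i (X a)

theorem IsSelection.pull {Ω' : Type*} [MeasurableSpace Ω'] {Q' : Measure Ω'} {j : Ω' → Ω}
    {X D : RandVec N Q} (h : IsSelection F X D) (hj : MeasurePreserving j Q' Q) :
    IsSelection F (RandVec.pull hj X) (RandVec.pull hj D) := by
  have h' := hj.quasiMeasurePreserving.ae h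
  filter_upwards [h', RandVec.coeFn_pull hj X, RandVec.coeFn_pull hj D] with a h1 h2 h3
  rw [h2, h3]
  exact h1

theorem IsSelection.norm_le [IsProbabilityMeasure Q] (hF : IsLipFamily F C L) {X D : RandVec N Q}
    (h : IsSelection F X D) : ‖D‖ ≤ C := by
  refine norm_le_of_ae_bound D hF.bound_nonneg ?_
  filter_upwards [h] with a ⟨i, hi⟩
  rw [hi]
  exact hF.bound i _

theorem IsSelection.meanMin_le_inner [IsProbabilityMeasure Q] (hF : IsLipFamily F C L)
    {X D : RandVec N Q} (h : IsSelection F X D) (P : RandVec N Q) :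
    meanMin F X P ≤ inner ℝ D P := by
  rw [RandVec.inner_def]
  refine integral_mono_ae (integrable_minInner hF X P) (L2.integrable_inner D P) ?_
  filter_upwards [h] with a ⟨i, hi⟩
  rw [hi]
  exact minInner_le _ _ i

theorem exists_isSelection [IsProbabilityMeasure Q] (hF : IsLipFamily F C L) (X P : RandVec N Q) :
    ∃ D : RandVec N Q, IsSelection F X D ∧ meanMin F X P = inner ℝ D P := by
  have hX := measurable_randVec X
  have hP := measurable_randVec P
  obtain ⟨D, hD, h⟩ := exists_measurable_argmin
    (g := fun i a => (inner ℝ (F i (X a)) (P a) : ℝ)) (φ := fun i a => F i (X a))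
    (fun i => ((hF.continuous i).measurable.comp hX).inner hP)
    (fun i => (hF.continuous i).measurable.comp hX)
  have hD2 : MemLp D 2 Q := MemLp.of_bound hD.aestronglyMeasurable C (.of_forall fun a => by
    obtain ⟨i, hi, -⟩ := h a
    rw [hi]
    exact hF.bound i _)
  refine ⟨hD2.toLp D, ?_, ?_⟩
  · filter_upwards [hD2.coeFn_toLp] with a e
    obtain ⟨i, hi, -⟩ := h a
    exact ⟨i, e.trans hi⟩
  · rw [RandVec.inner_def]
    apply integral_congr_ae
    filter_upwards [hD2.coeFn_toLp] with a e
    obtain ⟨i, hi, hi'⟩ := h a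
    rw [e, hi]
    exact le_antisymm (minInner_le _ _ i) (le_minInner hi')

theorem meanMin_pull {Ω' : Type*} [MeasurableSpace Ω'] {Q' : Measure Ω'} {j : Ω' → Ω}
    (hF : IsLipFamily F C L) (hj : MeasurePreserving j Q' Q) (X P : RandVec N Q) :
    meanMin F (RandVec.pull hj X) (RandVec.pull hj P) = meanMin F X P := by
  have h1 : meanMin F (RandVec.pull hj X) (RandVec.pull hj P)
      = ∫ a, minInner (fun i => F i (X (j a))) (P (j a)) ∂Q' := by
    apply integral_congr_ae
    filter_upwards [RandVec.coeFn_pull hj X, RandVec.coeFn_pull hj P] with a h2 h3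
    rw [h2, h3]
    rfl
  have h2 : ∫ a, minInner (fun i => F i (X a)) (P a) ∂(Q'.map j)
      = ∫ a, minInner (fun i => F i (X (j a))) (P (j a)) ∂Q' :=
    integral_map hj.measurable.aemeasurable
      (hF.measurable_minInner.comp (measurable_pair X P)).aestronglyMeasurable
  rw [h1, ← h2, hj.map_eq]
  rfl

theorem integral_minInner_lawOf [IsProbabilityMeasure Q] (hF : IsLipFamily F C L)
    {X Rv : RandVec N Q} {R : Space N → Space N} (hR : MemLp R 2 (lawOf X).meas)
    (hRv : Rv =ᵐ[Q] R ∘ X) :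
    ∫ x, minInner (fun i => F i x) (R x) ∂(lawOf X).meas = meanMin F X Rv := by
  rw [lawOf_meas] at hR ⊢
  rw [integral_map (measurable_randVec X).aemeasurable]
  · apply integral_congr_ae
    filter_upwards [hRv] with a h
    rw [h]
    rfl
  · have : AEMeasurable (fun x => (x, R x)) (Q.map X) :=
      aemeasurable_id.prodMk hR.1.aemeasurable
    exact (hF.measurable_minInner.comp_aemeasurable this).aestronglyMeasurable

/-- Jensen's inequality for the concave function `minInner`. -/
theorem meanMin_le_integral_condExp [IsProbabilityMeasure Q] (hF : IsLipFamily F C L)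
    {X P : RandVec N Q} {R : Space N → Space N} (hR : MemLp R 2 (lawOf X).meas)
    (h : ∀ ξ : Space N → Space N, MemLp ξ 2 (lawOf X).meas →
        ∫ a, inner ℝ (ξ (X a)) (P a) ∂Q = ∫ y, inner ℝ (ξ y) (R y) ∂(lawOf X).meas) :
    meanMin F X P ≤ ∫ x, minInner (fun i => F i x) (R x) ∂(lawOf X).meas := by
  obtain ⟨D, hD, hDa⟩ := exists_measurable_argmin
    (g := fun i (z : Space N × Space N) => (inner ℝ (F i z.1) z.2 : ℝ))
    (φ := fun i z => F i z.1)
    (fun i => by have := hF.continuous i; fun_prop)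
    (fun i => by have := hF.continuous i; fun_prop)
  let R' := hR.1.mk R
  have hR' : R =ᵐ[(lawOf X).meas] R' := hR.1.ae_eq_mk
  have hR'm : Measurable R' := hR.1.stronglyMeasurable_mk.measurable
  -- The field minimising against the conditional expectation depends on X alone, so it may be used
  -- as a test field; against P itself it is merely admissible.
  let ξ : Space N → Space N := fun x => D (x, R' x)
  have hξm : Measurable ξ := hD.comp (measurable_id.prodMk hR'm)
  have hξ : MemLp ξ 2 (lawOf X).meas :=
    MemLp.of_bound hξm.aestronglyMeasurable C (.of_forall fun x => by
      obtain ⟨i, hi, -⟩ := hDa (x, R' x)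
      change ‖D (x, R' x)‖ ≤ C
      rw [hi]
      exact hF.bound i _)
  have h1 : ∫ x, minInner (fun i => F i x) (R x) ∂(lawOf X).meas
      = ∫ y, inner ℝ (ξ y) (R y) ∂(lawOf X).meas := by
    apply integral_congr_ae
    filter_upwards [hR'] with x hx
    obtain ⟨i, hi, hi'⟩ := hDa (x, R' x)
    change _ = inner ℝ (D (x, R' x)) (R x)
    rw [hi, hx]
    exact le_antisymm (minInner_le _ _ i) (le_minInner hi')
  have hξX : MemLp (fun a => ξ (X a)) 2 Q :=
    hξ.comp_measurePreserving ⟨measurable_randVec X, rfl⟩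
  rw [h1, ← h ξ hξ]
  refine integral_mono (integrable_minInner hF X P)
    (integrable_inner_of_memLp hξX (Lp.memLp P)) fun a => ?_
  obtain ⟨i, hi, -⟩ := hDa (X a, R' (X a))
  change _ ≤ inner ℝ (D (X a, R' (X a))) (P a)
  rw [hi]
  exact minInner_le _ _ i

end MinInner

/-! ### Finite approximation of the Hamiltonian -/

section Hamiltonian

variable {N : ℕ} {EU EV : Type*}
    [NormedAddCommGroup EU] [MeasurableSpace EU] [BorelSpace EU]
    [NormedAddCommGroup EV] [MeasurableSpace EV] [BorelSpace EV]
    {U : Set EU} {V : Set EV} {f : Space N → U → V → Space N}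

theorem norm_le_supNorm (hf_bdd : ∃ C : ℝ, ∀ x u v, ‖f x u v‖ ≤ C) (x : Space N) (u : U) (v : V) :
    ‖f x u v‖ ≤ supNorm f := by
  obtain ⟨C, hC⟩ := hf_bdd
  exact le_ciSup (f := fun z : Space N × U × V => ‖f z.1 z.2.1 z.2.2‖)
    ⟨C, by rintro _ ⟨z, rfl⟩; exact hC _ _ _⟩ (x, u, v)

/-- The pointwise Hamiltonian for a given relaxed control of the second player. -/
def innerHam (f : Space N → U → V → Space N) (v : ProbabilityMeasure V) (x p : Space N) : ℝ :=
  ⨅ u : ProbabilityMeasure U,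
    ∫ z : U × V, inner ℝ (f x z.1 z.2) p ∂((u : Measure U).prod (v : Measure V))

theorem hamiltonian_eq (ν : WSpace N) (p : Space N → Space N) :
    hamiltonian f ν p = ⨆ v : ProbabilityMeasure V, ∫ x, innerHam f v x (p x) ∂ν.meas := rfl

/-- The dynamics averaged over a relaxed control of the second player. -/
def avgField (f : Space N → U → V → Space N) (v : ProbabilityMeasure V) (u : U) (x : Space N) :
    Space N := ∫ y, f x u y ∂(v : Measure V)

variable [CompactSpace U] [CompactSpace V]

theorem integrable_field (hf_bdd : ∃ C : ℝ, ∀ x u v, ‖f x u v‖ ≤ C)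
    (hf_uc : UniformContinuous (fun z : Space N × U × V => f z.1 z.2.1 z.2.2))
    (x : Space N) (m : Measure (U × V)) [IsProbabilityMeasure m] :
    Integrable (fun z : U × V => f x z.1 z.2) m := by
  have hc : Continuous fun z : U × V => f x z.1 z.2 :=
    hf_uc.continuous.comp (by fun_prop : Continuous fun z : U × V => (x, z.1, z.2))
  exact Integrable.of_bound hc.aestronglyMeasurable (supNorm f)
    (.of_forall fun z => norm_le_supNorm hf_bdd _ _ _)

theorem integrable_field_right (hf_bdd : ∃ C : ℝ, ∀ x u v, ‖f x u v‖ ≤ C)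
    (hf_uc : UniformContinuous (fun z : Space N × U × V => f z.1 z.2.1 z.2.2))
    (x : Space N) (u : U) (m : Measure V) [IsProbabilityMeasure m] :
    Integrable (fun y : V => f x u y) m := by
  have hc : Continuous fun y : V => f x u y :=
    hf_uc.continuous.comp (by fun_prop : Continuous fun y : V => (x, u, y))
  exact Integrable.of_bound hc.aestronglyMeasurable (supNorm f)
    (.of_forall fun z => norm_le_supNorm hf_bdd _ _ _)

theorem abs_integral_inner_field_le (hf_bdd : ∃ C : ℝ, ∀ x u v, ‖f x u v‖ ≤ C)
    (x p : Space N) (m : Measure (U × V))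
    [IsProbabilityMeasure m] : |∫ z, inner ℝ (f x z.1 z.2) p ∂m| ≤ supNorm f * ‖p‖ := by
  have := norm_integral_le_of_norm_le_const (μ := m) (f := fun z => (inner ℝ (f x z.1 z.2) p : ℝ))
    (C := supNorm f * ‖p‖) (.of_forall fun z => (norm_inner_le_norm _ _).trans
      (by gcongr; exact norm_le_supNorm hf_bdd _ _ _))
  simpa using this

theorem bddBelow_innerHam (hf_bdd : ∃ C : ℝ, ∀ x u v, ‖f x u v‖ ≤ C)
    (v : ProbabilityMeasure V) (x p : Space N) :
    BddBelow (Set.range fun u : ProbabilityMeasure U =>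
      ∫ z : U × V, inner ℝ (f x z.1 z.2) p ∂((u : Measure U).prod (v : Measure V))) :=
  ⟨-(supNorm f * ‖p‖), by
    rintro _ ⟨u, rfl⟩
    exact (abs_le.1 (abs_integral_inner_field_le hf_bdd x p _)).1⟩

variable [Nonempty U]

theorem abs_innerHam_le (hf_bdd : ∃ C : ℝ, ∀ x u v, ‖f x u v‖ ≤ C)
    (v : ProbabilityMeasure V) (x p : Space N) :
    |innerHam f v x p| ≤ supNorm f * ‖p‖ := by
  have u0 : ProbabilityMeasure U := ⟨Measure.dirac (Classical.arbitrary U), inferInstance⟩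
  have hne : Nonempty (ProbabilityMeasure U) := ⟨u0⟩
  rw [abs_le]
  constructor
  · exact le_ciInf fun u => (abs_le.1 (abs_integral_inner_field_le hf_bdd x p _)).1
  · exact (ciInf_le (bddBelow_innerHam hf_bdd v x p) u0).trans
      (abs_le.1 (abs_integral_inner_field_le hf_bdd x p _)).2

theorem innerHam_le_add (hf_bdd : ∃ C : ℝ, ∀ x u v, ‖f x u v‖ ≤ C)
    (hf_uc : UniformContinuous (fun z : Space N × U × V => f z.1 z.2.1 z.2.2)) {L : ℝ}
    (hf_lip : ∀ u v x y, ‖f x u v - f y u v‖ ≤ L * ‖x - y‖)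
    (v : ProbabilityMeasure V) (x p x' p' : Space N) :
    innerHam f v x' p' ≤ innerHam f v x p + (L * ‖x' - x‖ * ‖p'‖ + supNorm f * ‖p' - p‖) := by
  have u0 : ProbabilityMeasure U := ⟨Measure.dirac (Classical.arbitrary U), inferInstance⟩
  have hne : Nonempty (ProbabilityMeasure U) := ⟨u0⟩
  rw [← sub_le_iff_le_add]
  refine le_ciInf fun u => ?_
  rw [sub_le_iff_le_add]
  refine (ciInf_le (bddBelow_innerHam hf_bdd v x' p') u).trans ?_
  have hi := fun y q => (integrable_field hf_bdd hf_uc y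
    ((u : Measure U).prod (v : Measure V))).inner_const (𝕜 := ℝ) q
  have hc : ∫ _z : U × V, (L * ‖x' - x‖ * ‖p'‖ + supNorm f * ‖p' - p‖)
      ∂((u : Measure U).prod (v : Measure V)) = L * ‖x' - x‖ * ‖p'‖ + supNorm f * ‖p' - p‖ := by
    simp
  rw [← hc, ← integral_add (hi x p) (integrable_const _)]
  refine integral_mono (hi x' p') ((hi x p).add (integrable_const _)) fun z => ?_
  have h2 : (inner ℝ (f x' z.1 z.2) p' : ℝ) = inner ℝ (f x z.1 z.2) p
      + inner ℝ (f x' z.1 z.2 - f x z.1 z.2) p' + inner ℝ (f x z.1 z.2) (p' - p) := by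
    rw [inner_sub_left, inner_sub_right]; ring
  have h3 : (inner ℝ (f x' z.1 z.2 - f x z.1 z.2) p' : ℝ) ≤ L * ‖x' - x‖ * ‖p'‖ :=
    (real_inner_le_norm _ _).trans (by gcongr; exact hf_lip _ _ _ _)
  have h4 : (inner ℝ (f x z.1 z.2) (p' - p) : ℝ) ≤ supNorm f * ‖p' - p‖ :=
    (real_inner_le_norm _ _).trans (by gcongr; exact norm_le_supNorm hf_bdd _ _ _)
  simp only
  linarith

/-- Supplies the measurability of the integrand of the Hamiltonian, which is an infimum over a
possibly uncountable family. -/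
theorem continuous_innerHam (hf_bdd : ∃ C : ℝ, ∀ x u v, ‖f x u v‖ ≤ C)
    (hf_uc : UniformContinuous (fun z : Space N × U × V => f z.1 z.2.1 z.2.2)) {L : ℝ}
    (hf_lip : ∀ u v x y, ‖f x u v - f y u v‖ ≤ L * ‖x - y‖)
    (v : ProbabilityMeasure V) :
    Continuous fun z : Space N × Space N => innerHam f v z.1 z.2 := by
  rw [continuous_iff_continuousAt]
  intro z
  rw [ContinuousAt, tendsto_iff_dist_tendsto_zero]
  have hlim : Tendsto (fun z' : Space N × Space N =>
      (L * ‖z'.1 - z.1‖ * ‖z'.2‖ + supNorm f * ‖z'.2 - z.2‖)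
      + |L * ‖z.1 - z'.1‖ * ‖z.2‖ + supNorm f * ‖z.2 - z'.2‖|) (𝓝 z) (𝓝 0) := by
    have : Continuous (fun z' : Space N × Space N =>
      (L * ‖z'.1 - z.1‖ * ‖z'.2‖ + supNorm f * ‖z'.2 - z.2‖)
      + |L * ‖z.1 - z'.1‖ * ‖z.2‖ + supNorm f * ‖z.2 - z'.2‖|) := by fun_prop
    simpa using this.tendsto z
  refine squeeze_zero' (.of_forall fun _ => dist_nonneg) (.of_forall fun z' => ?_) hlim
  have h1 := innerHam_le_add hf_bdd hf_uc hf_lip v z.1 z.2 z'.1 z'.2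
  have h2 := innerHam_le_add hf_bdd hf_uc hf_lip v z'.1 z'.2 z.1 z.2
  have h3 : 0 ≤ supNorm f := (norm_nonneg _).trans (norm_le_supNorm hf_bdd 0
    (Classical.arbitrary U) (Classical.choice (nonempty_of_isProbabilityMeasure (v : Measure V))))
  have h4 : 0 ≤ L * ‖z'.1 - z.1‖ := (norm_nonneg _).trans (hf_lip (Classical.arbitrary U)
    (Classical.choice (nonempty_of_isProbabilityMeasure (v : Measure V))) _ _)
  have h5 : 0 ≤ L * ‖z'.1 - z.1‖ * ‖z'.2‖ + supNorm f * ‖z'.2 - z.2‖ := by positivity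
  rw [Real.dist_eq, abs_sub_le_iff]
  constructor
  · linarith [abs_nonneg (L * ‖z.1 - z'.1‖ * ‖z.2‖ + supNorm f * ‖z.2 - z'.2‖)]
  · linarith [le_abs_self (L * ‖z.1 - z'.1‖ * ‖z.2‖ + supNorm f * ‖z.2 - z'.2‖)]

theorem integrable_innerHam (hf_bdd : ∃ C : ℝ, ∀ x u v, ‖f x u v‖ ≤ C)
    (hf_uc : UniformContinuous (fun z : Space N × U × V => f z.1 z.2.1 z.2.2)) {L : ℝ}
    (hf_lip : ∀ u v x y, ‖f x u v - f y u v‖ ≤ L * ‖x - y‖)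
    (v : ProbabilityMeasure V) {ν : WSpace N} {p : Space N → Space N}
    (hp : MemLp p 2 ν.meas) : Integrable (fun x => innerHam f v x (p x)) ν.meas := by
  have hpair : AEMeasurable (fun x => (x, p x)) ν.meas :=
    aemeasurable_id.prodMk hp.1.aemeasurable
  have hm := ((continuous_innerHam hf_bdd hf_uc hf_lip v).measurable.comp_aemeasurable
    hpair).aestronglyMeasurable
  have hp1 : Integrable (fun x => ‖p x‖) ν.meas := (hp.integrable (by norm_num)).norm
  refine (hp1.const_mul (supNorm f)).mono' hm (.of_forall fun x => ?_)
  rw [Real.norm_eq_abs]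
  exact abs_innerHam_le hf_bdd v x (p x)

theorem norm_avgField_le (hf_bdd : ∃ C : ℝ, ∀ x u v, ‖f x u v‖ ≤ C)
    (v : ProbabilityMeasure V) (u : U) (x : Space N) :
    ‖avgField f v u x‖ ≤ supNorm f := by
  have := norm_integral_le_of_norm_le_const (μ := (v : Measure V)) (f := fun y => f x u y)
    (.of_forall fun y => norm_le_supNorm hf_bdd x u y)
  simpa [avgField] using this

theorem norm_avgField_sub_le (hf_bdd : ∃ C : ℝ, ∀ x u v, ‖f x u v‖ ≤ C)
    (hf_uc : UniformContinuous (fun z : Space N × U × V => f z.1 z.2.1 z.2.2))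
    (v : ProbabilityMeasure V) {u u' : U} {x x' : Space N} {c : ℝ}
    (h : ∀ y, ‖f x u y - f x' u' y‖ ≤ c) : ‖avgField f v u x - avgField f v u' x'‖ ≤ c := by
  rw [avgField, avgField, ← integral_sub (integrable_field_right hf_bdd hf_uc _ _ _)
    (integrable_field_right hf_bdd hf_uc _ _ _)]
  have := norm_integral_le_of_norm_le_const (μ := (v : Measure V))
    (f := fun y => f x u y - f x' u' y) (.of_forall h)
  simpa using this

theorem innerHam_le_avgField (hf_bdd : ∃ C : ℝ, ∀ x u v, ‖f x u v‖ ≤ C)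
    (hf_uc : UniformContinuous (fun z : Space N × U × V => f z.1 z.2.1 z.2.2))
    (v : ProbabilityMeasure V) (u : U) (x p : Space N) :
    innerHam f v x p ≤ inner ℝ (avgField f v u x) p := by
  refine (ciInf_le (bddBelow_innerHam hf_bdd v x p)
    ⟨Measure.dirac u, inferInstance⟩).trans_eq ?_
  have hi := (integrable_field hf_bdd hf_uc x ((Measure.dirac u).prod (v : Measure V))).inner_const
    (𝕜 := ℝ) p
  change ∫ z : U × V, inner ℝ (f x z.1 z.2) p ∂((Measure.dirac u).prod (v : Measure V)) = _
  rw [integral_prod _ hi, integral_dirac, avgField, real_inner_comm,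
    ← integral_inner (integrable_field_right hf_bdd hf_uc _ _ _)]
  simp_rw [real_inner_comm p]

/-- The integral is linear in the relaxed control u, so averaging cannot go below a bound valid for
pure controls. Together with `innerHam_le_avgField`, where u is a Dirac mass, this removes
relaxation for the minimiser. -/
theorem le_innerHam (hf_bdd : ∃ C : ℝ, ∀ x u v, ‖f x u v‖ ≤ C)
    (hf_uc : UniformContinuous (fun z : Space N × U × V => f z.1 z.2.1 z.2.2))
    (v : ProbabilityMeasure V) (x p : Space N) {c : ℝ}
    (h : ∀ u, c ≤ inner ℝ (avgField f v u x) p) : c ≤ innerHam f v x p := by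
  have u0 : ProbabilityMeasure U := ⟨Measure.dirac (Classical.arbitrary U), inferInstance⟩
  have hne : Nonempty (ProbabilityMeasure U) := ⟨u0⟩
  refine le_ciInf fun u => ?_
  have hi := (integrable_field hf_bdd hf_uc x ((u : Measure U).prod (v : Measure V))).inner_const
    (𝕜 := ℝ) p
  have hc : ∫ _u : U, c ∂(u : Measure U) = c := by simp
  rw [integral_prod _ hi, ← hc]
  refine integral_mono (integrable_const _) hi.integral_prod_left fun a => ?_
  refine (h a).trans_eq ?_
  rw [avgField, real_inner_comm, ← integral_inner (integrable_field_right hf_bdd hf_uc _ _ _)]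
  simp_rw [real_inner_comm p]

theorem exists_finite_control_net
    (hf_uc : UniformContinuous (fun z : Space N × U × V => f z.1 z.2.1 z.2.2))
    {e : ℝ} (he : 0 < e) : ∃ s : Set U, s.Finite ∧ s.Nonempty ∧
    ∀ u, ∃ u' ∈ s, ∀ x y, ‖f x u y - f x u' y‖ ≤ e := by
  obtain ⟨δ, hδ, h⟩ := Metric.uniformContinuous_iff.1 hf_uc e he
  obtain ⟨s, -, hs, hcov⟩ := (isCompact_univ (X := U)).finite_cover_balls hδ
  have key : ∀ u, ∃ u' ∈ s, ∀ x y, ‖f x u y - f x u' y‖ ≤ e := by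
    intro u
    obtain ⟨u', hu', hd⟩ := Set.mem_iUnion₂.1 (hcov (Set.mem_univ u))
    refine ⟨u', hu', fun x y => ?_⟩
    have := h (a := (x, u, y)) (b := (x, u', y)) (by
      simp only [Prod.dist_eq, dist_self]
      simpa [hδ] using hd)
    rw [dist_eq_norm] at this
    exact this.le
  obtain ⟨u', hu', -⟩ := key (Classical.arbitrary U)
  exact ⟨s, hs, ⟨u', hu'⟩, key⟩

/-- By uniform continuity y ↦ f(·,·,y) maps V continuously into bounded continuous functions with
the sup norm. Averaged fields lie in the closed convex hull of this compact image, which is totally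
bounded. -/
theorem exists_finite_relaxed_net (hf_bdd : ∃ C : ℝ, ∀ x u v, ‖f x u v‖ ≤ C)
    (hf_uc : UniformContinuous (fun z : Space N × U × V => f z.1 z.2.1 z.2.2))
    {e : ℝ} (he : 0 < e) : ∃ s : Set (ProbabilityMeasure V),
    s.Finite ∧ ∀ v, ∃ v' ∈ s, ∀ u x, ‖avgField f v u x - avgField f v' u x‖ ≤ e := by
  let Φ : V → (Space N × U →ᵇ Space N) := fun y =>
    BoundedContinuousFunction.ofNormedAddCommGroup (fun z => f z.1 z.2 y)
      (hf_uc.continuous.comp (by fun_prop : Continuous fun z : Space N × U => (z.1, z.2, y)))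
      (supNorm f) (fun z => norm_le_supNorm hf_bdd _ _ _)
  have hΦ : Continuous Φ := by
    refine Metric.continuous_iff.2 fun y ε hε => ?_
    obtain ⟨δ, hδ, h⟩ := Metric.uniformContinuous_iff.1 hf_uc (ε / 2) (by positivity)
    refine ⟨δ, hδ, fun y' hy' => ?_⟩
    refine lt_of_le_of_lt ((BoundedContinuousFunction.dist_le (C := ε / 2) (by positivity)).2
      fun z => ?_) (half_lt_self hε)
    exact (h (a := (z.1, z.2, y')) (b := (z.1, z.2, y)) (by
      simp only [Prod.dist_eq, dist_self]
      simpa [hδ] using hy')).le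
  have hbd : ∀ y, ‖Φ y‖ ≤ |supNorm f| := fun y =>
    (BoundedContinuousFunction.norm_le (abs_nonneg _)).2 fun z =>
      (norm_le_supNorm hf_bdd _ _ _).trans (le_abs_self _)
  have hint : ∀ v : ProbabilityMeasure V, Integrable Φ (v : Measure V) := fun v =>
    Integrable.of_bound hΦ.aestronglyMeasurable _ (.of_forall hbd)
  let G : ProbabilityMeasure V → (Space N × U →ᵇ Space N) := fun v => ∫ y, Φ y ∂(v : Measure V)
  have hG : ∀ v u x, G v (x, u) = avgField f v u x := fun v u x =>
    ((BoundedContinuousFunction.evalCLM ℝ (x, u)).integral_comp_comm (hint v)).symm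
  let K := closure (convexHull ℝ (Set.range Φ))
  have hK : TotallyBounded K :=
    ((isCompact_range hΦ).totallyBounded.convexHull).closure
  have hmem : ∀ v, G v ∈ K := fun v =>
    (convex_convexHull ℝ _).closure.integral_mem isClosed_closure
      (.of_forall fun y => subset_closure (subset_convexHull ℝ _ ⟨y, rfl⟩)) (hint v)
  have hS : TotallyBounded (Set.range G) := hK.subset (by rintro _ ⟨v, rfl⟩; exact hmem v)
  obtain ⟨t, hts, htf, hcov⟩ := hS.exists_subset (Metric.dist_mem_uniformity he)
  obtain ⟨s, hs, hst⟩ : ∃ s : Set (ProbabilityMeasure V), s.Finite ∧ t ⊆ G '' s := by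
    choose c hc using fun g : t => hts g.2
    have := htf.to_subtype
    exact ⟨Set.range c, Set.finite_range c, fun g hg => ⟨c ⟨g, hg⟩, ⟨_, rfl⟩, hc ⟨g, hg⟩⟩⟩
  refine ⟨s, hs, fun v => ?_⟩
  obtain ⟨_, hg, hd⟩ := Set.mem_iUnion₂.1 (hcov ⟨v, rfl⟩)
  obtain ⟨v', hv', rfl⟩ := hst hg
  refine ⟨v', hv', fun u x => ?_⟩
  rw [← hG, ← hG, ← dist_eq_norm]
  exact (BoundedContinuousFunction.dist_coe_le_dist (x, u)).trans (le_of_lt hd)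

/-- The Hamiltonian is uniformly approximated by finitely many averaged minima. -/
theorem exists_hamiltonian_net (hf_bdd : ∃ C : ℝ, ∀ x u v, ‖f x u v‖ ≤ C)
    (hf_uc : UniformContinuous (fun z : Space N × U × V => f z.1 z.2.1 z.2.2))
    {L : ℝ} (hL : 0 ≤ L)
    (hf_lip : ∀ u v x y, ‖f x u v - f y u v‖ ≤ L * ‖x - y‖)
    [Nonempty V] {e : ℝ} (he : 0 < e) :
    ∃ (n m : ℕ) (F : Fin n → Fin (m + 1) → Space N → Space N),
      (∀ k, IsLipFamily (F k) (supNorm f) L) ∧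
      (∀ (ν : WSpace N) (R : Space N → Space N) (c : ℝ), MemLp R 2 ν.meas →
        (∀ k, ∫ x, minInner (fun i => F k i x) (R x) ∂ν.meas + e * ∫ x, ‖R x‖ ∂ν.meas ≤ c) →
        hamiltonian f ν R ≤ c) ∧
      (∀ (ν : WSpace N) (R : Space N → Space N), MemLp R 2 ν.meas → ∀ k,
        ∫ x, minInner (fun i => F k i x) (R x) ∂ν.meas - e * ∫ x, ‖R x‖ ∂ν.meas
          ≤ hamiltonian f ν R) := by
  obtain ⟨sU, hsU, hsU0, hU⟩ := exists_finite_control_net hf_uc he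
  obtain ⟨sV, hsV, hV⟩ := exists_finite_relaxed_net hf_bdd hf_uc he
  -- Indexing by `Fin (m + 1)` makes the index set nonempty, as the minima over it require.
  obtain ⟨m, a, ha⟩ : ∃ (m : ℕ) (a : Fin (m + 1) → U), sU ⊆ Set.range a := by
    obtain ⟨k, a, -, ha⟩ := hsU.fin_param
    obtain ⟨u, hu⟩ := hsU0
    rw [← ha] at hu
    obtain ⟨i, -⟩ := hu
    obtain ⟨m, rfl⟩ := Nat.exists_eq_succ_of_ne_zero (Fin.pos i).ne'
    exact ⟨m, a, ha.ge⟩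
  obtain ⟨n, b, hb⟩ : ∃ (n : ℕ) (b : Fin n → ProbabilityMeasure V), sV ⊆ Set.range b := by
    obtain ⟨k, b, -, hb⟩ := hsV.fin_param
    exact ⟨k, b, hb.ge⟩
  let F : Fin n → Fin (m + 1) → Space N → Space N := fun k i => avgField f (b k) (a i)
  have hF : ∀ k, IsLipFamily (F k) (supNorm f) L := fun k =>
    ⟨fun i x => norm_avgField_le hf_bdd _ _ _,
      fun i x y => norm_avgField_sub_le hf_bdd hf_uc _ fun v => hf_lip _ _ _ _, hL⟩
  have hint : ∀ k (ν : WSpace N) (R : Space N → Space N), MemLp R 2 ν.meas →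
      Integrable (fun x => minInner (fun i => F k i x) (R x)) ν.meas := by
    intro k ν R hR
    refine ((hR.integrable (by norm_num)).norm.const_mul (supNorm f)).mono'
      ((hF k).measurable_minInner.comp_aemeasurable
        (aemeasurable_id.prodMk hR.1.aemeasurable)).aestronglyMeasurable (.of_forall fun x => ?_)
    exact abs_minInner_le (fun i => (hF k).bound i x) _
  have hinst : Nonempty (ProbabilityMeasure V) :=
    ⟨⟨Measure.dirac (Classical.arbitrary V), inferInstance⟩⟩
  refine ⟨n, m, F, hF, fun ν R c hR hc => ?_, fun ν R hR k => ?_⟩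
  · rw [hamiltonian_eq]
    refine ciSup_le fun v => ?_
    obtain ⟨v', hv', hd⟩ := hV v
    obtain ⟨k, rfl⟩ := hb hv'
    have hRi := (hR.integrable (by norm_num)).norm
    refine le_trans ?_ (hc k)
    rw [← integral_const_mul, ← integral_add (hint k ν R hR) (hRi.const_mul e)]
    refine integral_mono (integrable_innerHam hf_bdd hf_uc hf_lip v hR)
      ((hint k ν R hR).add (hRi.const_mul e)) fun x => ?_
    change innerHam f v x (R x) ≤ minInner (fun i => F k i x) (R x) + e * ‖R x‖
    rw [← sub_le_iff_le_add]
    refine le_minInner fun i => ?_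
    rw [sub_le_iff_le_add]
    refine (innerHam_le_avgField hf_bdd hf_uc v (a i) x (R x)).trans ?_
    have h1 : (inner ℝ (avgField f v (a i) x - F k i x) (R x) : ℝ) ≤ e * ‖R x‖ :=
      (real_inner_le_norm _ _).trans (by gcongr; exact hd _ _)
    rw [inner_sub_left] at h1
    linarith
  · rw [hamiltonian_eq]
    have hRi := (hR.integrable (by norm_num)).norm
    refine le_trans ?_ (le_ciSup (f := fun v => ∫ x, innerHam f v x (R x) ∂ν.meas)
      ⟨supNorm f * ∫ x, ‖R x‖ ∂ν.meas, ?_⟩ (b k))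
    · rw [← integral_const_mul, ← integral_sub (hint k ν R hR) (hRi.const_mul e)]
      refine integral_mono ((hint k ν R hR).sub (hRi.const_mul e))
        (integrable_innerHam hf_bdd hf_uc hf_lip (b k) hR) fun x => ?_
      change minInner (fun i => F k i x) (R x) - e * ‖R x‖ ≤ innerHam f (b k) x (R x)
      refine le_innerHam hf_bdd hf_uc _ _ _ fun u => ?_
      obtain ⟨u', hu', hd⟩ := hU u
      obtain ⟨i, rfl⟩ := ha hu'
      have h1 := minInner_le (fun i => F k i x) (R x) i
      have h2 : (inner ℝ (avgField f (b k) (a i) x - avgField f (b k) u x) (R x) : ℝ)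
          ≤ e * ‖R x‖ := (real_inner_le_norm _ _).trans (by
            gcongr
            rw [norm_sub_rev]
            exact norm_avgField_sub_le hf_bdd hf_uc _ fun y => hd _ _)
      rw [inner_sub_left] at h2
      change _ ≤ inner ℝ (avgField f (b k) (a i) x) (R x) at h1
      linarith
    · rintro _ ⟨v, rfl⟩
      simp only
      rw [← integral_const_mul]
      refine integral_mono (integrable_innerHam hf_bdd hf_uc hf_lip v hR)
        (hRi.const_mul _) fun x => ?_
      exact (abs_le.1 (abs_innerHam_le hf_bdd v x (R x))).2

end Hamiltonian

/-! ### Touching points and their perturbation -/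

section Touch

variable {N : ℕ}

/-- `w` is touched from above at `(t, ν)` by an admissible test function with time slope `τ`. -/
def TouchAt (T : ℝ) (w : ℝ → WSpace N → ℝ) (t τ k α η : ℝ) (μbar ν : WSpace N) : Prop :=
  ∀ s ∈ Set.Icc (0 : ℝ) T, ∀ ν' : WSpace N,
    w s ν' - (α / 2 * wdist μbar ν' ^ 2 + η * wdist ν ν' + τ * (s - t) + k / 2 * (s - t) ^ 2)
      ≤ w t ν - α / 2 * wdist μbar ν ^ 2

/-- Lipschitz continuity on the strip with constant `K`. -/
def LipStrip (T K : ℝ) (w : ℝ → WSpace N → ℝ) : Prop :=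
  ∀ s ∈ Set.Icc (0 : ℝ) T, ∀ t ∈ Set.Icc (0 : ℝ) T, ∀ μ ν : WSpace N,
    |w s μ - w t ν| ≤ K * (|s - t| + wdist μ ν)

theorem LipschitzOnStrip.exists_nonneg {T : ℝ} {w : ℝ → WSpace N → ℝ} (h : LipschitzOnStrip T w) :
    ∃ K, 0 ≤ K ∧ LipStrip T K w := by
  obtain ⟨K, hK⟩ := h
  refine ⟨|K|, abs_nonneg K, fun s hs t ht μ ν => (hK s hs t ht μ ν).trans ?_⟩
  have := wdist_nonneg μ ν
  gcongr
  exact le_abs_self K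

theorem lipschitzWith_lawOf {Ω : Type*} [MeasurableSpace Ω] {Q : Measure Ω}
    [IsProbabilityMeasure Q] : LipschitzWith 1 (lawOf : RandVec N Q → WSpace N) :=
  LipschitzWith.mk_one fun X Y => by
    rw [dist_eq_wdist, dist_eq_norm]
    exact wdist_lawOf_le X Y

theorem continuous_wdist : Continuous fun z : WSpace N × WSpace N => wdist z.1 z.2 :=
  continuous_dist

theorem LipStrip.continuous {T K : ℝ} {w : ℝ → WSpace N → ℝ} (hK : 0 ≤ K) (h : LipStrip T K w) :
    Continuous fun z : Set.Icc (0 : ℝ) T × WSpace N => w z.1 z.2 := by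
  refine (LipschitzWith.of_dist_le_mul (K := (2 * K).toNNReal) fun x y => ?_).continuous
  rw [Real.coe_toNNReal _ (by positivity), Real.dist_eq]
  refine (h _ x.1.2 _ y.1.2 _ _).trans ?_
  have h1 : |(x.1 : ℝ) - y.1| ≤ dist x y := (le_max_left (dist x.1 y.1) (dist x.2 y.2))
  have h2 : wdist x.2 y.2 ≤ dist x y := (le_max_right (dist x.1 y.1) (dist x.2 y.2))
  nlinarith

/-- Subsolutions satisfy the differential inequality at touching points. -/
theorem IsSubsolution.of_touchAt {EU EV : Type*} [NormedAddCommGroup EU] [MeasurableSpace EU]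
    [NormedAddCommGroup EV] [MeasurableSpace EV] {U : Set EU} {V : Set EV}
    {f : Space N → U → V → Space N} {T : ℝ} {w : ℝ → WSpace N → ℝ} (hw : IsSubsolution T f w)
    {t τ k α η : ℝ} {μbar ν : WSpace N} (ht : t ∈ Set.Ico (0 : ℝ) T) (hα : 0 < α) (hη : 0 < η)
    (h : TouchAt T w t τ k α η μbar ν) {π : Measure (Space N × Space N)}
    (hπ : π ∈ optPlans μbar ν) {p : Space N → Space N} (hp : IsPlanGradient ν π p) :
    -(supNorm f * η) ≤ τ + hamiltonian f ν (fun y => -(α • p y)) := by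
  have hd : HasDerivAt (fun s : ℝ => τ * (s - t) + k / 2 * (s - t) ^ 2) τ t := by
    have h1 := ((hasDerivAt_id t).sub_const t)
    have h2 := (h1.const_mul τ).add ((h1.pow 2).const_mul (k / 2))
    refine h2.congr_deriv ?_
    simp
  have := hw.2 (fun s => τ * (s - t) + k / 2 * (s - t) ^ 2) α η μbar ν t (by fun_prop) hα hη ht
    ⟨1, one_pos, fun s hs μ _ _ => by
      have h1 := h s hs μ
      have h2 := wdist_self ν
      simp only [sub_self, h2]
      linarith⟩ π hπ p hp
  rw [hd.deriv] at this
  exact this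

variable {Ω : Type*} [MeasurableSpace Ω] {Q : Measure Ω} [IsProbabilityMeasure Q]

/-- The slope at a touching point is bounded by the Lipschitz constant. -/
theorem TouchAt.slope_le {T K t τ k α η : ℝ} {w : ℝ → WSpace N → ℝ} (hw : LipStrip T K w)
    (ht : t ∈ Set.Icc (0 : ℝ) T) (hα : 0 < α) {Xb X : RandVec N Q}
    (h : TouchAt T w t τ k α η (lawOf Xb) (lawOf X)) (hη : 0 ≤ η) (hK : 0 ≤ K)
    (hopt : jointLaw Xb X ∈ optPlans (lawOf Xb) (lawOf X)) :
    ‖α • (X - Xb)‖ ≤ K + η := by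
  have hd : ‖X - Xb‖ = wdist (lawOf Xb) (lawOf X) := by
    rw [norm_sub_rev, norm_sub_of_jointLaw_mem_optPlans hopt]
  rw [norm_smul, Real.norm_of_nonneg hα.le]
  set d := ‖X - Xb‖
  have hd0 : 0 ≤ d := norm_nonneg _
  have key : ∀ r : ℝ, 0 < r → r ≤ 1 → α * d ^ 2 * (1 - r / 2) ≤ (K + η) * d := by
    intro r hr hr1
    -- Moving towards Xb lowers the quadratic term at rate α d², while w and the η-term change at
    -- rate at most (K + η) d.
    let X' := X - r • (X - Xb)
    have h1 : wdist (lawOf Xb) (lawOf X') ≤ (1 - r) * d := by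
      refine (wdist_lawOf_le _ _).trans_eq ?_
      rw [show Xb - X' = -((1 - r) • (X - Xb)) by simp only [X']; module, norm_neg, norm_smul,
        Real.norm_of_nonneg (by linarith)]
    have h2 : wdist (lawOf X) (lawOf X') ≤ r * d := by
      refine (wdist_lawOf_le _ _).trans_eq ?_
      rw [show X - X' = r • (X - Xb) by simp only [X']; module, norm_smul,
        Real.norm_of_nonneg hr.le]
    have h3 := h t ht (lawOf X')
    rw [← hd] at h3
    have h4 := (abs_le.1 (hw t ht t ht (lawOf X) (lawOf X'))).2
    simp only [sub_self, abs_zero, zero_add] at h3 h4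
    have h5 : wdist (lawOf Xb) (lawOf X') ^ 2 ≤ ((1 - r) * d) ^ 2 :=
      pow_le_pow_left₀ (wdist_nonneg _ _) h1 2
    have h6 : α / 2 * wdist (lawOf Xb) (lawOf X') ^ 2 ≤ α / 2 * ((1 - r) * d) ^ 2 := by gcongr
    have h7 : η * wdist (lawOf X) (lawOf X') ≤ η * (r * d) := by gcongr
    have h8 : K * wdist (lawOf X) (lawOf X') ≤ K * (r * d) := by gcongr
    have h9 : r * (α * d ^ 2 * (1 - r / 2)) ≤ r * ((K + η) * d) := by nlinarith
    exact le_of_mul_le_mul_left h9 hr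
  by_contra! hlt
  have hdpos : 0 < d := by
    rcases hd0.eq_or_lt with h0 | h0
    · rw [← h0] at hlt; linarith
    · exact h0
  have hαd : 0 < α * d := by positivity
  -- This r replaces the limit r → 0: it yields (α d + K + η)/2 ≤ K + η, contrary to `hlt`.
  have h1 := key ((α * d - (K + η)) / (α * d)) (div_pos (by linarith) hαd)
    ((div_le_one hαd).2 (by linarith))
  have h2 : α * d * (1 - (α * d - (K + η)) / (α * d) / 2) ≤ K + η := by
    refine le_of_mul_le_mul_right ?_ hdpos
    calc _ = α * d ^ 2 * (1 - (α * d - (K + η)) / (α * d) / 2) := by ring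
      _ ≤ _ := h1
  have h3 : α * d * (1 - (α * d - (K + η)) / (α * d) / 2) = (α * d + (K + η)) / 2 := by
    field_simp
    ring
  linarith

/-- The parameters of the perturbed variational problem. -/
abbrev ParamBox (h T : ℝ) := Set.Icc (0 : ℝ) h × Set.Icc (0 : ℝ) T

/-- Perturbing a touching point: the slope `P = α (X - Xb)` is pushed in the direction `Z`, or the
touching point moves along `-h Z`. -/
theorem TouchAt.exists_push {T K t τ k α η : ℝ} {w : ℝ → WSpace N → ℝ} (hw : LipStrip T K w)
    (hK : 0 ≤ K) (ht : t ∈ Set.Icc (0 : ℝ) T) (hα : 0 < α) (hη : 0 ≤ η) {Xb X : RandVec N Q}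
    (h : TouchAt T w t τ k α η (lawOf Xb) (lawOf X))
    (hopt : jointLaw Xb X ∈ optPlans (lawOf Xb) (lawOf X))
    (Z : RandVec N Q) {M hs β η' : ℝ} (hM : 0 < M) (hhs : 0 ≤ hs) (hη' : 0 < η') :
    ∃ σ ∈ Set.Icc 0 hs, ∃ t' ∈ Set.Icc (0 : ℝ) T, ∃ (Q' : Measure (Ω × Space N))
      (_ : IsProbabilityMeasure Q') (hj : MeasurePreserving Prod.fst Q' Q) (Xb' X' : RandVec N Q'),
      Xb' = RandVec.pull hj (X - σ • Z - M⁻¹ • (α • (X - Xb))) ∧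
      jointLaw Xb' X' ∈ optPlans (lawOf Xb') (lawOf X') ∧
      TouchAt T w t' (τ + (k + 1) * (t' - t)) (k + 1) M (η + η') (lawOf Xb') (lawOf X') ∧
      M / 2 * ‖X' - RandVec.pull hj (X - σ • Z)‖ ^ 2 + 1 / 2 * (t' - t) ^ 2
        ≤ β * σ + α / 2 * ‖X' - RandVec.pull hj X‖ ^ 2 ∧
      (σ < hs → β ≤ inner ℝ (M • (X' - RandVec.pull hj (X - σ • Z))) (RandVec.pull hj Z)) := by
  set P : RandVec N Q := α • (X - Xb) with hP
  let ζ : ℝ → WSpace N := fun σ => lawOf (X - σ • Z - M⁻¹ • P)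
  have hζ : Continuous ζ := lipschitzWith_lawOf.continuous.comp (by fun_prop)
  let ν := lawOf X
  -- The term σ⟨P,Z⟩ cancels the linear effect of shifting the centre along -σZ, and β is the reward
  -- per unit of shift. Raising k to k + 1 gives the strict gain that controls t' - t.
  let Φ : ParamBox hs T → WSpace N → ℝ := fun a ν' =>
    w a.2 ν' - M / 2 * wdist (ζ a.1) ν' ^ 2 + a.1 * (inner ℝ P Z + β) - η * wdist ν ν'
      - τ * (a.2 - t) - (k + 1) / 2 * ((a.2 : ℝ) - t) ^ 2
  have hΦ : Continuous fun z : ParamBox hs T × WSpace N => Φ z.1 z.2 := by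
    have h1 : Continuous fun z : ParamBox hs T × WSpace N => w z.1.2 z.2 :=
      (hw.continuous hK).comp (by fun_prop : Continuous fun z : ParamBox hs T × WSpace N => (z.1.2, z.2))
    have h2 : Continuous fun z : ParamBox hs T × WSpace N => wdist (ζ z.1.1) z.2 :=
      continuous_wdist.comp (f := fun z : ParamBox hs T × WSpace N => (ζ z.1.1, z.2)) (by fun_prop)
    have h3 : Continuous fun z : ParamBox hs T × WSpace N => wdist ν z.2 :=
      continuous_wdist.comp (f := fun z : ParamBox hs T × WSpace N => (ν, z.2)) (by fun_prop)
    simp only [Φ]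
    exact ((((h1.sub (continuous_const.mul (h2.pow 2))).add (by fun_prop)).sub
      (continuous_const.mul h3)).sub (by fun_prop)).sub (by fun_prop)
  obtain ⟨B, hB⟩ : ∃ B, ∀ a ν', Φ a ν' ≤ B := by
    let G : ParamBox hs T → ℝ := fun a => w t ν + K * (|(a.2 : ℝ) - t| + wdist ν (ζ a.1))
      + a.1 * (inner ℝ P Z + β) - τ * (a.2 - t) - (k + 1) / 2 * ((a.2 : ℝ) - t) ^ 2
    have hG : Continuous G := by
      have h2 : Continuous fun z : ParamBox hs T => wdist ν (ζ z.1) :=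
        continuous_wdist.comp (f := fun z : ParamBox hs T => (ν, ζ z.1)) (by fun_prop)
      simp only [G]
      fun_prop
    obtain ⟨B, hB⟩ := (isCompact_range hG).bddAbove
    refine ⟨B + K ^ 2 / (2 * M), fun a ν' => ?_⟩
    have h1 := hB ⟨a, rfl⟩
    have h2 := (abs_le.1 (hw a.2 a.2.2 t ht ν' ν)).2
    have h3 : wdist ν' ν ≤ wdist ν (ζ a.1) + wdist (ζ a.1) ν' := by
      rw [wdist_comm]; exact wdist_triangle _ _ _
    have h4 : K * wdist (ζ a.1) ν' - M / 2 * wdist (ζ a.1) ν' ^ 2 ≤ K ^ 2 / (2 * M) := by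
      rw [le_div_iff₀ (by positivity)]
      nlinarith [sq_nonneg (K - M * wdist (ζ a.1) ν')]
    have h5 : K * wdist ν' ν ≤ K * (wdist ν (ζ a.1) + wdist (ζ a.1) ν') := by gcongr
    have h6 : 0 ≤ η * wdist ν ν' := mul_nonneg hη (wdist_nonneg _ _)
    simp only [G] at h1
    simp only [Φ]
    linarith
  let a0 : ParamBox hs T := (⟨0, le_rfl, hhs⟩, ⟨t, ht⟩)
  obtain ⟨⟨σ, t'⟩, ν', hle, hmax⟩ := exists_ekeland_param hΦ hB hη' a0 ν
  obtain ⟨π, hπ⟩ := optPlans_nonempty (ζ σ) ν'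
  obtain ⟨Q', hQ', hj, X', hX', hX'law⟩ := exists_gluing (X - (σ : ℝ) • Z - M⁻¹ • P) hπ.1
  set j := RandVec.pull hj with hjdef
  have hlaw : lawOf (j (X - (σ : ℝ) • Z - M⁻¹ • P)) = ζ σ := lawOf_pull hj _
  subst hX'law
  set Y := X' - j X with hY
  have hu : ∀ s : ℝ, X' - j (X - s • Z - M⁻¹ • P) = (Y + s • j Z) + M⁻¹ • j P := by
    intro s
    simp only [hY, map_sub, map_smul]
    abel
  have hexp : ∀ s : ℝ, M / 2 * ‖(Y + s • j Z) + M⁻¹ • j P‖ ^ 2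
      = M / 2 * ‖Y + s • j Z‖ ^ 2 + inner ℝ (j P) Y + s * inner ℝ P Z + ‖P‖ ^ 2 / (2 * M) := by
    intro s
    rw [norm_add_sq_real, inner_smul_right, norm_smul, inner_add_left, inner_smul_left,
      LinearIsometry.norm_map, real_inner_comm (j P) Y, real_inner_comm (j P) (j Z),
      LinearIsometry.inner_map_map, Real.norm_of_nonneg (by positivity : (0 : ℝ) ≤ M⁻¹)]
    simp only [conj_trivial]
    field_simp
    ring
  have hdist : wdist (ζ σ) (lawOf X') ^ 2 = ‖(Y + (σ : ℝ) • j Z) + M⁻¹ • j P‖ ^ 2 := by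
    rw [← hu, norm_sub_rev, ← norm_sub_of_jointLaw_mem_optPlans (hX' ▸ hπ)]
  -- The coupling that is optimal at σ remains a competitor at every other s, with equality at s =
  -- σ. This permits differentiation in s without tracking optimal plans.
  have hdist' : ∀ s : ℝ, wdist (ζ s) (lawOf X') ^ 2 ≤ ‖(Y + s • j Z) + M⁻¹ • j P‖ ^ 2 := by
    intro s
    have h1 := wdist_lawOf_le (j (X - s • Z - M⁻¹ • P)) X'
    rw [lawOf_pull, norm_sub_rev, hu] at h1
    exact pow_le_pow_left₀ (wdist_nonneg _ _) h1 2
  refine ⟨σ, σ.2, t', t'.2, Q', hQ', hj, _, X', rfl, ?_, ?_, ?_, ?_⟩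
  · rw [hX', hlaw]; exact hπ
  · rw [hlaw]
    intro s hs' ν''
    have h1 := hmax (σ, ⟨s, hs'⟩) ν''
    simp only [Φ, dist_eq_wdist] at h1
    have h2 : η * wdist ν ν'' ≤ η * (wdist ν (lawOf X') + wdist (lawOf X') ν'') := by
      gcongr; exact wdist_triangle _ _ _
    linarith
  -- The maximal value dominates the value at the unperturbed point, while the old touching
  -- inequality bounds it from above; the terms in ⟨P, Y⟩ cancel.
  · have h1 : wdist (ζ 0) ν ^ 2 ≤ (M⁻¹ * ‖P‖) ^ 2 := by
      refine pow_le_pow_left₀ (wdist_nonneg _ _) ?_ 2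
      refine (wdist_lawOf_le _ _).trans_eq ?_
      rw [show X - (0 : ℝ) • Z - M⁻¹ • P - X = -(M⁻¹ • P) by module, norm_neg, norm_smul,
        Real.norm_of_nonneg (by positivity)]
    have h1' : M / 2 * wdist (ζ 0) ν ^ 2 ≤ ‖P‖ ^ 2 / (2 * M) := by
      calc _ ≤ M / 2 * (M⁻¹ * ‖P‖) ^ 2 := by gcongr
        _ = _ := by field_simp
    have h2 := hle
    simp only [Φ, a0, wdist_self, hdist] at h2
    have h3 := h t' t'.2 (lawOf X')
    have h4 : wdist (lawOf Xb) (lawOf X') ^ 2 ≤ ‖Y + α⁻¹ • j P‖ ^ 2 := by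
      have h5 := wdist_lawOf_le (j Xb) X'
      rw [lawOf_pull, norm_sub_rev, show X' - j Xb = Y + α⁻¹ • j P by
        rw [hP, map_smul, smul_smul, inv_mul_cancel₀ hα.ne', one_smul, map_sub, hY]; abel] at h5
      exact pow_le_pow_left₀ (wdist_nonneg _ _) h5 2
    have h5 : wdist (lawOf Xb) (lawOf X) ^ 2 = ‖α⁻¹ • P‖ ^ 2 := by
      rw [hP, smul_smul, inv_mul_cancel₀ hα.ne', one_smul, norm_sub_rev,
        norm_sub_of_jointLaw_mem_optPlans hopt]
    have h6 : α / 2 * ‖Y + α⁻¹ • j P‖ ^ 2 = α / 2 * ‖Y‖ ^ 2 + inner ℝ (j P) Y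
        + α / 2 * ‖α⁻¹ • P‖ ^ 2 := by
      rw [norm_add_sq_real, inner_smul_right, real_inner_comm (j P) Y,
        show ‖α⁻¹ • j P‖ = ‖α⁻¹ • P‖ by rw [norm_smul, norm_smul, LinearIsometry.norm_map]]
      field_simp
    have h7 : α / 2 * wdist (lawOf Xb) (lawOf X') ^ 2 ≤ α / 2 * ‖Y + α⁻¹ • j P‖ ^ 2 := by gcongr
    have h8 := hexp σ
    have h9 : X' - j (X - (σ : ℝ) • Z) = Y + (σ : ℝ) • j Z := by
      simp only [hY, map_sub, map_smul]; abel
    rw [h9]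
    rw [h5] at h3
    simp only [sub_self] at h2
    linarith
  · intro hσ
    have h9 : X' - j (X - (σ : ℝ) • Z) = Y + (σ : ℝ) • j Z := by
      simp only [hY, map_sub, map_smul]; abel
    rw [h9]
    -- Right difference quotient in σ, available exactly because σ < hs.
    have key : ∀ δ : ℝ, 0 < δ → δ ≤ hs - σ →
        β ≤ inner ℝ (M • (Y + (σ : ℝ) • j Z)) (j Z) + δ * (M / 2 * ‖j Z‖ ^ 2) := by
      intro δ hδ hδ'
      have h1 := hmax (⟨σ + δ, add_nonneg σ.2.1 hδ.le, by linarith⟩, t') (lawOf X')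
      simp only [Φ, dist_self, mul_zero, add_zero, hdist] at h1
      have h2 := hdist' (σ + δ)
      have h3 : M / 2 * wdist (ζ (σ + δ)) (lawOf X') ^ 2 ≤ M / 2 *
        ‖(Y + ((σ : ℝ) + δ) • j Z) + M⁻¹ • j P‖ ^ 2 := by gcongr
      have h4 := hexp (σ + δ)
      have h5 := hexp σ
      have h6 : ‖Y + ((σ : ℝ) + δ) • j Z‖ ^ 2 = ‖Y + (σ : ℝ) • j Z‖ ^ 2
          + 2 * (δ * inner ℝ (Y + (σ : ℝ) • j Z) (j Z)) + δ ^ 2 * ‖j Z‖ ^ 2 := by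
        rw [add_smul, ← add_assoc, norm_add_sq_real, inner_smul_right, norm_smul, mul_pow,
          Real.norm_eq_abs, sq_abs]
      rw [h6] at h4
      rw [inner_smul_left]
      simp only [conj_trivial]
      have h7 : δ * β ≤ δ * (M * inner ℝ (Y + (σ : ℝ) • j Z) (j Z) + δ * (M / 2 * ‖j Z‖ ^ 2)) := by
        linarith
      exact le_of_mul_le_mul_left h7 hδ
    have hlim : Tendsto (fun δ : ℝ => inner ℝ (M • (Y + (σ : ℝ) • j Z)) (j Z)
        + δ * (M / 2 * ‖j Z‖ ^ 2)) (𝓝[>] 0)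
        (𝓝 (inner ℝ (M • (Y + (σ : ℝ) • j Z)) (j Z) + 0 * (M / 2 * ‖j Z‖ ^ 2))) :=
      ((tendsto_id.mul_const _).const_add _).mono_left nhdsWithin_le_nhds
    rw [zero_mul, add_zero] at hlim
    refine ge_of_tendsto hlim ?_
    filter_upwards [Ioc_mem_nhdsGT (sub_pos.2 hσ)] with δ hδ
    exact key δ hδ.1 hδ.2

end Touch

/-! ### The penalty, its ascent direction and monotonicity -/

section Penalty

variable {N n : ℕ} {I : Type*} [Finite I] [Nonempty I] {F : Fin n → I → Space N → Space N}
  {C L ε θ : ℝ} {Ω : Type*} [MeasurableSpace Ω] {Q : Measure Ω} [IsProbabilityMeasure Q]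

/-- The violation of the `k`-th differential inequality with time slope `τ` and slope `P` at `X`. -/
def violation (F : Fin n → I → Space N → Space N) (θ τ : ℝ) (X P : RandVec N Q) (k : Fin n) : ℝ :=
  max (τ + meanMin (F k) X P + θ) 0

/-- The size of the slope, penalised by the violations. -/
def penalty (F : Fin n → I → Space N → Space N) (ε θ τ : ℝ) (X P : RandVec N Q) : ℝ :=
  ε * ‖P‖ ^ 2 - ∑ k, violation F θ τ X P k ^ 2

/-- A direction in which the penalty increases. -/
def ascent (F : Fin n → I → Space N → Space N) (ε θ τ : ℝ) (X P : RandVec N Q)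
    (D : Fin n → RandVec N Q) : RandVec N Q :=
  (2 * ε) • P - ∑ k, (2 * violation F θ τ X P k) • D k

theorem violation_nonneg (τ : ℝ) (X P : RandVec N Q) (k : Fin n) : 0 ≤ violation F θ τ X P k :=
  le_max_right _ _

theorem violation_pull {Ω' : Type*} [MeasurableSpace Ω'] {Q' : Measure Ω'} [IsProbabilityMeasure Q']
    {j : Ω' → Ω} (hj : MeasurePreserving j Q' Q) (hF : ∀ k, IsLipFamily (F k) C L) (τ : ℝ)
    (X P : RandVec N Q) (k : Fin n) :
    violation F θ τ (RandVec.pull hj X) (RandVec.pull hj P) k = violation F θ τ X P k := by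
  rw [violation, violation, meanMin_pull (hF k)]

theorem penalty_pull {Ω' : Type*} [MeasurableSpace Ω'] {Q' : Measure Ω'} [IsProbabilityMeasure Q']
    {j : Ω' → Ω} (hj : MeasurePreserving j Q' Q) (hF : ∀ k, IsLipFamily (F k) C L) (τ : ℝ)
    (X P : RandVec N Q) :
    penalty F ε θ τ (RandVec.pull hj X) (RandVec.pull hj P) = penalty F ε θ τ X P := by
  simp only [penalty, violation_pull hj hF, LinearIsometry.norm_map]

theorem ascent_pull {Ω' : Type*} [MeasurableSpace Ω'] {Q' : Measure Ω'} [IsProbabilityMeasure Q']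
    {j : Ω' → Ω} (hj : MeasurePreserving j Q' Q) (hF : ∀ k, IsLipFamily (F k) C L) (τ : ℝ)
    (X P : RandVec N Q) (D : Fin n → RandVec N Q) :
    ascent F ε θ τ (RandVec.pull hj X) (RandVec.pull hj P) (fun k => RandVec.pull hj (D k))
      = RandVec.pull hj (ascent F ε θ τ X P D) := by
  simp only [ascent, violation_pull hj hF, map_sub, map_smul, map_sum]

theorem violation_sq_le (hε : 0 ≤ ε) {τ : ℝ} {X P : RandVec N Q} {B b : ℝ} (hP : ‖P‖ ≤ B)
    (h : -b ≤ penalty F ε θ τ X P) (k : Fin n) : violation F θ τ X P k ^ 2 ≤ ε * B ^ 2 + b := by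
  have h1 : violation F θ τ X P k ^ 2 ≤ ∑ k, violation F θ τ X P k ^ 2 :=
    Finset.single_le_sum (f := fun k => violation F θ τ X P k ^ 2) (fun _ _ => sq_nonneg _)
      (Finset.mem_univ k)
  have h2 : ε * ‖P‖ ^ 2 ≤ ε * B ^ 2 := by gcongr
  rw [penalty] at h
  linarith

theorem penalty_le (hε : 0 ≤ ε) {τ : ℝ} {X P : RandVec N Q} {B : ℝ} (hP : ‖P‖ ≤ B) :
    penalty F ε θ τ X P ≤ ε * B ^ 2 := by
  have h2 : ε * ‖P‖ ^ 2 ≤ ε * B ^ 2 := by gcongr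
  have h1 : 0 ≤ ∑ k, violation F θ τ X P k ^ 2 := Finset.sum_nonneg fun _ _ => sq_nonneg _
  rw [penalty]
  linarith

/-- First order expansion of the penalty along the ascent direction. -/
theorem penalty_ascent (hF : ∀ k, IsLipFamily (F k) C L) (hε : 0 ≤ ε) {X P X' P' : RandVec N Q}
    {D : Fin n → RandVec N Q} (hD : ∀ k, IsSelection (F k) X (D k))
    (hDP : ∀ k, meanMin (F k) X P = inner ℝ (D k) P) {B τ τ' o : ℝ} (hP' : ‖P'‖ ≤ B)
    (ho : τ' - τ + L * B * ‖X' - X‖ ≤ o) (ho0 : 0 ≤ o) (hv : ∀ k, violation F θ τ X P k ≤ 1) :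
    penalty F ε θ τ X P + inner ℝ (P' - P) (ascent F ε θ τ X P D)
        - n * (2 * o + 2 * o ^ 2 + 2 * C ^ 2 * ‖P' - P‖ ^ 2) ≤ penalty F ε θ τ' X' P' := by
  have h1 : ∀ k, violation F θ τ' X' P' k ^ 2 ≤ violation F θ τ X P k ^ 2
      + 2 * violation F θ τ X P k * inner ℝ (D k) (P' - P)
      + (2 * o + 2 * o ^ 2 + 2 * C ^ 2 * ‖P' - P‖ ^ 2) := by
    intro k
    have hL := (hF k).nonneg
    have e1 := meanMin_le_add (hF k) X P' X' P'
    have e2 := (hD k).meanMin_le_inner (hF k) P'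
    have e3 : (inner ℝ (D k) P' : ℝ) = inner ℝ (D k) P + inner ℝ (D k) (P' - P) := by
      rw [inner_sub_right]; ring
    have e4 : L * (‖X' - X‖ * ‖P'‖) ≤ L * B * ‖X' - X‖ := by
      calc _ ≤ L * (‖X' - X‖ * B) := by gcongr
        _ = _ := by ring
    simp only [sub_self, norm_zero, mul_zero, add_zero] at e1
    have e5 := hDP k
    set x := violation F θ τ X P k with hx
    set d : ℝ := inner ℝ (D k) (P' - P) with hd
    have hx0 : 0 ≤ x := violation_nonneg _ _ _ _
    -- The selection D k supports the concave functional from above, exactly at P, so the increase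
    -- of the violation is at most linear in P' - P, plus o.
    have e6 : violation F θ τ' X' P' k ≤ |x + (d + o)| := by
      refine max_le ?_ (abs_nonneg _)
      refine le_trans ?_ (le_abs_self _)
      have : τ + meanMin (F k) X P + θ ≤ x := le_max_left _ _
      linarith
    have e7 : violation F θ τ' X' P' k ^ 2 ≤ (x + (d + o)) ^ 2 := by
      rw [← sq_abs (x + (d + o))]
      exact pow_le_pow_left₀ (violation_nonneg _ _ _ _) e6 2
    have e8 : d ^ 2 ≤ C ^ 2 * ‖P' - P‖ ^ 2 := by
      rw [← mul_pow, ← sq_abs d]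
      refine pow_le_pow_left₀ (abs_nonneg _) ?_ 2
      refine (abs_real_inner_le_norm _ _).trans ?_
      gcongr
      exact (hD k).norm_le (hF k)
    have e9 : x * o ≤ 1 * o := by gcongr; exact hv k
    nlinarith [sq_nonneg (d - o)]
  have h2 := Finset.sum_le_sum fun k (_ : k ∈ Finset.univ) => h1 k
  rw [Finset.sum_add_distrib, Finset.sum_add_distrib, Finset.sum_const, Finset.card_univ,
    Fintype.card_fin, nsmul_eq_mul] at h2
  have h3 : (inner ℝ (P' - P) (ascent F ε θ τ X P D) : ℝ) = 2 * ε * inner ℝ P (P' - P)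
      - ∑ k, 2 * violation F θ τ X P k * inner ℝ (D k) (P' - P) := by
    rw [ascent, inner_sub_right, inner_smul_right, inner_sum, real_inner_comm P]
    congr 1
    refine Finset.sum_congr rfl fun k _ => ?_
    rw [inner_smul_right, real_inner_comm]
  have h4 : ‖P'‖ ^ 2 = ‖P‖ ^ 2 + 2 * inner ℝ P (P' - P) + ‖P' - P‖ ^ 2 := by
    rw [← norm_add_sq_real, add_sub_cancel]
  have h5 : 0 ≤ ε * ‖P' - P‖ ^ 2 := by positivity
  rw [penalty, penalty, h3, h4]
  linarith

/-- Selections of minimisers are almost antitone. -/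
theorem IsSelection.inner_sub_le {F : I → Space N → Space N} (hF : IsLipFamily F C L)
    {X₁ X₂ P₁ P₂ D₁ D₂ : RandVec N Q} (h₁ : IsSelection F X₁ D₁) (h₂ : IsSelection F X₂ D₂)
    (e₁ : meanMin F X₁ P₁ = inner ℝ D₁ P₁) (e₂ : meanMin F X₂ P₂ = inner ℝ D₂ P₂) {B : ℝ}
    (b₁ : ‖P₁‖ ≤ B) (b₂ : ‖P₂‖ ≤ B) :
    inner ℝ (D₁ - D₂) (P₁ - P₂) ≤ 2 * (L * B * ‖X₁ - X₂‖) := by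
  have hL := hF.nonneg
  have h3 := h₂.meanMin_le_inner hF P₁
  have h4 := h₁.meanMin_le_inner hF P₂
  have h5 := meanMin_le_add hF X₂ P₁ X₁ P₁
  have h6 := meanMin_le_add hF X₁ P₂ X₂ P₂
  simp only [sub_self, norm_zero, mul_zero, add_zero] at h5 h6
  rw [norm_sub_rev X₂] at h6
  have h7 : L * (‖X₁ - X₂‖ * ‖P₁‖) ≤ L * B * ‖X₁ - X₂‖ := by
    calc _ ≤ L * (‖X₁ - X₂‖ * B) := by gcongr
      _ = _ := by ring
  have h8 : L * (‖X₁ - X₂‖ * ‖P₂‖) ≤ L * B * ‖X₁ - X₂‖ := by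
    calc _ ≤ L * (‖X₁ - X₂‖ * B) := by gcongr
      _ = _ := by ring
  simp only [inner_sub_left, inner_sub_right]
  linarith

/-- The ascent direction is an almost strongly monotone function of the slope. -/
theorem inner_ascent_sub_ge (hF : ∀ k, IsLipFamily (F k) C L)
    {X₁ X₂ P₁ P₂ : RandVec N Q} {D₁ D₂ : Fin n → RandVec N Q}
    (h₁ : ∀ k, IsSelection (F k) X₁ (D₁ k)) (h₂ : ∀ k, IsSelection (F k) X₂ (D₂ k))
    (e₁ : ∀ k, meanMin (F k) X₁ P₁ = inner ℝ (D₁ k) P₁)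
    (e₂ : ∀ k, meanMin (F k) X₂ P₂ = inner ℝ (D₂ k) P₂) {B τ : ℝ}
    (b₁ : ‖P₁‖ ≤ B) (b₂ : ‖P₂‖ ≤ B) (hL : 0 ≤ L) (hv : ∀ k, violation F θ τ X₁ P₁ k ≤ 1)
    (hveq : ∀ k, violation F θ τ X₁ P₁ k = violation F θ τ X₂ P₂ k) :
    2 * ε * ‖P₁ - P₂‖ ^ 2 - 4 * n * (L * B * ‖X₁ - X₂‖) ≤
      inner ℝ (ascent F ε θ τ X₁ P₁ D₁ - ascent F ε θ τ X₂ P₂ D₂) (P₁ - P₂) := by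
  have hB : 0 ≤ B := (norm_nonneg _).trans b₁
  have h1 : ascent F ε θ τ X₁ P₁ D₁ - ascent F ε θ τ X₂ P₂ D₂
      = (2 * ε) • (P₁ - P₂) - ∑ k, (2 * violation F θ τ X₁ P₁ k) • (D₁ k - D₂ k) := by
    simp only [ascent, ← hveq, smul_sub, Finset.sum_sub_distrib]
    abel
  -- Both points carry the same nonnegative weights by `hveq`, so almost antitone selections D give
  -- an almost monotone contribution -2 v D.
  have h2 : ∑ k, 2 * violation F θ τ X₁ P₁ k * inner ℝ (D₁ k - D₂ k) (P₁ - P₂)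
      ≤ ∑ _k : Fin n, 4 * (L * B * ‖X₁ - X₂‖) := by
    refine Finset.sum_le_sum fun k _ => ?_
    have h3 := (h₁ k).inner_sub_le (hF k) (h₂ k) (e₁ k) (e₂ k) b₁ b₂
    have h4 := violation_nonneg (F := F) (θ := θ) τ X₁ P₁ k
    have h5 : 0 ≤ L * B * ‖X₁ - X₂‖ := by positivity
    have h6 := hv k
    calc 2 * violation F θ τ X₁ P₁ k * inner ℝ (D₁ k - D₂ k) (P₁ - P₂)
        ≤ 2 * violation F θ τ X₁ P₁ k * (2 * (L * B * ‖X₁ - X₂‖)) := by gcongr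
      _ ≤ 2 * 1 * (2 * (L * B * ‖X₁ - X₂‖)) := by gcongr
      _ = _ := by ring
  rw [Finset.sum_const, Finset.card_univ, Fintype.card_fin, nsmul_eq_mul] at h2
  rw [h1, inner_sub_left, inner_smul_left, real_inner_self_eq_norm_sq, sum_inner]
  simp only [inner_smul_left, conj_trivial]
  linarith

/-- Optimal couplings are monotone with respect to copies. -/
theorem inner_sub_le_of_optimal {α : ℝ} (hα : 0 ≤ α) {A₁ A₂ X₁ X₂ : RandVec N Q}
    (hX : lawOf X₁ = lawOf X₂)
    (h₁ : ‖A₁ - X₁‖ = wdist (lawOf A₁) (lawOf X₁)) (h₂ : ‖A₂ - X₂‖ = wdist (lawOf A₂) (lawOf X₂)) :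
    inner ℝ (X₁ - X₂) (α • (X₁ - A₁) - α • (X₂ - A₂)) ≤ α * ‖X₁ - X₂‖ ^ 2 := by
  -- Equality of the laws of X₁ and X₂ makes exchanging them an admissible competitor in both
  -- transport problems; adding the inequalities gives monotonicity.
  have h3 : ‖A₁ - X₁‖ ^ 2 ≤ ‖A₁ - X₂‖ ^ 2 :=
    pow_le_pow_left₀ (norm_nonneg _) (h₁.trans_le (by rw [hX]; exact wdist_lawOf_le _ _)) 2
  have h4 : ‖A₂ - X₂‖ ^ 2 ≤ ‖A₂ - X₁‖ ^ 2 :=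
    pow_le_pow_left₀ (norm_nonneg _) (h₂.trans_le (by rw [← hX]; exact wdist_lawOf_le _ _)) 2
  rw [norm_sub_sq_real, norm_sub_sq_real] at h3 h4
  have h5 : 0 ≤ inner ℝ (X₁ - X₂) (A₁ - A₂) := by
    simp only [inner_sub_left, inner_sub_right]
    rw [real_inner_comm A₁ X₁, real_inner_comm A₂ X₁, real_inner_comm A₁ X₂, real_inner_comm A₂ X₂]
    linarith
  rw [show α • (X₁ - A₁) - α • (X₂ - A₂) = α • (X₁ - X₂) - α • (A₁ - A₂) by module,
    inner_sub_right, inner_smul_right, inner_smul_right, real_inner_self_eq_norm_sq]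
  have := mul_nonneg hα h5
  linarith

end Penalty

/-! ### Touching points with a realised optimal coupling -/

section Touch

variable {N : ℕ} {Ω : Type*} [MeasurableSpace Ω] {Q : Measure Ω} [IsProbabilityMeasure Q]
  {T η₀ K : ℝ} {w : ℝ → WSpace N → ℝ} {t τ k α η : ℝ} {Xb X : RandVec N Q}

/-- A touching point together with an optimal coupling realised by random vectors. -/
structure IsTouch (T η₀ : ℝ) (w : ℝ → WSpace N → ℝ) (t τ k α η : ℝ) (Xb X : RandVec N Q) :
    Prop where
  mem : t ∈ Set.Ico (0 : ℝ) T
  pos : 0 < α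
  eta_pos : 0 < η
  eta_lt : η < η₀
  opt : jointLaw Xb X ∈ optPlans (lawOf Xb) (lawOf X)
  touch : TouchAt T w t τ k α η (lawOf Xb) (lawOf X)

theorem IsTouch.norm_slope_le (h : IsTouch T η₀ w t τ k α η Xb X) (hw : LipStrip T K w)
    (hK : 0 ≤ K) (hη : η₀ ≤ 1) : ‖α • (X - Xb)‖ ≤ K + 1 :=
  (h.touch.slope_le hw ⟨h.mem.1, h.mem.2.le⟩ h.pos h.eta_pos.le hK h.opt).trans
    (by linarith [h.eta_lt])

/-- A touching point can be realised on the product space. -/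
theorem IsTouch.exists_plan {n : ℕ} {I : Type*} [Finite I] [Nonempty I]
    {F : Fin n → I → Space N → Space N} {C L ε θ : ℝ} (hF : ∀ k, IsLipFamily (F k) C L)
    (h : IsTouch T η₀ w t τ k α η Xb X) :
    ∃ (π : Measure (Space N × Space N)) (_ : IsProbabilityMeasure π) (Yb Y : RandVec N π),
      IsTouch T η₀ w t τ k α η Yb Y ∧
      penalty F ε θ τ Y (α • (Y - Yb)) = penalty F ε θ τ X (α • (X - Xb)) := by
  have hπ := jointLaw_mem_plans Xb X
  have hprob := isProbabilityMeasure_of_mem_plans hπ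
  have hj : MeasurePreserving (fun a => (Xb a, X a)) Q (jointLaw Xb X) :=
    ⟨measurable_pair Xb X, rfl⟩
  have e1 : RandVec.pull hj (planFst hπ) = Xb := by
    refine Lp.ext ((RandVec.coeFn_pull hj _).trans ?_)
    filter_upwards [hj.quasiMeasurePreserving.ae (coeFn_planFst hπ)] with a ha
    exact ha
  have e2 : RandVec.pull hj (planSnd hπ) = X := by
    refine Lp.ext ((RandVec.coeFn_pull hj _).trans ?_)
    filter_upwards [hj.quasiMeasurePreserving.ae (coeFn_planSnd hπ)] with a ha
    exact ha
  refine ⟨jointLaw Xb X, hprob, planFst hπ, planSnd hπ, ⟨h.mem, h.pos, h.eta_pos, h.eta_lt, ?_, ?_⟩,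
    ?_⟩
  · rw [jointLaw_planFst_planSnd, lawOf_planFst, lawOf_planSnd]
    exact h.opt
  · rw [lawOf_planFst, lawOf_planSnd]
    exact h.touch
  · rw [← penalty_pull hj hF, map_smul, map_sub, e1, e2]

theorem integral_norm_lawOf_le {R : Space N → Space N} {Rv : RandVec N Q}
    (hR : MemLp R 2 (lawOf X).meas) (hRv : Rv =ᵐ[Q] R ∘ X) :
    ∫ x, ‖R x‖ ∂(lawOf X).meas ≤ ‖Rv‖ := by
  refine le_trans (le_of_eq ?_) (integral_norm_le Rv).2
  rw [lawOf_meas] at hR ⊢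
  rw [integral_map (measurable_randVec X).aemeasurable hR.1.norm]
  apply integral_congr_ae
  filter_upwards [hRv] with a ha
  rw [ha]
  rfl

/-- The differential inequality at a touching point, for the conditional expectation of the
slope. -/
theorem IsTouch.neg_le {EU EV : Type*} [NormedAddCommGroup EU] [MeasurableSpace EU]
    [NormedAddCommGroup EV] [MeasurableSpace EV] {U : Set EU} {V : Set EV}
    {f : Space N → U → V → Space N} (hw : IsSubsolution T f w)
    {n : ℕ} {I : Type*} [Finite I] [Nonempty I]
    {F : Fin n → I → Space N → Space N} {C L e : ℝ} (hF : ∀ k, IsLipFamily (F k) C L) (he : 0 ≤ e)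
    (hup : ∀ (ν : WSpace N) (R : Space N → Space N) (c : ℝ), MemLp R 2 ν.meas →
        (∀ k, ∫ x, minInner (fun i => F k i x) (R x) ∂ν.meas + e * ∫ x, ‖R x‖ ∂ν.meas ≤ c) →
        hamiltonian f ν R ≤ c)
    (h : IsTouch T η₀ w t τ k α η Xb X) {R : Space N → Space N} {Rv : RandVec N Q}
    (hR : MemLp R 2 (lawOf X).meas) (hRv : Rv =ᵐ[Q] R ∘ X)
    (hcond : ∀ ξ : Space N → Space N, MemLp ξ 2 (lawOf X).meas →
        ∫ a, inner ℝ (ξ (X a)) ((α • (X - Xb)) a) ∂Q = ∫ y, inner ℝ (ξ y) (R y) ∂(lawOf X).meas)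
    {c : ℝ} (hc : ∀ k, meanMin (F k) X Rv + e * ‖Rv‖ ≤ c) : -(supNorm f * η) ≤ τ + c := by
  have h1 := hw.of_touchAt h.mem h.pos h.eta_pos h.touch h.opt
    (isPlanGradient_jointLaw Xb X α h.pos.ne' hR hcond)
  have h2 : (fun y => -(α • -(α⁻¹ • R y))) = R := by
    funext y
    rw [smul_neg, neg_neg, smul_smul, mul_inv_cancel₀ h.pos.ne', one_smul]
  rw [h2] at h1
  refine h1.trans ?_
  gcongr
  refine hup _ R c hR fun k => le_trans ?_ (hc k)
  rw [integral_minInner_lawOf (hF k) hR hRv]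
  gcongr
  exact integral_norm_lawOf_le hR hRv

/-- The scaling M = κ/hs, β = κρ² makes the displacement error u at most 3ρ·hs, small against the
shift hs·Z, while the change of slope M u stays at most 3κρ whatever hs is. The old quadratic is
absorbed since 4α ≤ M. The Ekeland weight uses up half of the remaining gap to η₀, so pushing never
reaches η₀. -/
theorem IsTouch.exists_push (h : IsTouch T η₀ w t τ k α η Xb X) (hw : LipStrip T K w) (hK : 0 ≤ K)
    (Z : RandVec N Q) {κ ρ hs : ℝ} (hκ : 0 < κ) (hρ : 0 < ρ) (hhs : 0 < hs)
    (h₁ : 4 * α * hs ≤ κ) (h₂ : α * hs * ‖Z‖ ^ 2 ≤ κ * ρ ^ 2)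
    (h₃ : 2 * √(κ * ρ ^ 2 * hs) < T - t) :
    ∃ σ ∈ Set.Icc 0 hs, ∃ (t' η' : ℝ) (Q' : Measure (Ω × Space N)) (_ : IsProbabilityMeasure Q')
      (hj : MeasurePreserving Prod.fst Q' Q) (Xb' X' u : RandVec N Q'),
      IsTouch T η₀ w t' (τ + (k + 1) * (t' - t)) (k + 1) (κ / hs) η' Xb' X' ∧
      |t' - t| ≤ 2 * √(κ * ρ ^ 2 * hs) ∧ u = X' - RandVec.pull hj X + σ • RandVec.pull hj Z ∧
      (κ / hs) • (X' - Xb') = RandVec.pull hj (α • (X - Xb)) + (κ / hs) • u ∧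
      ‖u‖ ≤ 3 * ρ * hs ∧
      (σ < hs → κ * ρ ^ 2 ≤ inner ℝ ((κ / hs) • u) (RandVec.pull hj Z)) := by
  have hM : 0 < κ / hs := by positivity
  obtain ⟨σ, hσ, t', ht', Q', hQ', hj, Xb', X', hXb, hopt, htouch, hest, hin⟩ :=
    h.touch.exists_push hw hK ⟨h.mem.1, h.mem.2.le⟩ h.pos h.eta_pos.le h.opt Z (β := κ * ρ ^ 2) hM hhs.le
      (half_pos (sub_pos.2 h.eta_lt))
  set u := X' - RandVec.pull hj (X - σ • Z) with hu
  have hu' : u = X' - RandVec.pull hj X + σ • RandVec.pull hj Z := by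
    rw [hu, map_sub, map_smul]
    abel
  have hY : ‖X' - RandVec.pull hj X‖ ^ 2 ≤ 2 * ‖u‖ ^ 2 + 2 * (σ ^ 2 * ‖Z‖ ^ 2) := by
    have h1 : X' - RandVec.pull hj X = u - σ • RandVec.pull hj Z := by
      rw [hu']; abel
    have h2 := norm_sub_le u (σ • RandVec.pull hj Z)
    rw [← h1, norm_smul, LinearIsometry.norm_map, Real.norm_of_nonneg hσ.1] at h2
    have h3 := pow_le_pow_left₀ (norm_nonneg _) h2 2
    nlinarith [sq_nonneg (‖u‖ - σ * ‖Z‖)]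
  have hα := h.pos
  have e1 : 4 * α ≤ κ / hs := (le_div_iff₀ hhs).2 h₁
  have e2 : α * ‖u‖ ^ 2 ≤ κ / hs / 4 * ‖u‖ ^ 2 := by gcongr; linarith
  have e3 : α * (σ ^ 2 * ‖Z‖ ^ 2) ≤ κ * ρ ^ 2 * hs := by
    calc α * (σ ^ 2 * ‖Z‖ ^ 2) ≤ α * (hs ^ 2 * ‖Z‖ ^ 2) := by
          have := hσ.1
          have := hσ.2
          gcongr
      _ = (α * hs * ‖Z‖ ^ 2) * hs := by ring
      _ ≤ _ := by gcongr
  have e4 : κ * ρ ^ 2 * σ ≤ κ * ρ ^ 2 * hs := by gcongr; exact hσ.2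
  have e5 : α / 2 * ‖X' - RandVec.pull hj X‖ ^ 2
      ≤ α / 2 * (2 * ‖u‖ ^ 2 + 2 * (σ ^ 2 * ‖Z‖ ^ 2)) := by gcongr
  have e6 : κ / hs / 4 * ‖u‖ ^ 2 + 1 / 2 * (t' - t) ^ 2 ≤ 2 * (κ * ρ ^ 2 * hs) := by linarith
  have e7 : ‖u‖ ^ 2 ≤ (3 * ρ * hs) ^ 2 := by
    have e8 : κ / hs / 4 * ‖u‖ ^ 2 ≤ κ / hs / 4 * (8 * (ρ * hs) ^ 2) := by
      have : κ / hs / 4 * (8 * (ρ * hs) ^ 2) = 2 * (κ * ρ ^ 2 * hs) := by field_simp; ring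
      nlinarith [sq_nonneg (t' - t)]
    have e9 := le_of_mul_le_mul_left e8 (by positivity)
    nlinarith [sq_nonneg (ρ * hs)]
  have e8 : |t' - t| ≤ 2 * √(κ * ρ ^ 2 * hs) := by
    refine abs_le_of_sq_le_sq ?_ (by positivity)
    rw [mul_pow, Real.sq_sqrt (by positivity)]
    have : 0 ≤ κ / hs / 4 * ‖u‖ ^ 2 := by positivity
    linarith
  refine ⟨σ, hσ, t', η + (η₀ - η) / 2, Q', hQ', hj, Xb', X', u,
    ⟨⟨ht'.1, ?_⟩, hM, ?_, ?_, hopt, htouch⟩, e8, hu', ?_, ?_, ?_⟩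
  · have := (abs_le.1 e8).2
    linarith
  · linarith [h.eta_pos, h.eta_lt]
  · linarith [h.eta_lt]
  · have : X' - Xb' = u + (κ / hs)⁻¹ • RandVec.pull hj (α • (X - Xb)) := by
      rw [hXb, hu']
      simp only [map_sub, map_smul]
      abel
    rw [this, smul_add, smul_smul, mul_inv_cancel₀ hM.ne', one_smul, add_comm]
  · exact (abs_le_of_sq_le_sq e7 (by positivity)).trans' (le_abs_self _)
  · intro hσ'
    exact hin hσ'

end Touch

/-! ### Raising the penalty of a touching point -/

section Improve

variable {N n : ℕ} {I : Type*} [Finite I] [Nonempty I] {F : Fin n → I → Space N → Space N}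
  {Ω : Type*} [MeasurableSpace Ω] {Q : Measure Ω} [IsProbabilityMeasure Q]

/-- Copies with a common image under the push have almost equal slopes. -/
theorem norm_sub_copies_sq_le {C L ε θ B ρ α τ h : ℝ} (hF : ∀ k, IsLipFamily (F k) C L)
    (hL : 0 ≤ L) (hα : 0 ≤ α) (hh : 0 < h) {Xb X X' u : RandVec N Q}
    (hopt : ‖Xb - X‖ = wdist (lawOf Xb) (lawOf X)) (hP : ‖α • (X - Xb)‖ ≤ B)
    {D : Fin n → RandVec N Q} (hD : ∀ k, IsSelection (F k) X (D k))
    (hDP : ∀ k, meanMin (F k) X (α • (X - Xb)) = inner ℝ (D k) (α • (X - Xb)))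
    (hv : ∀ k, violation F θ τ X (α • (X - Xb)) k ≤ 1)
    (hX' : u = X' - X + h • ascent F ε θ τ X (α • (X - Xb)) D) (hu : ‖u‖ ≤ 3 * ρ * h)
    (hsmall : α * h * (2 * ‖ascent F ε θ τ X (α • (X - Xb)) D‖ + 6 * ρ) ^ 2
      + 4 * n * L * B * h * (2 * ‖ascent F ε θ τ X (α • (X - Xb)) D‖ + 6 * ρ) ≤ ρ * B)
    {Ω₂ : Type*} [MeasurableSpace Ω₂] {Q₂ : Measure Ω₂} [IsProbabilityMeasure Q₂] {j₁ j₂ : Ω₂ → Ω}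
    (h₁ : MeasurePreserving j₁ Q₂ Q) (h₂ : MeasurePreserving j₂ Q₂ Q)
    (heq : RandVec.pull h₁ X' = RandVec.pull h₂ X') :
    2 * ε * ‖RandVec.pull h₁ (α • (X - Xb)) - RandVec.pull h₂ (α • (X - Xb))‖ ^ 2
      ≤ 13 * ρ * B := by
  set P := α • (X - Xb) with hPdef
  set Z := ascent F ε θ τ X P D with hZ
  have hB : 0 ≤ B := (norm_nonneg _).trans hP
  set d := RandVec.pull h₁ P - RandVec.pull h₂ P with hd
  set x := RandVec.pull h₁ X - RandVec.pull h₂ X with hx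
  set z := RandVec.pull h₁ Z - RandVec.pull h₂ Z with hz
  set v := RandVec.pull h₁ u - RandVec.pull h₂ u with hv'
  have hxz : x = h • z - v := by
    have e1 : RandVec.pull h₁ u = RandVec.pull h₁ X' - RandVec.pull h₁ X + h • RandVec.pull h₁ Z := by
      rw [hX', map_add, map_sub, map_smul]
    have e2 : RandVec.pull h₂ u = RandVec.pull h₂ X' - RandVec.pull h₂ X + h • RandVec.pull h₂ Z := by
      rw [hX', map_add, map_sub, map_smul]
    rw [hv', e1, e2, heq, hx, hz, smul_sub]
    abel
  have hdB : ‖d‖ ≤ 2 * B := by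
    refine (norm_sub_le _ _).trans ?_
    rw [LinearIsometry.norm_map, LinearIsometry.norm_map]
    linarith
  have hvB : ‖v‖ ≤ 6 * ρ * h := by
    refine (norm_sub_le _ _).trans ?_
    rw [LinearIsometry.norm_map, LinearIsometry.norm_map]
    linarith
  have hzB : ‖z‖ ≤ 2 * ‖Z‖ := by
    refine (norm_sub_le _ _).trans ?_
    rw [LinearIsometry.norm_map, LinearIsometry.norm_map]
    linarith
  set E := 2 * ‖Z‖ + 6 * ρ with hE
  have hxB : ‖x‖ ≤ h * E := by
    rw [hxz]
    refine (norm_sub_le _ _).trans ?_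
    rw [norm_smul, Real.norm_of_nonneg hh.le]
    nlinarith
  have e1 : inner ℝ x d ≤ α * ‖x‖ ^ 2 := by
    have := inner_sub_le_of_optimal hα (A₁ := RandVec.pull h₁ Xb) (A₂ := RandVec.pull h₂ Xb)
      (X₁ := RandVec.pull h₁ X) (X₂ := RandVec.pull h₂ X) (by simp only [lawOf_pull])
      (by rw [← map_sub, LinearIsometry.norm_map, lawOf_pull, lawOf_pull, hopt])
      (by rw [← map_sub, LinearIsometry.norm_map, lawOf_pull, lawOf_pull, hopt])
    simpa only [hd, hPdef, map_smul, map_sub] using this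
  have e2 : 2 * ε * ‖d‖ ^ 2 - 4 * n * (L * B * ‖x‖) ≤ inner ℝ z d := by
    have := inner_ascent_sub_ge (ε := ε) (θ := θ) (τ := τ) (B := B) hF
      (X₁ := RandVec.pull h₁ X) (X₂ := RandVec.pull h₂ X)
      (P₁ := RandVec.pull h₁ P) (P₂ := RandVec.pull h₂ P)
      (D₁ := fun k => RandVec.pull h₁ (D k)) (D₂ := fun k => RandVec.pull h₂ (D k))
      (fun k => (hD k).pull h₁) (fun k => (hD k).pull h₂)
      (fun k => by rw [meanMin_pull (hF k), LinearIsometry.inner_map_map, hDP])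
      (fun k => by rw [meanMin_pull (hF k), LinearIsometry.inner_map_map, hDP])
      (by rwa [LinearIsometry.norm_map]) (by rwa [LinearIsometry.norm_map]) hL
      (fun k => by rw [violation_pull h₁ hF]; exact hv k)
      (fun k => by rw [violation_pull h₁ hF, violation_pull h₂ hF])
    rw [ascent_pull h₁ hF, ascent_pull h₂ hF] at this
    exact this
  have e3 : (inner ℝ x d : ℝ) = h * inner ℝ z d - inner ℝ v d := by
    rw [hxz, inner_sub_left, inner_smul_left]
    simp
  have hρh : 0 ≤ 6 * ρ * h := (norm_nonneg _).trans hvB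
  have e4 : inner ℝ v d ≤ h * (12 * ρ * B) := by
    refine (real_inner_le_norm _ _).trans ?_
    calc ‖v‖ * ‖d‖ ≤ 6 * ρ * h * (2 * B) := by gcongr
      _ = _ := by ring
  have e5 : α * ‖x‖ ^ 2 ≤ h * (α * h * E ^ 2) := by
    calc α * ‖x‖ ^ 2 ≤ α * (h * E) ^ 2 := by gcongr
      _ = _ := by ring
  have e6 : 4 * n * (L * B * ‖x‖) ≤ 4 * n * L * B * h * E := by
    calc 4 * n * (L * B * ‖x‖) ≤ 4 * n * (L * B * (h * E)) := by gcongr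
      _ = _ := by ring
  -- Strong monotonicity of the ascent direction against monotonicity of the optimal coupling. After
  -- division by h the terms still containing h are at most ρB by `hsmall`, whence 13ρB.
  have e7 : h * (2 * ε * ‖d‖ ^ 2 - 4 * n * L * B * h * E) ≤ h * (α * h * E ^ 2 + 12 * ρ * B) := by
    have : h * (2 * ε * ‖d‖ ^ 2 - 4 * n * L * B * h * E) ≤ h * inner ℝ z d := by
      gcongr
      linarith
    linarith
  have e8 := le_of_mul_le_mul_left e7 hh
  linarith

/-- The constants of the improvement step. -/
structure StepConsts (n : ℕ) (C L K e θ η₀ δ ε ρ κ : ℝ) : Prop where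
  L_nonneg : 0 ≤ L
  K_nonneg : 0 ≤ K
  e_nonneg : 0 ≤ e
  eta_le : η₀ ≤ 1
  delta_pos : 0 < δ
  delta_le : δ ≤ 1
  eps_pos : 0 < ε
  rho_pos : 0 < ρ
  kappa_pos : 0 < κ
  kappa_le : κ ≤ 1
  theta_gt : C * η₀ + e * (K + 1) + δ * (2 + 3 * C) < θ
  eps_le : ε * (K + 1) ^ 2 ≤ δ ^ 2 / 2
  rho_le : 7 * ρ * (K + 1) ≤ ε * δ ^ 2
  rho_le' : 6 * ρ ≤ δ
  kappa_small : 144 * n * C ^ 2 * κ ≤ 1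

/-- Every quantity to be made small is continuous in h and vanishes at h = 0. The step may depend on
α, k and ‖Z‖, whereas the gain κρ²/2 does not. -/
theorem StepConsts.exists_step {n : ℕ} {C L K e θ η₀ δ ε ρ κ : ℝ}
    (hc : StepConsts n C L K e θ η₀ δ ε ρ κ) {α k : ℝ} (Zn : ℝ) {r : ℝ} (hr : 0 < r) :
    ∃ h > 0, ∃ o ≤ δ, 4 * α * h ≤ κ ∧ α * h * Zn ^ 2 ≤ κ * ρ ^ 2 ∧
      2 * √(κ * ρ ^ 2 * h) < r ∧
      |k + 1| * (2 * √(κ * ρ ^ 2 * h)) + L * (K + 1) * (h * (3 * ρ + Zn)) = o ∧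
      n * (2 * o + 2 * o ^ 2) ≤ κ * ρ ^ 2 / 8 ∧
      α * h * (2 * Zn + 6 * ρ) ^ 2 + 4 * n * L * (K + 1) * h * (2 * Zn + 6 * ρ) ≤ ρ * (K + 1) := by
  have hκ := hc.kappa_pos
  have hρ := hc.rho_pos
  have hK := hc.K_nonneg
  have ev : ∀ g : ℝ → ℝ, Continuous g → g 0 = 0 → ∀ c > 0, ∀ᶠ h in 𝓝[>] (0 : ℝ), g h < c := by
    intro g hg h0 c hc
    exact (hg.continuousAt.eventually_lt continuousAt_const (by rw [h0]; exact hc)).filter_mono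
      nhdsWithin_le_nhds
  let o : ℝ → ℝ := fun h =>
    |k + 1| * (2 * √(κ * ρ ^ 2 * h)) + L * (K + 1) * (h * (3 * ρ + Zn))
  have ho : Continuous o := by simp only [o]; fun_prop
  have ho0 : o 0 = 0 := by simp [o]
  have h1 := ev (fun h => 4 * α * h) (by fun_prop) (by simp) κ hκ
  have h2 := ev (fun h => α * h * Zn ^ 2) (by fun_prop) (by simp) (κ * ρ ^ 2) (by positivity)
  have h3 := ev (fun h => 2 * √(κ * ρ ^ 2 * h)) (by fun_prop) (by simp) r hr
  have h4 := ev o ho ho0 δ hc.delta_pos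
  have h5 := ev (fun h => n * (2 * o h + 2 * o h ^ 2)) (by fun_prop) (by simp [ho0])
    (κ * ρ ^ 2 / 8) (by positivity)
  have h6 := ev (fun h => α * h * (2 * Zn + 6 * ρ) ^ 2
    + 4 * n * L * (K + 1) * h * (2 * Zn + 6 * ρ)) (by fun_prop) (by simp) (ρ * (K + 1))
    (by positivity)
  have h0 : ∀ᶠ h in 𝓝[>] (0 : ℝ), 0 < h := self_mem_nhdsWithin
  obtain ⟨h, g0, g1, g2, g3, g4, g5, g6⟩ := (h0.and (h1.and (h2.and (h3.and
    (h4.and (h5.and h6)))))).exists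
  exact ⟨h, g0, o h, g4.le, g1.le, g2.le, g3, rfl, g5.le, g6.le⟩

variable {EU EV : Type*} [NormedAddCommGroup EU] [MeasurableSpace EU]
    [NormedAddCommGroup EV] [MeasurableSpace EV] {U : Set EU} {V : Set EV}
    {f : Space N → U → V → Space N} {T K L e θ η₀ δ ε ρ κ : ℝ} {w : ℝ → WSpace N → ℝ}

/-- Touching points can be improved. -/
theorem IsTouch.exists_penalty_gt [StandardBorelSpace Ω] (hw : IsSubsolution T f w)
    (hwK : LipStrip T K w) (hF : ∀ k, IsLipFamily (F k) (supNorm f) L) (hC : 0 ≤ supNorm f)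
    (hup : ∀ (ν : WSpace N) (R : Space N → Space N) (c : ℝ), MemLp R 2 ν.meas →
        (∀ k, ∫ x, minInner (fun i => F k i x) (R x) ∂ν.meas + e * ∫ x, ‖R x‖ ∂ν.meas ≤ c) →
        hamiltonian f ν R ≤ c)
    (hc : StepConsts n (supNorm f) L K e θ η₀ δ ε ρ κ) {t τ k α η : ℝ} {Xb X : RandVec N Q}
    (h : IsTouch T η₀ w t τ k α η Xb X)
    (hJ : -(κ * ρ ^ 2 / 2) ≤ penalty F ε θ τ X (α • (X - Xb))) :
    ∃ (t' τ' k' α' η' : ℝ) (Q' : Measure (Ω × Space N)) (_ : IsProbabilityMeasure Q')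
      (Xb' X' : RandVec N Q'), IsTouch T η₀ w t' τ' k' α' η' Xb' X' ∧
      penalty F ε θ τ X (α • (X - Xb)) + κ * ρ ^ 2 / 2
        < penalty F ε θ τ' X' (α' • (X' - Xb')) := by
  obtain ⟨hL, hK, he, hη₀, hδ, hδ1, hε, hρ, hκ, hκ1, hθ, hεδ, hρε, hρδ, hκC⟩ := hc
  set C := supNorm f with hCdef
  set P := α • (X - Xb) with hP
  have hPB : ‖P‖ ≤ K + 1 := h.norm_slope_le hwK hK hη₀
  have hρδ2 : κ * ρ ^ 2 ≤ δ ^ 2 := by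
    calc κ * ρ ^ 2 ≤ 1 * δ ^ 2 := by gcongr; linarith
      _ = _ := one_mul _
  -- Half of δ² comes from ε(K + 1)², the other half from κρ²/2 ≤ δ²/2.
  have hvδ : ∀ k, violation F θ τ X P k ≤ δ := fun k =>
    (abs_le_of_sq_le_sq ((violation_sq_le hε.le hPB hJ k).trans (by linarith)) hδ.le).trans'
      (le_abs_self _)
  have hv1 : ∀ k, violation F θ τ X P k ≤ 1 := fun k => (hvδ k).trans hδ1
  choose D hD hDP using fun k => exists_isSelection (hF k) X P
  set Z := ascent F ε θ τ X P D with hZ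
  obtain ⟨hs, hhs, o, hoδ, s1, s2, s3, ho, s4, s5⟩ :=
    StepConsts.exists_step (α := α) (k := k)
      (⟨hL, hK, he, hη₀, hδ, hδ1, hε, hρ, hκ, hκ1, hθ, hεδ, hρε, hρδ, hκC⟩ :
        StepConsts n C L K e θ η₀ δ ε ρ κ) ‖Z‖ (sub_pos.2 h.mem.2)
  obtain ⟨σ, hσ, t', η', Q', hQ', hj, Xb', X', u, htouch, htt, hu, hP', hub, hin⟩ :=
    h.exists_push hwK hK Z hκ hρ hhs s1 s2 s3
  set j := RandVec.pull hj with hjdef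
  set P' := (κ / hs) • (X' - Xb') with hP'def
  have hPB' : ‖P'‖ ≤ K + 1 := htouch.norm_slope_le hwK hK hη₀
  have hΔ : P' - j P = (κ / hs) • u := by rw [hP', add_sub_cancel_left]
  have hΔn : ‖P' - j P‖ ≤ 3 * κ * ρ := by
    rw [hΔ, norm_smul, Real.norm_of_nonneg (by positivity)]
    calc κ / hs * ‖u‖ ≤ κ / hs * (3 * ρ * hs) := by gcongr
      _ = _ := by field_simp
  have hY : ‖X' - j X‖ ≤ hs * (3 * ρ + ‖Z‖) := by
    have : X' - j X = u - σ • j Z := by rw [hu]; abel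
    rw [this]
    refine (norm_sub_le _ _).trans ?_
    rw [norm_smul, LinearIsometry.norm_map, Real.norm_of_nonneg hσ.1]
    have : σ * ‖Z‖ ≤ hs * ‖Z‖ := by gcongr; exact hσ.2
    linarith
  have hLY : L * (K + 1) * ‖X' - j X‖ ≤ L * (K + 1) * (hs * (3 * ρ + ‖Z‖)) := by gcongr
  have htau : (k + 1) * (t' - t) ≤ |k + 1| * (2 * √(κ * ρ ^ 2 * hs)) := by
    refine (le_abs_self _).trans ?_
    rw [abs_mul]
    gcongr
  have ho' : τ + (k + 1) * (t' - t) - τ + L * (K + 1) * ‖X' - j X‖ ≤ o := by linarith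
  have ho0 : 0 ≤ o := by rw [← ho]; positivity
  refine ⟨t', _, _, _, η', Q', hQ', Xb', X', htouch, ?_⟩
  rcases hσ.2.lt_or_eq with hlt | heq
  -- Interior σ: the linear term gains κρ², and the errors from o and from the squared slope change
  -- cost κρ²/8 each.
  · have h1 := penalty_ascent (ε := ε) (θ := θ) (τ := τ) (τ' := τ + (k + 1) * (t' - t)) (o := o)
      (B := K + 1) hF hε.le (X := j X) (P := j P) (X' := X') (P' := P') (D := fun k => j (D k))
      (fun k => (hD k).pull hj)
      (fun k => by rw [meanMin_pull (hF k), LinearIsometry.inner_map_map, hDP]) hPB' ho' ho0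
      (fun k => by rw [violation_pull hj hF]; exact hv1 k)
    rw [ascent_pull hj hF, penalty_pull hj hF, hΔ] at h1
    have h2 := hin hlt
    rw [← hΔ] at h1 h2
    have h3 : n * (2 * C ^ 2 * ‖P' - j P‖ ^ 2) ≤ κ * ρ ^ 2 / 8 := by
      calc n * (2 * C ^ 2 * ‖P' - j P‖ ^ 2) ≤ n * (2 * C ^ 2 * (3 * κ * ρ) ^ 2) := by gcongr
        _ = (144 * n * C ^ 2 * κ) * (κ * ρ ^ 2 / 8) := by ring
        _ ≤ 1 * (κ * ρ ^ 2 / 8) := by gcongr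
        _ = _ := one_mul _
    have h4 : 0 < κ * ρ ^ 2 := by positivity
    have h5 : inner ℝ (P' - j P) (ascent F ε θ τ (j X) (j P) fun k => j (D k))
      = inner ℝ (P' - j P) (j Z) := by rw [ascent_pull hj hF]
    linarith
  · exfalso
    -- Full shift σ = hs: copies conditioned on X' show that P, and then P', is almost a function of
    -- X'.
    obtain ⟨Q₂, hQ₂, j₁, j₂, h₁, h₂, R, Rv, hX12, hR, hRv, hcond, hle, hRvle⟩ :=
      exists_condCopies X' P'
    have hjP : α • (j X - j Xb) = j P := by rw [hP, map_smul, map_sub]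
    have hopt : ‖j Xb - j X‖ = wdist (lawOf (j Xb)) (lawOf (j X)) := by
      rw [← map_sub, LinearIsometry.norm_map, lawOf_pull, lawOf_pull,
        norm_sub_of_jointLaw_mem_optPlans h.opt]
    have hjZ : ascent F ε θ τ (j X) (j P) (fun k => j (D k)) = j Z := ascent_pull hj hF _ _ _ _
    have h1 := norm_sub_copies_sq_le (ε := ε) (θ := θ) (τ := τ) (α := α) (B := K + 1) (ρ := ρ) hF hL
      h.pos.le hhs (Xb := j Xb) (X := j X) (X' := X') (u := u) hopt
      (by rwa [hjP, LinearIsometry.norm_map]) (D := fun k => j (D k)) (fun k => (hD k).pull hj)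
      (fun k => by rw [hjP, meanMin_pull (hF k), LinearIsometry.inner_map_map, hDP])
      (fun k => by rw [hjP, violation_pull hj hF]; exact hv1 k)
      (by rw [hjP, hjZ, hu, heq]) hub
      (by rw [hjP, hjZ, LinearIsometry.norm_map]; exact s5) h₁ h₂ hX12
    rw [hjP] at h1
    have h2 : ‖RandVec.pull h₁ (j P) - RandVec.pull h₂ (j P)‖ ≤ δ := by
      refine (abs_le_of_sq_le_sq ?_ hδ.le).trans' (le_abs_self _)
      have h3 : 2 * ε * ‖RandVec.pull h₁ (j P) - RandVec.pull h₂ (j P)‖ ^ 2 ≤ 2 * ε * δ ^ 2 := by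
        have : 0 ≤ ρ * (K + 1) := by positivity
        linarith
      exact le_of_mul_le_mul_left h3 (by positivity)
    have h3 : 6 * κ * ρ ≤ δ := by
      have : κ * ρ ≤ 1 * ρ := by gcongr
      linarith
    have h4 : ‖P' - Rv‖ ≤ 2 * δ := by
      refine hle.trans ?_
      have e1 : RandVec.pull h₁ P' - RandVec.pull h₂ P' = RandVec.pull h₁ (j P)
          - RandVec.pull h₂ (j P) + (RandVec.pull h₁ (P' - j P) - RandVec.pull h₂ (P' - j P)) := by
        simp only [map_sub]; abel
      rw [e1]
      refine (norm_add_le _ _).trans ?_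
      have e2 := norm_sub_le (RandVec.pull h₁ (P' - j P)) (RandVec.pull h₂ (P' - j P))
      rw [LinearIsometry.norm_map, LinearIsometry.norm_map] at e2
      linarith
    have h5 : ‖Rv - j P‖ ≤ 3 * δ := by
      rw [show Rv - j P = (P' - j P) - (P' - Rv) by abel]
      refine (norm_sub_le _ _).trans ?_
      linarith
    have hRvB : ‖Rv‖ ≤ K + 1 := hRvle.trans hPB'
    -- The conditional slope is within 3δ of the old slope, where all violations are at most δ; the
    -- total error stays below θ by `theta_gt`, contradicting the subsolution inequality.
    have h6 := htouch.neg_le hw hF he hup hR hRv hcond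
      (c := δ - τ - θ + L * (K + 1) * ‖X' - j X‖ + C * (3 * δ) + e * (K + 1)) (fun i => by
        have g1 := meanMin_le_add (hF i) (j X) (j P) X' Rv
        rw [meanMin_pull (hF i)] at g1
        have g2 : τ + meanMin (F i) X P + θ ≤ δ := (le_max_left _ _).trans (hvδ i)
        have g3 : L * (‖X' - j X‖ * ‖Rv‖) ≤ L * (K + 1) * ‖X' - j X‖ := by
          calc _ ≤ L * (‖X' - j X‖ * (K + 1)) := by gcongr
            _ = _ := by ring
        have g4 : C * ‖Rv - j P‖ ≤ C * (3 * δ) := by gcongr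
        have g5 : e * ‖Rv‖ ≤ e * (K + 1) := by gcongr
        linarith)
    have h7 : C * η' ≤ C * η₀ := by have := htouch.eta_lt.le; gcongr
    rw [← hCdef] at h6
    linarith

/-- There is no touching point at which all the differential inequalities fail. -/
theorem IsTouch.false_of_violation {Ω : Type*} [MeasurableSpace Ω] {Q : Measure Ω}
    [IsProbabilityMeasure Q] (hw : IsSubsolution T f w)
    (hwK : LipStrip T K w) (hF : ∀ k, IsLipFamily (F k) (supNorm f) L) (hC : 0 ≤ supNorm f)
    (hup : ∀ (ν : WSpace N) (R : Space N → Space N) (c : ℝ), MemLp R 2 ν.meas →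
        (∀ k, ∫ x, minInner (fun i => F k i x) (R x) ∂ν.meas + e * ∫ x, ‖R x‖ ∂ν.meas ≤ c) →
        hamiltonian f ν R ≤ c)
    (hc : StepConsts n (supNorm f) L K e θ η₀ δ ε ρ κ) {t τ k α η : ℝ} {Xb X : RandVec N Q}
    (h : IsTouch T η₀ w t τ k α η Xb X)
    (h0 : ∀ i, τ + meanMin (F i) X (α • (X - Xb)) + θ ≤ 0) : False := by
  -- Pushing enlarges the probability space each time. Transferring every touching point to its
  -- joint law on one fixed standard Borel space makes a supremum over all of them meaningful.
  let S : Set ℝ := {J | ∃ (t τ k α η : ℝ) (π : Measure (Space N × Space N))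
    (_ : IsProbabilityMeasure π) (Yb Y : RandVec N π), IsTouch T η₀ w t τ k α η Yb Y ∧
    penalty F ε θ τ Y (α • (Y - Yb)) = J}
  have hbdd : BddAbove S := by
    refine ⟨ε * (K + 1) ^ 2, ?_⟩
    rintro _ ⟨t, τ, k, α, η, π, hπ, Yb, Y, hY, rfl⟩
    exact penalty_le hc.eps_pos.le (hY.norm_slope_le hwK hc.K_nonneg hc.eta_le)
  have hmem : ∀ {Ω : Type _} [MeasurableSpace Ω] {Q : Measure Ω} [IsProbabilityMeasure Q]
      {t τ k α η : ℝ} {Xb X : RandVec N Q}, IsTouch T η₀ w t τ k α η Xb X →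
      penalty F ε θ τ X (α • (X - Xb)) ∈ S := by
    intro Ω _ Q _ t τ k α η Xb X h
    obtain ⟨π, hπ, Yb, Y, hY, he⟩ := h.exists_plan (ε := ε) (θ := θ) hF
    exact ⟨t, τ, k, α, η, π, hπ, Yb, Y, hY, he⟩
  have hJ0 : 0 ≤ penalty F ε θ τ X (α • (X - Xb)) := by
    have h1 : ∀ i, violation F θ τ X (α • (X - Xb)) i = 0 := fun i => max_eq_right (h0 i)
    have := hc.eps_pos
    simp only [penalty, h1]
    simp
    positivity
  have hβ : 0 < κ * ρ ^ 2 := mul_pos hc.kappa_pos (pow_pos hc.rho_pos 2)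
  obtain ⟨π, hπ, Yb, Y, hY, he⟩ := h.exists_plan (ε := ε) (θ := θ) hF
  have hS0 : 0 ≤ sSup S := hJ0.trans (le_csSup hbdd ⟨_, _, _, _, _, π, hπ, Yb, Y, hY, he⟩)
  -- A point within κρ²/2 of the supremum is improved by more than κρ²/2. Its penalty is at least
  -- -κρ²/2 because the supremum is nonnegative.
  obtain ⟨J, ⟨t, τ, k, α, η, π, hπ, Yb, Y, hY, rfl⟩, hJ⟩ := exists_lt_of_lt_csSup
    (⟨_, ⟨_, _, _, _, _, π, hπ, Yb, Y, hY, he⟩⟩ : S.Nonempty)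
    (show sSup S - κ * ρ ^ 2 / 2 < sSup S by linarith)
  obtain ⟨t', τ', k', α', η', Q', hQ', Xb', X', h', hlt⟩ :=
    hY.exists_penalty_gt hw hwK hF hC hup hc (by linarith)
  have := le_csSup hbdd (hmem h')
  linarith

end Improve

/-! ### Doubling of variables and the comparison principle -/

section Comparison

theorem exists_stepConsts {C L K e θ η₀ δ : ℝ} (hL : 0 ≤ L) (hK : 0 ≤ K) (he : 0 ≤ e)
    (hη : η₀ ≤ 1) (hδ : 0 < δ) (hδ1 : δ ≤ 1) (hθ : C * η₀ + e * (K + 1) + δ * (2 + 3 * C) < θ)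
    (n : ℕ) : ∃ ε ρ κ, StepConsts n C L K e θ η₀ δ ε ρ κ := by
  have hB : 0 < K + 1 := by linarith
  set ε := δ ^ 2 / (2 * (K + 1) ^ 2) with hε
  have hε0 : 0 < ε := by positivity
  refine ⟨ε, min (δ / 6) (ε * δ ^ 2 / (7 * (K + 1))), 1 / (144 * n * C ^ 2 + 1), hL, hK, he, hη, hδ,
    hδ1, hε0, by positivity, by positivity, ?_, hθ, ?_, ?_, ?_, ?_⟩
  · rw [div_le_one (by positivity)]
    have : 0 ≤ 144 * n * C ^ 2 := by positivity
    linarith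
  · rw [hε]
    field_simp
    rfl
  · have h1 := min_le_right (δ / 6) (ε * δ ^ 2 / (7 * (K + 1)))
    rw [le_div_iff₀ (by positivity)] at h1
    linarith
  · have h1 := min_le_left (δ / 6) (ε * δ ^ 2 / (7 * (K + 1)))
    linarith
  · rw [mul_one_div, div_le_one (by positivity)]
    linarith

variable {N : ℕ}

theorem LipStrip.mono {T K K' : ℝ} {w : ℝ → WSpace N → ℝ} (h : LipStrip T K w) (hK : K ≤ K') :
    LipStrip T K' w := fun s hs t ht μ ν => (h s hs t ht μ ν).trans (by
  have := wdist_nonneg μ ν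
  gcongr)

/-- The doubling of variables. -/
theorem exists_doubling {T K A lam η : ℝ} {w₁ w₂ : ℝ → WSpace N → ℝ} (hK : 0 ≤ K)
    (h₁ : LipStrip T K w₁) (h₂ : LipStrip T K w₂) (hT : ∀ μ, w₁ T μ ≤ w₂ T μ)
    (hA : 0 < A) (hlam : 0 ≤ lam) (hη : 0 < η) {t₀ : ℝ} (ht₀ : t₀ ∈ Set.Icc (0 : ℝ) T)
    (μ₀ : WSpace N) :
    ∃ t ∈ Set.Icc (0 : ℝ) T, ∃ s ∈ Set.Icc (0 : ℝ) T, ∃ μ ν : WSpace N,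
      w₁ t₀ μ₀ - w₂ t₀ μ₀ + lam * (t₀ - T) ≤ w₁ t μ - w₂ s ν ∧
      (∀ t' ∈ Set.Icc (0 : ℝ) T, ∀ μ', w₁ t' μ' - A / 2 * wdist ν μ' ^ 2 - A / 2 * (t' - s) ^ 2
        + lam * t' ≤ w₁ t μ - A / 2 * wdist ν μ ^ 2 - A / 2 * (t - s) ^ 2 + lam * t
          + η * wdist μ μ') ∧
      (∀ s' ∈ Set.Icc (0 : ℝ) T, ∀ ν', w₂ s ν + A / 2 * wdist μ ν ^ 2 + A / 2 * (t - s) ^ 2 ≤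
        w₂ s' ν' + A / 2 * wdist μ ν' ^ 2 + A / 2 * (t - s') ^ 2 + η * wdist ν ν') := by
  let Φ : (Set.Icc (0 : ℝ) T × Set.Icc (0 : ℝ) T) → WSpace N × WSpace N → ℝ := fun a x =>
    w₁ a.1 x.1 - w₂ a.2 x.2 - A / 2 * wdist x.1 x.2 ^ 2 - A / 2 * ((a.1 : ℝ) - a.2) ^ 2
      + lam * (a.1 - T)
  have hΦ : Continuous fun z : (Set.Icc (0 : ℝ) T × Set.Icc (0 : ℝ) T) × (WSpace N × WSpace N) =>
      Φ z.1 z.2 := by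
    have e1 : Continuous fun z : (Set.Icc (0 : ℝ) T × Set.Icc (0 : ℝ) T) × (WSpace N × WSpace N) =>
        w₁ z.1.1 z.2.1 := (h₁.continuous hK).comp
      (by fun_prop : Continuous fun z : (Set.Icc (0 : ℝ) T × Set.Icc (0 : ℝ) T) ×
        (WSpace N × WSpace N) => (z.1.1, z.2.1))
    have e2 : Continuous fun z : (Set.Icc (0 : ℝ) T × Set.Icc (0 : ℝ) T) × (WSpace N × WSpace N) =>
        w₂ z.1.2 z.2.2 := (h₂.continuous hK).comp
      (by fun_prop : Continuous fun z : (Set.Icc (0 : ℝ) T × Set.Icc (0 : ℝ) T) ×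
        (WSpace N × WSpace N) => (z.1.2, z.2.2))
    have e3 : Continuous fun z : (Set.Icc (0 : ℝ) T × Set.Icc (0 : ℝ) T) × (WSpace N × WSpace N) =>
        wdist z.2.1 z.2.2 := continuous_wdist.comp continuous_snd
    exact (((e1.sub e2).sub (continuous_const.mul (e3.pow 2))).sub (by fun_prop)).add (by fun_prop)
  have hTm : T ∈ Set.Icc (0 : ℝ) T := ⟨ht₀.1.trans ht₀.2, le_rfl⟩
  -- Both functions are compared at time T; the remaining growth K d is absorbed by the quadratic
  -- penalty.
  have hB : ∀ a x, Φ a x ≤ 2 * (K * T) + K ^ 2 / (2 * A) := by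
    intro a x
    have e1 := (abs_le.1 (h₁ a.1 a.1.2 T hTm x.1 x.1)).2
    have e2 := (abs_le.1 (h₂ T hTm a.2 a.2.2 x.1 x.2)).2
    have e3 := hT x.1
    rw [wdist_self, add_zero] at e1
    have e4 : K * |(a.1 : ℝ) - T| ≤ K * T := by
      gcongr
      rw [abs_le]
      constructor <;> linarith [a.1.2.1, a.1.2.2]
    have e5 : K * |T - (a.2 : ℝ)| ≤ K * T := by
      gcongr
      rw [abs_le]
      constructor <;> linarith [a.2.2.1, a.2.2.2]
    have e6 : K * wdist x.1 x.2 - A / 2 * wdist x.1 x.2 ^ 2 ≤ K ^ 2 / (2 * A) := by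
      rw [le_div_iff₀ (by positivity)]
      nlinarith [sq_nonneg (K - A * wdist x.1 x.2)]
    have e7 : 0 ≤ A / 2 * ((a.1 : ℝ) - a.2) ^ 2 := by positivity
    have e8 : lam * ((a.1 : ℝ) - T) ≤ 0 :=
      mul_nonpos_of_nonneg_of_nonpos hlam (by linarith [a.1.2.2])
    simp only [Φ]
    linarith
  obtain ⟨⟨t, s⟩, ⟨μ, ν⟩, hle, hmax⟩ :=
    exists_ekeland_param hΦ hB hη (⟨t₀, ht₀⟩, ⟨t₀, ht₀⟩) (μ₀, μ₀)
  refine ⟨t, t.2, s, s.2, μ, ν, ?_, ?_, ?_⟩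
  · simp only [Φ, wdist_self, sub_self] at hle
    have e1 : 0 ≤ A / 2 * ((t : ℝ) - s) ^ 2 := by positivity
    have e2 : 0 ≤ A / 2 * wdist μ ν ^ 2 := by positivity
    have e3 : lam * ((t : ℝ) - T) ≤ 0 :=
      mul_nonpos_of_nonneg_of_nonpos hlam (by linarith [t.2.2])
    linarith
  · intro t' ht' μ'
    have e := hmax (⟨t', ht'⟩, s) (μ', ν)
    have e1 : dist (μ, ν) (μ', ν) = wdist μ μ' := by
      rw [Prod.dist_eq, dist_self, max_eq_left dist_nonneg, dist_eq_wdist]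
    rw [e1] at e
    simp only [Φ] at e
    rw [wdist_comm ν, wdist_comm ν]
    linarith
  · intro s' hs' ν'
    have e := hmax (t, ⟨s', hs'⟩) (μ, ν')
    have e1 : dist (μ, ν) (μ, ν') = wdist ν ν' := by
      rw [Prod.dist_eq, dist_self, max_eq_right dist_nonneg, dist_eq_wdist]
    rw [e1] at e
    simp only [Φ] at e
    linarith

variable {EU EV : Type*} [NormedAddCommGroup EU] [MeasurableSpace EU]
    [NormedAddCommGroup EV] [MeasurableSpace EV] {U : Set EU} {V : Set EV}
    {f : Space N → U → V → Space N}

/-- The supersolution inequality, tested with the conditional expectation of the slope. -/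
theorem IsSupersolution.meanMin_le {T : ℝ} {w : ℝ → WSpace N → ℝ} (hw : IsSupersolution T f w)
    {n : ℕ} {I : Type*} [Finite I] [Nonempty I] {F : Fin n → I → Space N → Space N} {C L e : ℝ}
    (hF : ∀ k, IsLipFamily (F k) C L) (he : 0 ≤ e)
    (hlow : ∀ (ν : WSpace N) (R : Space N → Space N), MemLp R 2 ν.meas → ∀ k,
        ∫ x, minInner (fun i => F k i x) (R x) ∂ν.meas - e * ∫ x, ‖R x‖ ∂ν.meas
          ≤ hamiltonian f ν R)
    {Ω : Type*} [MeasurableSpace Ω] [StandardBorelSpace Ω] {Q : Measure Ω} [IsProbabilityMeasure Q]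
    {X Y : RandVec N Q} (hopt : jointLaw X Y ∈ optPlans (lawOf X) (lawOf Y)) {A η t s : ℝ}
    (hA : 0 < A) (hη : 0 < η) (hs : s ∈ Set.Ico (0 : ℝ) T)
    (h : ∀ s' ∈ Set.Icc (0 : ℝ) T, ∀ ν', w s (lawOf Y) + A / 2 * wdist (lawOf X) (lawOf Y) ^ 2
        + A / 2 * (t - s) ^ 2 ≤
        w s' ν' + A / 2 * wdist (lawOf X) ν' ^ 2 + A / 2 * (t - s') ^ 2 + η * wdist (lawOf Y) ν')
    (k : Fin n) :
    A * (t - s) + meanMin (F k) Y (A • (X - Y)) ≤ supNorm f * η + e * ‖A • (X - Y)‖ := by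
  obtain ⟨-, -, -, -, -, -, R, Rv, -, hR, hRv, hcond, -, hRvle⟩ := exists_condCopies Y (A • (X - Y))
  -- The constant -A expresses A(X - Y) as a multiple of Y - X, which accounts for the sign in the
  -- supersolution inequality.
  have hc : ∀ ξ : Space N → Space N, MemLp ξ 2 (lawOf Y).meas →
      ∫ a, inner ℝ (ξ (Y a)) (((-A) • (Y - X)) a) ∂Q
        = ∫ y, inner ℝ (ξ y) (R y) ∂(lawOf Y).meas := by
    rw [show (-A) • (Y - X) = A • (X - Y) by module]
    exact hcond
  have hp := isPlanGradient_jointLaw X Y (-A) (neg_ne_zero.2 hA.ne') hR hc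
  have hd : HasDerivAt (fun s' : ℝ => -(A / 2 * (t - s') ^ 2)) (A * (t - s)) s := by
    have e1 := ((((hasDerivAt_id s).const_sub t).pow 2).const_mul (A / 2)).neg
    refine e1.congr_deriv ?_
    simp
    ring
  have h1 := hw.2 (fun s' => -(A / 2 * (t - s') ^ 2)) A η (lawOf X) (lawOf Y) s (by fun_prop) hA hη
    hs ⟨1, one_pos, fun s' hs' μ _ _ => by
      have e1 := h s' hs' μ
      have e2 := wdist_self (lawOf Y)
      simp only [e2]
      linarith⟩ _ hopt _ hp
  have h2 : (fun y => A • -((-A)⁻¹ • R y)) = R := by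
    funext y
    rw [inv_neg, neg_smul, neg_neg, smul_smul, mul_inv_cancel₀ hA.ne', one_smul]
  rw [hd.deriv, h2] at h1
  have h3 := hlow _ R hR k
  -- Jensen works in the favourable direction here: the conditional expectation only increases the
  -- minimum functional.
  have h4 := meanMin_le_integral_condExp (hF k) hR hcond
  have h5 : e * ∫ x, ‖R x‖ ∂(lawOf Y).meas ≤ e * ‖A • (X - Y)‖ := by
    gcongr
    exact (integral_norm_lawOf_le hR hRv).trans hRvle
  linarith

theorem jointLaw_swap_mem_optPlans {Ω : Type*} [MeasurableSpace Ω] {Q : Measure Ω}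
    [IsProbabilityMeasure Q] {X Y : RandVec N Q}
    (h : jointLaw X Y ∈ optPlans (lawOf X) (lawOf Y)) :
    jointLaw Y X ∈ optPlans (lawOf Y) (lawOf X) := by
  refine mem_optPlans_of_transportCost_le (jointLaw_mem_plans Y X) ?_
  rw [transportCost_jointLaw, norm_sub_rev, norm_sub_of_jointLaw_mem_optPlans h, wdist_comm]

/-- The comparison principle. -/
theorem comparison [CompactSpace U] [CompactSpace V] [Nonempty U] [Nonempty V]
    [BorelSpace EU] [BorelSpace EV] {T L : ℝ} (hT : 0 < T)
    (hf_bdd : ∃ C : ℝ, ∀ x u v, ‖f x u v‖ ≤ C)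
    (hf_uc : UniformContinuous (fun z : Space N × U × V => f z.1 z.2.1 z.2.2)) (hL : 0 ≤ L)
    (hf_lip : ∀ u v x y, ‖f x u v - f y u v‖ ≤ L * ‖x - y‖)
    {w₁ w₂ : ℝ → WSpace N → ℝ} (hw₁ : IsSubsolution T f w₁) (hw₂ : IsSupersolution T f w₂)
    (hend : ∀ μ, w₁ T μ ≤ w₂ T μ) {t₀ : ℝ} (ht₀ : t₀ ∈ Set.Icc (0 : ℝ) T) (μ₀ : WSpace N) :
    w₁ t₀ μ₀ ≤ w₂ t₀ μ₀ := by
  by_contra! hlt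
  obtain ⟨K, hK, hK₁, hK₂⟩ : ∃ K, 0 ≤ K ∧ LipStrip T K w₁ ∧ LipStrip T K w₂ := by
    obtain ⟨K₁, h1, h2⟩ := LipschitzOnStrip.exists_nonneg hw₁.1
    obtain ⟨K₂, h3, h4⟩ := LipschitzOnStrip.exists_nonneg hw₂.1
    exact ⟨max K₁ K₂, h1.trans (le_max_left _ _), h2.mono (le_max_left _ _),
      h4.mono (le_max_right _ _)⟩
  set C := supNorm f with hCdef
  have hC : 0 ≤ C := Real.iSup_nonneg fun _ => norm_nonneg _
  set m := w₁ t₀ μ₀ - w₂ t₀ μ₀ with hm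
  have hm0 : 0 < m := sub_pos.2 hlt
  -- The tilt lam·(t - T) costs at most m/2 of the gap m and supplies the strict margin lam = 2θ;
  -- the quarters of θ below pay for the individual errors.
  set lam := m / (2 * T) with hlam
  have hlam0 : 0 < lam := by positivity
  set θ := lam / 2 with hθ
  have hθ0 : 0 < θ := by positivity
  obtain ⟨η₀, hη0, hη1, hηC⟩ : ∃ η₀ : ℝ, 0 < η₀ ∧ η₀ ≤ 1 ∧ C * η₀ ≤ θ / 4 := by
    refine ⟨min 1 (θ / 4 / (C + 1)), by positivity, min_le_left _ _, ?_⟩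
    have h1 := min_le_right 1 (θ / 4 / (C + 1))
    rw [le_div_iff₀ (by positivity)] at h1
    have h2 : 0 ≤ min 1 (θ / 4 / (C + 1)) := by positivity
    linarith
  obtain ⟨δ, hδ0, hδ1, hδC⟩ : ∃ δ : ℝ, 0 < δ ∧ δ ≤ 1 ∧ δ * (2 + 3 * C) ≤ θ / 4 := by
    refine ⟨min 1 (θ / 4 / (2 + 3 * C)), by positivity, min_le_left _ _, ?_⟩
    have h1 := min_le_right 1 (θ / 4 / (2 + 3 * C))
    rwa [le_div_iff₀ (by positivity)] at h1
  set e := θ / 4 / (K + 1) with he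
  have he0 : 0 < e := by positivity
  have heK : e * (K + 1) = θ / 4 := by rw [he]; field_simp
  obtain ⟨n, l, F, hF, hup, hlow⟩ := exists_hamiltonian_net hf_bdd hf_uc hL hf_lip he0
  obtain ⟨ε, ρ, κ, hconsts⟩ := exists_stepConsts (C := C) (θ := θ) hL hK he0.le hη1 hδ0 hδ1
    (by linarith) n
  -- The first bound keeps the doubled point away from the terminal time; the second makes the
  -- x-dependence error L‖X - Y‖‖P‖ at most θ/4.
  obtain ⟨A, hA0, hA1, hA2⟩ : ∃ A : ℝ, 0 < A ∧ K * (3 * K + 2 * lam + 1) < A * (m / 2) ∧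
      L * (K + 1) * (K + 1) ≤ A * (θ / 4) := by
    have e1 : 0 ≤ K * (3 * K + 2 * lam + 1) / (m / 2) := by positivity
    have e2 : 0 ≤ L * (K + 1) * (K + 1) / (θ / 4) := by positivity
    refine ⟨1 + K * (3 * K + 2 * lam + 1) / (m / 2) + L * (K + 1) * (K + 1) / (θ / 4),
      by positivity, ?_, ?_⟩
    · rw [← div_lt_iff₀ (by positivity)]
      linarith
    · rw [← div_le_iff₀ (by positivity)]
      linarith
  have hη : 0 < η₀ / 2 := by positivity
  obtain ⟨t, ht, s, hs, μ, ν, hval, hmax, hmin⟩ :=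
    exists_doubling hK hK₁ hK₂ hend hA0 hlam0.le hη ht₀ μ₀
  have hval' : m / 2 ≤ w₁ t μ - w₂ s ν := by
    have e1 : lam * T = m / 2 := by rw [hlam]; field_simp
    have e2 : 0 ≤ lam * t₀ := mul_nonneg hlam0.le ht₀.1
    linarith
  obtain ⟨π, hπ⟩ := optPlans_nonempty μ ν
  have hprob := isProbabilityMeasure_of_mem_plans hπ.1
  obtain ⟨X, Y, rfl, rfl, hopt⟩ : ∃ X Y : RandVec N π, lawOf X = μ ∧ lawOf Y = ν ∧
      jointLaw X Y ∈ optPlans (lawOf X) (lawOf Y) :=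
    ⟨planFst hπ.1, planSnd hπ.1, lawOf_planFst _, lawOf_planSnd _, by
      rwa [lawOf_planFst, lawOf_planSnd, jointLaw_planFst_planSnd]⟩
  have htouch : TouchAt T w₁ t (A * (t - s) - lam) A A (η₀ / 2) (lawOf Y) (lawOf X) := by
    intro s' hs' ν'
    have e1 := hmax s' hs' ν'
    have e2 : (s' - s) ^ 2 = (s' - t) ^ 2 + 2 * (s' - t) * (t - s) + (t - s) ^ 2 := by ring
    rw [e2] at e1
    linarith
  have hopt' := jointLaw_swap_mem_optPlans hopt
  have hP : ‖A • (X - Y)‖ ≤ K + 1 :=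
    (htouch.slope_le hK₁ ht hA0 hη.le hK hopt').trans (by linarith)
  have hXY : A * ‖X - Y‖ ≤ K + 1 := by
    rwa [norm_smul, Real.norm_of_nonneg hA0.le] at hP
  have hd : wdist (lawOf X) (lawOf Y) = ‖X - Y‖ := (norm_sub_of_jointLaw_mem_optPlans hopt).symm
  -- Compare with the competitor t' = s at the same measure, which removes the time penalty.
  have hts : A * |t - s| ≤ 2 * (K + lam) := by
    have e1 := hmax s hs (lawOf X)
    have e2 := (abs_le.1 (hK₁ t ht s hs (lawOf X) (lawOf X))).2
    rw [wdist_self, mul_zero] at e1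
    rw [wdist_self, add_zero] at e2
    rw [sub_self] at e1
    have e3 : lam * (t - s) ≤ lam * |t - s| := by gcongr; exact le_abs_self _
    have e4 : |t - s| * (A * |t - s|) ≤ |t - s| * (2 * (K + lam)) := by
      have : |t - s| * |t - s| = (t - s) ^ 2 := by rw [← sq, sq_abs]
      nlinarith
    rcases (abs_nonneg (t - s)).eq_or_lt with h0 | h0
    · rw [← h0, mul_zero]; positivity
    · exact le_of_mul_le_mul_left e4 h0
  have hgap : K * (|t - s| + ‖X - Y‖) < m / 2 := by
    have e1 : A * (K * (|t - s| + ‖X - Y‖)) < A * (m / 2) := by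
      have : K * (A * |t - s| + A * ‖X - Y‖) ≤ K * (2 * (K + lam) + (K + 1)) := by gcongr
      linarith
    exact lt_of_mul_lt_mul_left e1 hA0.le
  have htT : t < T := by
    refine lt_of_le_of_ne ht.2 fun h => ?_
    have e1 := (abs_le.1 (hK₂ t ht s hs (lawOf X) (lawOf Y))).2
    have e2 := hend (lawOf X)
    rw [← h] at e2
    rw [hd] at e1
    linarith
  have hsT : s < T := by
    refine lt_of_le_of_ne hs.2 fun h => ?_
    have e1 := (abs_le.1 (hK₁ t ht s hs (lawOf X) (lawOf Y))).2
    have e2 := hend (lawOf Y)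
    rw [← h] at e2
    rw [hd] at e1
    linarith
  have hXYL : L * (‖X - Y‖ * ‖A • (X - Y)‖) ≤ θ / 4 := by
    have e1 : A * (L * (‖X - Y‖ * ‖A • (X - Y)‖)) ≤ A * (θ / 4) := by
      calc A * (L * (‖X - Y‖ * ‖A • (X - Y)‖)) = L * (A * ‖X - Y‖) * ‖A • (X - Y)‖ := by ring
        _ ≤ L * (K + 1) * (K + 1) := by gcongr
        _ ≤ _ := hA2
    exact le_of_mul_le_mul_left e1 hA0
  -- The supersolution inequality is moved from Y to X with the same slope; the term -lam in the
  -- time slope then makes every inequality of the subsolution fail by θ.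
  refine IsTouch.false_of_violation hw₁ hK₁ hF hC hup hconsts
    (⟨⟨ht.1, htT⟩, hA0, hη, by linarith, hopt', htouch⟩ :
      IsTouch T η₀ w₁ t (A * (t - s) - lam) A A (η₀ / 2) Y X) fun k => ?_
  have e1 := hw₂.meanMin_le hF he0.le hlow hopt hA0 hη ⟨hs.1, hsT⟩ hmin k
  have e2 := meanMin_le_add (hF k) Y (A • (X - Y)) X (A • (X - Y))
  simp only [sub_self, norm_zero, mul_zero, add_zero] at e2
  have e3 : e * ‖A • (X - Y)‖ ≤ e * (K + 1) := by gcongr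
  have e4 : C * (η₀ / 2) ≤ C * η₀ := by gcongr; linarith
  linarith

end Comparison

end

theorem mainTheorem4 {N : ℕ} {EU EV : Type*}
    [NormedAddCommGroup EU] [NormedSpace ℝ EU] [FiniteDimensional ℝ EU]
    [MeasurableSpace EU] [BorelSpace EU]
    [NormedAddCommGroup EV] [NormedSpace ℝ EV] [FiniteDimensional ℝ EV]
    [MeasurableSpace EV] [BorelSpace EV]
    (T : ℝ) (hT : 0 < T)
    (U : Set EU) (hU : IsCompact U) (hU0 : U.Nonempty)
    (V : Set EV) (hV : IsCompact V) (hV0 : V.Nonempty)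
    (f : Space N → U → V → Space N)
    (hf_bdd : ∃ C : ℝ, ∀ x u v, ‖f x u v‖ ≤ C)
    (hf_uc : UniformContinuous (fun z : Space N × U × V => f z.1 z.2.1 z.2.2))
    (hf_lip : ∃ K : ℝ, ∀ u v x y, ‖f x u v - f y u v‖ ≤ K * ‖x - y‖) :
    (∀ w₁ w₂ : ℝ → WSpace N → ℝ,
      IsSubsolution T f w₁ → IsSupersolution T f w₂ →
      (∀ μ, w₁ T μ ≤ w₂ T μ) →
      ∀ t ∈ Set.Icc (0 : ℝ) T, ∀ μ, w₁ t μ ≤ w₂ t μ) ∧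
    (∀ g : WSpace N → ℝ, LipschitzOnW g →
      ∀ w w' : ℝ → WSpace N → ℝ,
        IsSolution T f w → IsSolution T f w' →
        (∀ μ, w T μ = g μ) → (∀ μ, w' T μ = g μ) →
        ∀ t ∈ Set.Icc (0 : ℝ) T, ∀ μ, w t μ = w' t μ) := by
  have hcU : CompactSpace U := isCompact_iff_compactSpace.1 hU
  have hcV : CompactSpace V := isCompact_iff_compactSpace.1 hV
  have hnU : Nonempty U := hU0.to_subtype
  have hnV : Nonempty V := hV0.to_subtype
  obtain ⟨L, hL⟩ := hf_lip
  have hL' : ∀ u v x y, ‖f x u v - f y u v‖ ≤ |L| * ‖x - y‖ := fun u v x y =>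
    (hL u v x y).trans (by gcongr; exact le_abs_self L)
  have key : ∀ w₁ w₂ : ℝ → WSpace N → ℝ, IsSubsolution T f w₁ → IsSupersolution T f w₂ →
      (∀ μ, w₁ T μ ≤ w₂ T μ) → ∀ t ∈ Set.Icc (0 : ℝ) T, ∀ μ, w₁ t μ ≤ w₂ t μ :=
    fun w₁ w₂ h₁ h₂ hend t ht μ =>
      comparison hT hf_bdd hf_uc (abs_nonneg L) hL' h₁ h₂ hend ht μ
  refine ⟨key, fun g _ w w' hw hw' hg hg' t ht μ => le_antisymm ?_ ?_⟩
  · exact key w w' hw.1 hw'.2 (fun ν => by rw [hg, hg']) t ht μ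
  · exact key w' w hw'.1 hw.2 (fun ν => by rw [hg, hg']) t ht μ
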